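/- Let $N$ be a random real $3\times 3$ matrix with i.i.d. $\mathcal N(0,1)$ entries and, for $\sigma>0$, let $M=M_\sigma=I+\sigma N$. For a real $3\times3$ matrix $M$ with singular value decomposition $M=U\Sigma V^{\top}$ put $\mathrm{SVDO}^+(M)=U\,\mathrm{diag}(1,1,\det(UV^{\top}))\,V^{\top}$, let $J(M)\in\mathbb R^{9\times 9}$ be the Jacobian of $M\mapsto \mathrm{SVDO}^+(M)$, and let $\kappa(M)$ be the ratio of the largest to the smallest nonzero singular value of $J(M)$. Let $c_3=\frac32\sqrt{\frac3\pi}$, and let $\mathbb E[\kappa]$ denote the conditional expectation $\mathbb E[\kappa(M_\sigma)\mid \det M_\sigma>0]$. Then: 1. Whenever $\det M>0$, $\kappa(M)=\dfrac{s_1+s_2}{s_2+s_3}$, where $s_1\ge s_2\ge s_3$ are the singular values of $M$. 2. $c_3$ is the expected largest eigenvalue of the $3\times 3$ GOE matrix $W=(N+N^{\top})/2$ (whose largest eigenvalue is integrable). 3. $\mathbb P(\det M_\sigma>0)\to 1$ as $\sigma\to0^+$; for every $\sigma>0$ this probability is positive, and $\mathbb E[\kappa]$ is finite. 4. To leading order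 in $\sigma$, $\mathbb E[\kappa]$ is given by $\dfrac{2+\sigma c_3}{2-\sigma c_3}$; that is, as $\sigma\to0^+$, $$\mathbb E[\kappa]=\frac{2+\sigma c_3}{2-\sigma c_3}+O(\sigma^2),\qquad \mathbb E[\kappa]=1+\sigma c_3+O(\sigma^2).$$ 5. The approximating expression $\dfrac{2+\sigma c_3}{2-\sigma c_3}$ tends to $+\infty$ as $\sigma$ increases to $2/c_3=\frac43\sqrt{\pi/3}$. -/

import Mathlib

open Filter Topology Asymptotics MeasureTheory ProbabilityTheory

noncomputable section

/-- `M = U diag(s) Vᵀ` is a singular value decomposition of the real `3 × 3` matrix `M`: `U`, `V` are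
orthogonal and `s 0 ≥ s 1 ≥ s 2 ≥ 0`. -/
def IsSVD (M U : Matrix (Fin 3) (Fin 3) ℝ) (s : Fin 3 → ℝ) (V : Matrix (Fin 3) (Fin 3) ℝ) : Prop :=
  U ∈ Matrix.orthogonalGroup (Fin 3) ℝ ∧ V ∈ Matrix.orthogonalGroup (Fin 3) ℝ ∧
    Antitone s ∧ (∀ i, 0 ≤ s i) ∧ M = U * Matrix.diagonal s * V.transpose

/-- The special orthogonalization `SVDO⁺(M) = U diag(1, 1, det(U Vᵀ)) Vᵀ`, where `M = U Σ Vᵀ` is a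
singular value decomposition. The value does not depend on the decomposition when `det M > 0`;
otherwise some decomposition is chosen. -/
def svdOrthogonalization (M : Matrix (Fin 3) (Fin 3) ℝ) : Matrix (Fin 3) (Fin 3) ℝ :=
  Classical.epsilon fun R => ∃ (U V : Matrix (Fin 3) (Fin 3) ℝ) (s : Fin 3 → ℝ), IsSVD M U s V ∧
    R = U * Matrix.diagonal ![1, 1, (U * V.transpose).det] * V.transpose

/-- Vectorization of a `3 × 3` matrix, as a point of the Euclidean space `ℝ⁹`. -/
def matVec (M : Matrix (Fin 3) (Fin 3) ℝ) : EuclideanSpace ℝ (Fin 3 × Fin 3) :=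
  WithLp.toLp 2 fun p => M p.1 p.2

/-- The `3 × 3` matrix with a given vectorization. -/
def matUnvec (x : EuclideanSpace ℝ (Fin 3 × Fin 3)) : Matrix (Fin 3) (Fin 3) ℝ :=
  Matrix.of fun i j => x (i, j)

/-- The Jacobian `∂ vec(R) / ∂ vec(M)` of the map `M ↦ R = SVDO⁺(M)` at `M`. -/
def svdJacobian (M : Matrix (Fin 3) (Fin 3) ℝ) :
    EuclideanSpace ℝ (Fin 3 × Fin 3) →L[ℝ] EuclideanSpace ℝ (Fin 3 × Fin 3) :=
  fderiv ℝ (fun x => matVec (svdOrthogonalization (matUnvec x))) (matVec M)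

/-- The condition number of a linear map with its null space discarded: its largest singular value
divided by its smallest nonzero singular value. (Singular values are indexed from `0`, in decreasing
order, and exactly the first `rank T` of them are nonzero.) -/
def restrictedCond {E : Type*} [NormedAddCommGroup E] [InnerProductSpace ℝ E]
    [FiniteDimensional ℝ E] (T : E →ₗ[ℝ] E) : ℝ :=
  T.singularValues 0 / T.singularValues (Module.finrank ℝ (LinearMap.range T) - 1)

/-- The condition number `κ` of the Jacobian of `SVDO⁺` at `M`. -/
def jacobianCond (M : Matrix (Fin 3) (Fin 3) ℝ) : ℝ :=
  restrictedCond (svdJacobian M : EuclideanSpace ℝ (Fin 3 × Fin 3) →ₗ[ℝ] _)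

/-- The singular values of a `3 × 3` matrix in decreasing order, indexed from `0`. -/
def singVal (M : Matrix (Fin 3) (Fin 3) ℝ) (k : ℕ) : ℝ :=
  (Matrix.toEuclideanLin M).singularValues k

/-- The symmetric part `W = (N + Nᵀ) / 2`. -/
def symPart (N : Matrix (Fin 3) (Fin 3) ℝ) : Matrix (Fin 3) (Fin 3) ℝ :=
  (1 / 2 : ℝ) • (N + N.transpose)

theorem symPart_isHermitian (N : Matrix (Fin 3) (Fin 3) ℝ) : (symPart N).IsHermitian := by
  ext i j
  simp only [symPart, Matrix.conjTranspose_apply, Matrix.smul_apply, Matrix.add_apply,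
    Matrix.transpose_apply, star_trivial, add_comm]

/-- The largest eigenvalue of the symmetric part of `N` (`eigenvalues₀` is in decreasing order). -/
def largestEigSymPart (N : Matrix (Fin 3) (Fin 3) ℝ) : ℝ :=
  (symPart_isHermitian N).eigenvalues₀ ⟨0, by simp⟩

/-- The constant `c₃ = (3/2) √(3/π)`. -/
def goeConst : ℝ := 3 / 2 * Real.sqrt (3 / Real.pi)

/-- The event `det (I + σ N) > 0`. -/
def detPosEvent {Ω : Type*} (N : Ω → Matrix (Fin 3) (Fin 3) ℝ) (σ : ℝ) : Set Ω :=
  {ω | 0 < (1 + σ • N ω).det}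

/-- The expected condition number of the Jacobian at `M = I + σ N`, given `det M > 0`. -/
def expectedCond {Ω : Type*} [MeasurableSpace Ω] (P : Measure Ω)
    (N : Ω → Matrix (Fin 3) (Fin 3) ℝ) (σ : ℝ) : ℝ :=
  ∫ ω, jacobianCond (1 + σ • N ω) ∂(ProbabilityTheory.cond P (detPosEvent N σ))

end

/-! Where `det M > 0`, `SVDO⁺(M)` is the orthogonal polar factor of `M`, the orthogonal `R` that
maximizes `tr(RᵀM)`. In the frame of the singular vectors its differential kills symmetric matrices
and multiplies the skew generator of the `(i,j)` plane by `2/(sᵢ+sⱼ)`. The extreme nonzero values of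
this factor are `2/(s₂+s₃)` and `2/(s₁+s₂)`, which gives `κ` (`jacobianCond_eq`).

For `M = I + σN` the Rayleigh principle for `W = (N+Nᵀ)/2` gives `s₁ = 1 + σ λ_max(W) + O(σ²‖N‖²)`
and `s₃ = 1 + σ λ_min(W) + O(σ²‖N‖²)`. Since `κ - 1 = (s₁-s₃)/(s₂+s₃)` and the denominator is `2 +
O(σ‖N‖)`, the middle singular value has no first-order effect: `κ = 1 + σ(λ_max - λ_min)/2 +
O(σ²‖N‖²)` (`abs_jacobianCond_sub_le`). By the symmetry `N ↦ -N` the mean of the linear coefficient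
is `E λ_max(W)`.

This mean is found without the GOE eigenvalue density. Split `W` into its trace part and a traceless
part with Gaussian coordinates in `ℝ⁵`; the trace has mean zero. By the trigonometric solution of
the cubic, the top eigenvalue of the traceless part is `√(2/3) r cos(arccos(Q/r³)/3)`, where `r` is
the norm and `Q` is the Cartan cubic, a multiple of the determinant. As `Q` is harmonic with `|∇Q|²
= 9r⁴`, Gaussian integration by parts gives a recursion for its moments, and on the unit sphere
these are the moments of the uniform law on `[-1,1]` (`integral_sphere_cartanFun_pow`). One
elementary integral and the mean radius then give `c₃` (`integral_largestEig_stdGaussian`).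

The expansion holds only for `σ‖N‖ ≤ 1/4`. Elsewhere `κ ≤ 2s₁²/(s₁s₂)`, and every `2 × 2` minor of
`M` is at most `s₁s₂`. The product of two suitable minors to the power `-3/4` has expectation at
most a constant times `σ⁻³` (`lintegral_minorNegPow_le`), which bounds a `3/2` moment of `1/(s₁s₂)`.
Young's inequality, with powers of `4σ‖N‖ > 1` inserted, makes this region contribute `O(σ²)`.
Finally `P(det M > 0) ≥ 1 - Cσ²`, so conditioning costs only `O(σ²)`. -/

/-! ### Variational characterization of the extreme singular values -/

theorem LinearMap.norm_map_sq_eq_sum_singularValues {E : Type*} [NormedAddCommGroup E]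
    [InnerProductSpace ℝ E] [FiniteDimensional ℝ E] (T : E →ₗ[ℝ] E) {n : ℕ}
    (hn : Module.finrank ℝ E = n) (x : E) :
    ‖T x‖ ^ 2 = ∑ i : Fin n, T.singularValues i ^ 2 *
      (inner ℝ (T.isSymmetric_adjoint_comp_self.eigenvectorBasis hn i) x) ^ 2 := by
  set b := T.isSymmetric_adjoint_comp_self.eigenvectorBasis hn
  have h1 : ‖T x‖ ^ 2 = inner ℝ x ((adjoint T ∘ₗ T) x) := by
    rw [LinearMap.comp_apply, LinearMap.adjoint_inner_right, real_inner_self_eq_norm_sq]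
  rw [h1, ← b.sum_inner_mul_inner]
  refine Finset.sum_congr rfl fun i _ => ?_
  have h2 : inner ℝ (b i) ((adjoint T ∘ₗ T) x) =
      T.singularValues i ^ 2 * inner ℝ (b i) x := by
    rw [← T.isSymmetric_adjoint_comp_self (b i) x,
      T.isSymmetric_adjoint_comp_self.apply_eigenvectorBasis hn i, real_inner_smul_left,
      T.sq_singularValues_fin hn]
    rfl
  rw [h2, real_inner_comm x (b i)]
  ring

theorem LinearMap.singularValues_zero_eq {E : Type*} [NormedAddCommGroup E]
    [InnerProductSpace ℝ E] [FiniteDimensional ℝ E] (T : E →ₗ[ℝ] E) {c : ℝ} (hc : 0 ≤ c)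
    (hle : ∀ x, ‖T x‖ ≤ c * ‖x‖) {x : E} (hx : x ≠ 0) (heq : ‖T x‖ = c * ‖x‖) :
    T.singularValues 0 = c := by
  have hx' : 0 < ‖x‖ ^ 2 := by positivity
  have hpos : 0 < Module.finrank ℝ E := Module.finrank_pos_iff_exists_ne_zero.2 ⟨x, hx⟩
  obtain ⟨n, hn⟩ : ∃ n, Module.finrank ℝ E = n := ⟨_, rfl⟩
  rw [hn] at hpos
  set b := T.isSymmetric_adjoint_comp_self.eigenvectorBasis hn
  have h0 := T.singularValues_nonneg 0
  refine le_antisymm ?_ ?_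
  · have h1 := T.norm_map_sq_eq_sum_singularValues hn (b ⟨0, hpos⟩)
    have h2 : ‖T (b ⟨0, hpos⟩)‖ ^ 2 = T.singularValues 0 ^ 2 := by
      rw [h1, Finset.sum_eq_single ⟨0, hpos⟩]
      · simp [b]
      · intro i _ hi
        rw [b.orthonormal.2 hi]; ring
      · simp
    have h3 := hle (b ⟨0, hpos⟩)
    rw [b.norm_eq_one, mul_one] at h3
    exact le_of_sq_le_sq (by rw [← h2]; gcongr) hc
  · have h1 := T.norm_map_sq_eq_sum_singularValues hn x
    have h2 : ‖T x‖ ^ 2 ≤ T.singularValues 0 ^ 2 * ‖x‖ ^ 2 := by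
      rw [h1, ← b.sum_sq_inner_right x, Finset.mul_sum]
      refine Finset.sum_le_sum fun i _ => ?_
      gcongr
      · exact T.singularValues_nonneg _
      · exact T.singularValues_antitone (Nat.zero_le _)
    rw [heq, mul_pow] at h2
    exact le_of_sq_le_sq (le_of_mul_le_mul_right h2 hx') h0

/-- Eigenvectors of `T*T` with index at least the rank lie in `ker T`, so a vector orthogonal to the
kernel has only components with singular value at least the last nonzero one. Conversely the
eigenvector of index `rank - 1` is orthogonal to the kernel, so the lower bound applies to it. -/
theorem LinearMap.singularValues_finrank_range_sub_one_eq {E : Type*} [NormedAddCommGroup E]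
    [InnerProductSpace ℝ E] [FiniteDimensional ℝ E] (T : E →ₗ[ℝ] E) {c : ℝ} (hc : 0 < c)
    (hle : ∀ x ∈ (LinearMap.ker T)ᗮ, c * ‖x‖ ≤ ‖T x‖) {x : E} (hx : x ≠ 0)
    (hxk : x ∈ (LinearMap.ker T)ᗮ) (heq : ‖T x‖ = c * ‖x‖) :
    T.singularValues (Module.finrank ℝ (LinearMap.range T) - 1) = c := by
  have hx' : 0 < ‖x‖ ^ 2 := by positivity
  obtain ⟨n, hn⟩ : ∃ n, Module.finrank ℝ E = n := ⟨_, rfl⟩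
  set r := Module.finrank ℝ (LinearMap.range T) with hr
  set b := T.isSymmetric_adjoint_comp_self.eigenvectorBasis hn
  have hbn : ∀ i, ‖T (b i)‖ ^ 2 = T.singularValues i ^ 2 := by
    intro i
    rw [T.norm_map_sq_eq_sum_singularValues hn (b i), Finset.sum_eq_single i]
    · simp [b]
    · intro j _ hj
      rw [b.orthonormal.2 hj]; ring
    · simp
  -- Needed so that the natural subtraction `r - 1` is not truncated.
  have hrpos : 0 < r := by
    rw [hr, Module.finrank_pos_iff_exists_ne_zero]
    refine ⟨⟨T x, LinearMap.mem_range_self _ _⟩, fun h => ?_⟩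
    have h1 : T x = 0 := congrArg Subtype.val h
    rw [h1, norm_zero] at heq
    have : 0 < c * ‖x‖ := by positivity
    linarith
  have hrn : r ≤ n := by rw [hr, ← hn]; exact Submodule.finrank_le _
  have hlast : r - 1 < n := by omega
  have hpos : 0 < T.singularValues (r - 1) :=
    T.singularValues_pos_iff_lt_finrank_range.2 (by omega)
  refine le_antisymm ?_ ?_
  · have h2 : T.singularValues (r - 1) ^ 2 * ‖x‖ ^ 2 ≤ ‖T x‖ ^ 2 := by
      rw [T.norm_map_sq_eq_sum_singularValues hn, ← b.sum_sq_inner_right x, Finset.mul_sum]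
      refine Finset.sum_le_sum fun i _ => ?_
      by_cases hi : (i : ℕ) < r
      · gcongr
        exact T.singularValues_antitone (by omega)
      · have h0 : T.singularValues i = 0 :=
          T.singularValues_eq_zero_iff_le_finrank_range.2 (by omega)
        have hk : b i ∈ LinearMap.ker T := by
          have := hbn i
          rw [h0] at this
          simpa using this
        have h3 : inner ℝ (b i) x = 0 := (Submodule.mem_orthogonal _ _).1 hxk _ hk
        rw [h3]; simp
    rw [heq, mul_pow] at h2
    exact le_of_sq_le_sq (le_of_mul_le_mul_right h2 hx') hc.le
  · have hmem : b ⟨r - 1, hlast⟩ ∈ (LinearMap.ker T)ᗮ := by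
      rw [Submodule.mem_orthogonal]
      intro u hu
      have h1 := T.isSymmetric_adjoint_comp_self u (b ⟨r - 1, hlast⟩)
      rw [T.isSymmetric_adjoint_comp_self.apply_eigenvectorBasis hn, LinearMap.comp_apply,
        LinearMap.mem_ker.1 hu, map_zero, inner_zero_left, real_inner_smul_right,
        ← T.sq_singularValues_fin hn] at h1
      have : T.singularValues (r - 1) ^ 2 ≠ 0 := by positivity
      exact (mul_eq_zero.1 h1.symm).resolve_left this
    have h1 := hle _ hmem
    rw [b.norm_eq_one, mul_one] at h1
    have h2 := hbn ⟨r - 1, hlast⟩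
    refine le_of_sq_le_sq ?_ hpos.le
    change _ ≤ T.singularValues ((⟨r - 1, hlast⟩ : Fin n) : ℕ) ^ 2
    rw [← h2]
    gcongr

/-! ### Singular value decomposition and the polar factor -/

section

open scoped Matrix

/-- The columns of `V` are eigenvectors of `MᵀM`, and `U = M V D⁻¹` with `D` the diagonal of
singular values. Invertibility of `M` is what allows dividing by `D`, so no completion of an
orthonormal family is required. -/
theorem exists_isSVD_singVal (M : Matrix (Fin 3) (Fin 3) ℝ) (hM : M.det ≠ 0) :
    ∃ U V : Matrix (Fin 3) (Fin 3) ℝ, IsSVD M U (fun i => singVal M i) V := by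
  set T := Matrix.toEuclideanLin M with hT
  have hn : Module.finrank ℝ (EuclideanSpace ℝ (Fin 3)) = 3 := by simp
  set b := T.isSymmetric_adjoint_comp_self.eigenvectorBasis hn with hb
  have hinj : Function.Injective T := by
    intro x y hxy
    have h1 : M *ᵥ x.ofLp = M *ᵥ y.ofLp := congrArg WithLp.ofLp hxy
    have h2 := Matrix.mulVec_injective_of_isUnit
      ((Matrix.isUnit_iff_isUnit_det M).2 (isUnit_iff_ne_zero.2 hM)) h1
    exact WithLp.ofLp_injective 2 h2
  have hpos : ∀ i : Fin 3, 0 < singVal M i := fun i =>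
    T.injective_iff_forall_lt_finrank_singularValues_pos.1 hinj i (by rw [hn]; exact i.2)
  set V : Matrix (Fin 3) (Fin 3) ℝ := Matrix.of fun i j => b j i with hV
  have hVV : Vᵀ * V = 1 := by
    ext i j
    have h := b.inner_eq_ite i j
    simp only [PiLp.inner_apply, RCLike.inner_apply, conj_trivial] at h
    simp only [Matrix.mul_apply, Matrix.transpose_apply, hV, Matrix.of_apply, Matrix.one_apply]
    rw [← h]
    exact Finset.sum_congr rfl fun _ _ => mul_comm _ _
  have hMV : ∀ i j, (M * V) i j = T (b j) i := by
    intro i j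
    simp [Matrix.mul_apply, hV, hT, Matrix.toLpLin_apply, Matrix.mulVec, dotProduct]
  have hG : (M * V)ᵀ * (M * V) = Matrix.diagonal fun i : Fin 3 => singVal M i ^ 2 := by
    ext i j
    have h : inner ℝ (T (b j)) (T (b i)) = if i = j then singVal M j ^ 2 else 0 := by
      rw [← LinearMap.adjoint_inner_left, ← LinearMap.comp_apply,
        T.isSymmetric_adjoint_comp_self.apply_eigenvectorBasis hn j]
      erw [real_inner_smul_left]
      rw [← T.sq_singularValues_fin hn, b.inner_eq_ite]
      by_cases hij : i = j
      · subst hij; simp [singVal, hT]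
      · simp [hij, Ne.symm hij]
    simp only [PiLp.inner_apply, RCLike.inner_apply, conj_trivial] at h
    simp only [Matrix.mul_apply, Matrix.transpose_apply, Matrix.diagonal_apply] at hMV ⊢
    simp only [hMV]
    rw [h]
    split_ifs with hij
    · rw [hij]
    · rfl
  have hVV' : V * Vᵀ = 1 := mul_eq_one_comm.1 hVV
  set D : Matrix (Fin 3) (Fin 3) ℝ := Matrix.diagonal fun i : Fin 3 => (singVal M i)⁻¹ with hD
  refine ⟨M * V * D, V, ?_, ?_, ?_, fun i => (hpos i).le, ?_⟩
  · rw [Matrix.mem_orthogonalGroup_iff']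
    change (M * V * D)ᵀ * (M * V * D) = 1
    rw [Matrix.transpose_mul, Matrix.mul_assoc, ← Matrix.mul_assoc _ _ D, hG, hD,
      Matrix.diagonal_transpose, Matrix.diagonal_mul_diagonal, Matrix.diagonal_mul_diagonal,
      ← Matrix.diagonal_one]
    congr 1
    ext i
    have := (hpos i).ne'
    field_simp
  · rw [Matrix.mem_orthogonalGroup_iff']
    exact hVV
  · intro i j hij
    exact T.singularValues_antitone hij
  · rw [Matrix.mul_assoc (M * V), hD, Matrix.diagonal_mul_diagonal]
    have : (Matrix.diagonal fun i : Fin 3 => (singVal M i)⁻¹ * singVal M i) = 1 := by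
      rw [← Matrix.diagonal_one]
      congr 1
      ext i
      exact inv_mul_cancel₀ (hpos i).ne'
    rw [this, Matrix.mul_one, Matrix.mul_assoc, hVV', Matrix.mul_one]

theorem Matrix.transpose_mul_self_of_mem_orthogonalGroup {U : Matrix (Fin 3) (Fin 3) ℝ}
    (hU : U ∈ Matrix.orthogonalGroup (Fin 3) ℝ) : Uᵀ * U = 1 :=
  (Matrix.mem_orthogonalGroup_iff' _ _).1 hU

theorem Matrix.mul_transpose_self_of_mem_orthogonalGroup {U : Matrix (Fin 3) (Fin 3) ℝ}
    (hU : U ∈ Matrix.orthogonalGroup (Fin 3) ℝ) : U * Uᵀ = 1 :=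
  (Matrix.mem_orthogonalGroup_iff _ _).1 hU

theorem Matrix.apply_le_one_of_transpose_mul_self {Q : Matrix (Fin 3) (Fin 3) ℝ}
    (hQ : Qᵀ * Q = 1) (i j : Fin 3) : Q i j ≤ 1 := by
  have h := congrFun (congrFun hQ j) j
  simp only [Matrix.mul_apply, Matrix.transpose_apply, Matrix.one_apply_eq] at h
  have h1 : Q i j * Q i j ≤ ∑ k, Q k j * Q k j :=
    Finset.single_le_sum (f := fun k => Q k j * Q k j) (fun k _ => mul_self_nonneg _)
      (Finset.mem_univ i)
  nlinarith

/-- The properties of the orthogonal polar factor of `M` used to compute its derivative. -/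
structure IsPolarFactor (M R : Matrix (Fin 3) (Fin 3) ℝ) : Prop where
  transpose_mul_self : Rᵀ * R = 1
  isSymm : (Rᵀ * M)ᵀ = Rᵀ * M
  trace_le : ∀ Q : Matrix (Fin 3) (Fin 3) ℝ, Qᵀ * Q = 1 → (Qᵀ * M).trace ≤ (Rᵀ * M).trace

/-- Maximality is von Neumann's trace argument: `tr(QᵀM)` is a sum of the `sᵢ` weighted by diagonal
entries of an orthogonal matrix, which are at most `1`, and `U Vᵀ` makes all the weights equal to
`1`. -/
theorem IsSVD.isPolarFactor {M U V : Matrix (Fin 3) (Fin 3) ℝ} {s : Fin 3 → ℝ}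
    (h : IsSVD M U s V) : IsPolarFactor M (U * Vᵀ) := by
  obtain ⟨hU, hV, -, hs, rfl⟩ := h
  have hU1 := Matrix.transpose_mul_self_of_mem_orthogonalGroup hU
  have hU2 := Matrix.mul_transpose_self_of_mem_orthogonalGroup hU
  have hV1 := Matrix.transpose_mul_self_of_mem_orthogonalGroup hV
  have hV2 := Matrix.mul_transpose_self_of_mem_orthogonalGroup hV
  have key : (U * Vᵀ)ᵀ * (U * Matrix.diagonal s * Vᵀ) = V * Matrix.diagonal s * Vᵀ := by
    rw [Matrix.transpose_mul, Matrix.transpose_transpose]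
    calc V * Uᵀ * (U * Matrix.diagonal s * Vᵀ) = V * (Uᵀ * U) * Matrix.diagonal s * Vᵀ := by
          simp only [Matrix.mul_assoc]
      _ = _ := by rw [hU1, Matrix.mul_one]
  refine ⟨?_, ?_, ?_⟩
  · rw [Matrix.transpose_mul, Matrix.transpose_transpose]
    calc V * Uᵀ * (U * Vᵀ) = V * (Uᵀ * U) * Vᵀ := by simp only [Matrix.mul_assoc]
      _ = 1 := by rw [hU1, Matrix.mul_one, hV2]
  · rw [key]
    simp [Matrix.transpose_mul, Matrix.mul_assoc]
  · intro Q hQ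
    rw [key]
    have h1 : (V * Matrix.diagonal s * Vᵀ).trace = ∑ i, s i := by
      rw [Matrix.trace_mul_comm, ← Matrix.mul_assoc, hV1, Matrix.one_mul, Matrix.trace_diagonal]
    have h2 : (Qᵀ * (U * Matrix.diagonal s * Vᵀ)).trace =
        ∑ i, (Vᵀ * Qᵀ * U) i i * s i := by
      rw [← Matrix.mul_assoc, Matrix.trace_mul_comm, ← Matrix.mul_assoc, ← Matrix.mul_assoc,
        Matrix.trace]
      simp [Matrix.mul_diagonal]
    rw [h1, h2]
    refine Finset.sum_le_sum fun i _ => ?_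
    have hQ' : Q * Qᵀ = 1 := mul_eq_one_comm.1 hQ
    have h3 : (Vᵀ * Qᵀ * U)ᵀ * (Vᵀ * Qᵀ * U) = 1 := by
      simp only [Matrix.transpose_mul, Matrix.transpose_transpose]
      calc Uᵀ * (Q * V) * (Vᵀ * Qᵀ * U) = Uᵀ * (Q * (V * Vᵀ) * Qᵀ) * U := by
            simp only [Matrix.mul_assoc]
        _ = 1 := by rw [hV2, Matrix.mul_one, hQ', Matrix.mul_one, hU1]
    have := mul_le_mul_of_nonneg_right (Matrix.apply_le_one_of_transpose_mul_self h3 i i) (hs i)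
    linarith

theorem IsSVD.det_eq {M U V : Matrix (Fin 3) (Fin 3) ℝ} {s : Fin 3 → ℝ} (h : IsSVD M U s V) :
    M.det = (U * Vᵀ).det * (s 0 * s 1 * s 2) := by
  obtain ⟨-, -, -, -, rfl⟩ := h
  rw [Matrix.det_mul, Matrix.det_mul, Matrix.det_mul, Matrix.det_diagonal, Fin.prod_univ_three]
  ring

theorem IsSVD.pos {M U V : Matrix (Fin 3) (Fin 3) ℝ} {s : Fin 3 → ℝ} (h : IsSVD M U s V)
    (hM : M.det ≠ 0) (i : Fin 3) : 0 < s i := by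
  refine lt_of_le_of_ne (h.2.2.2.1 i) fun h0 => hM ?_
  have h1 : ∏ j, s j = 0 := Finset.prod_eq_zero (Finset.mem_univ i) h0.symm
  rw [h.det_eq, ← Fin.prod_univ_three, h1, mul_zero]

theorem IsSVD.det_mul_transpose_eq_one {M U V : Matrix (Fin 3) (Fin 3) ℝ} {s : Fin 3 → ℝ}
    (h : IsSVD M U s V) (hM : 0 < M.det) : (U * Vᵀ).det = 1 := by
  have h1 := h.isPolarFactor.transpose_mul_self
  have h2 : (U * Vᵀ).det * (U * Vᵀ).det = 1 := by
    have := congrArg Matrix.det h1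
    rwa [Matrix.det_mul, Matrix.det_transpose, Matrix.det_one] at this
  rcases mul_self_eq_one_iff.1 h2 with h3 | h3
  · exact h3
  · have hp : 0 ≤ s 0 * s 1 * s 2 :=
      mul_nonneg (mul_nonneg (h.2.2.2.1 0) (h.2.2.2.1 1)) (h.2.2.2.1 2)
    rw [h.det_eq, h3] at hM
    linarith

/-- Whichever decomposition the choice operator selects, `det M > 0` forces `det(U Vᵀ) = 1`, so the
sign correction is trivial. The three polar-factor properties suffice later, so uniqueness is never
proved separately. -/
theorem isPolarFactor_svdOrthogonalization {M : Matrix (Fin 3) (Fin 3) ℝ} (hM : 0 < M.det) :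
    IsPolarFactor M (svdOrthogonalization M) := by
  obtain ⟨U, V, hUV⟩ := exists_isSVD_singVal M hM.ne'
  have hex : ∃ R, ∃ (U V : Matrix (Fin 3) (Fin 3) ℝ) (s : Fin 3 → ℝ), IsSVD M U s V ∧
      R = U * Matrix.diagonal ![1, 1, (U * V.transpose).det] * V.transpose :=
    ⟨_, U, V, _, hUV, rfl⟩
  obtain ⟨U', V', s', h', hR⟩ := Classical.epsilon_spec hex
  have : svdOrthogonalization M = U' * V'ᵀ := by
    rw [svdOrthogonalization, hR, h'.det_mul_transpose_eq_one hM]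
    have : (Matrix.diagonal ![1, 1, 1] : Matrix (Fin 3) (Fin 3) ℝ) = 1 := by
      rw [← Matrix.diagonal_one]
      congr 1
      ext i
      fin_cases i <;> rfl
    rw [this, Matrix.mul_one]
  rw [this]
  exact h'.isPolarFactor

end

/-! ### First-order perturbation of the polar factor -/

section

open scoped Matrix Matrix.Norms.Frobenius

theorem norm_matVec (X : Matrix (Fin 3) (Fin 3) ℝ) : ‖matVec X‖ = ‖X‖ := by
  rw [EuclideanSpace.norm_eq, Matrix.frobenius_norm_def, Fintype.sum_prod_type, Real.sqrt_eq_rpow]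
  simp [matVec]

theorem inner_matVec (X Y : Matrix (Fin 3) (Fin 3) ℝ) :
    inner ℝ (matVec X) (matVec Y) = (Xᵀ * Y).trace := by
  simp [PiLp.inner_apply, Fintype.sum_prod_type, matVec, Matrix.trace, Matrix.mul_apply,
    Fin.sum_univ_three]
  ring

theorem Matrix.abs_trace_transpose_mul_le (X Y : Matrix (Fin 3) (Fin 3) ℝ) :
    |(Xᵀ * Y).trace| ≤ ‖X‖ * ‖Y‖ := by
  rw [← inner_matVec, ← norm_matVec, ← norm_matVec]
  exact abs_real_inner_le_norm _ _

theorem Matrix.trace_transpose_mul_self_eq_norm_sq (X : Matrix (Fin 3) (Fin 3) ℝ) :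
    (Xᵀ * X).trace = ‖X‖ ^ 2 := by
  rw [← inner_matVec, ← norm_matVec, real_inner_self_eq_norm_sq]

theorem Matrix.abs_apply_le_frobenius_norm (X : Matrix (Fin 3) (Fin 3) ℝ) (i j : Fin 3) :
    |X i j| ≤ ‖X‖ := by
  rw [← norm_matVec]
  exact PiLp.norm_apply_le (matVec X) (i, j)

theorem Matrix.frobenius_norm_le_of_abs_apply_le {X : Matrix (Fin 3) (Fin 3) ℝ} {c : ℝ}
    (hX : ∀ i j, |X i j| ≤ c) : ‖X‖ ≤ 3 * c := by
  have hc : 0 ≤ c := (abs_nonneg _).trans (hX 0 0)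
  refine le_of_sq_le_sq ?_ (by positivity)
  rw [← Matrix.trace_transpose_mul_self_eq_norm_sq]
  have h : ∀ i j, X i j * X i j ≤ c ^ 2 := fun i j => by
    rw [← sq, ← sq_abs]
    gcongr
    exact hX i j
  simp only [Matrix.trace, Matrix.diag_apply, Matrix.mul_apply, Matrix.transpose_apply]
  calc ∑ i, ∑ j, X j i * X j i ≤ ∑ i : Fin 3, ∑ j : Fin 3, c ^ 2 :=
        Finset.sum_le_sum fun i _ => Finset.sum_le_sum fun j _ => h j i
    _ = (3 * c) ^ 2 := by simp; ring

/-- The solution `Y` of `Y D + D Y = X - Xᵀ` with `D = diag(s)`. -/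
noncomputable def skewSolve (s : Fin 3 → ℝ) (X : Matrix (Fin 3) (Fin 3) ℝ) : Matrix (Fin 3) (Fin 3) ℝ :=
  Matrix.of fun i j => (X i j - X j i) / (s i + s j)

theorem IsPolarFactor.conj {M R U V : Matrix (Fin 3) (Fin 3) ℝ} (h : IsPolarFactor M R)
    (hU : U ∈ Matrix.orthogonalGroup (Fin 3) ℝ) (hV : V ∈ Matrix.orthogonalGroup (Fin 3) ℝ) :
    IsPolarFactor (Uᵀ * M * V) (Uᵀ * R * V) := by
  have hU1 := Matrix.transpose_mul_self_of_mem_orthogonalGroup hU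
  have hU2 := Matrix.mul_transpose_self_of_mem_orthogonalGroup hU
  have hV1 := Matrix.transpose_mul_self_of_mem_orthogonalGroup hV
  have hV2 := Matrix.mul_transpose_self_of_mem_orthogonalGroup hV
  have key : ∀ X : Matrix (Fin 3) (Fin 3) ℝ,
      (Uᵀ * R * V)ᵀ * (Uᵀ * X * V) = Vᵀ * (Rᵀ * X) * V := by
    intro X
    simp only [Matrix.transpose_mul, Matrix.transpose_transpose]
    calc Vᵀ * (Rᵀ * U) * (Uᵀ * X * V) = Vᵀ * Rᵀ * (U * Uᵀ) * X * V := by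
          simp only [Matrix.mul_assoc]
      _ = _ := by rw [hU2, Matrix.mul_one]; simp only [Matrix.mul_assoc]
  refine ⟨?_, ?_, fun Q hQ => ?_⟩
  · rw [key, h.transpose_mul_self, Matrix.mul_one, hV1]
  · rw [key]
    have h2 := h.isSymm
    simp only [Matrix.transpose_mul, Matrix.transpose_transpose] at h2 ⊢
    rw [h2]
    simp only [Matrix.mul_assoc]
  · have h1 : (U * Q * Vᵀ)ᵀ * (U * Q * Vᵀ) = 1 := by
      simp only [Matrix.transpose_mul, Matrix.transpose_transpose]
      calc V * (Qᵀ * Uᵀ) * (U * Q * Vᵀ) = V * (Qᵀ * (Uᵀ * U) * Q) * Vᵀ := by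
            simp only [Matrix.mul_assoc]
        _ = 1 := by rw [hU1, Matrix.mul_one, hQ, Matrix.mul_one, hV2]
    have h2 := h.trace_le _ h1
    rw [key]
    have h3 : (Vᵀ * (Rᵀ * M) * V).trace = (Rᵀ * M).trace := by
      rw [Matrix.trace_mul_comm, ← Matrix.mul_assoc, hV2, Matrix.one_mul]
    have h4 : (Qᵀ * (Uᵀ * M * V)).trace = ((U * Q * Vᵀ)ᵀ * M).trace := by
      simp only [Matrix.transpose_mul, Matrix.transpose_transpose]
      rw [Matrix.mul_assoc V, Matrix.trace_mul_comm V]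
      simp only [Matrix.mul_assoc]
    rw [h3, h4]
    exact h2

/-- Comparing `R` with the competitor `1` in the trace maximization gives `∑ sᵢ(1 - Rᵢᵢ) ≤
tr((R-1)ᵀH)`. The left side is at least `(c/2)‖R-1‖²` by orthogonality of `R`, and Cauchy–Schwarz
bounds the right side. No smallness of `H` is assumed. -/
theorem IsPolarFactor.norm_sub_one_le {s : Fin 3 → ℝ} {H R : Matrix (Fin 3) (Fin 3) ℝ}
    (h : IsPolarFactor (Matrix.diagonal s + H) R) {c : ℝ} (hc : 0 < c) (hs : ∀ i, c ≤ s i) :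
    ‖R - 1‖ ≤ 2 / c * ‖H‖ := by
  have h1 := h.trace_le 1 (by simp)
  have hR := h.transpose_mul_self
  have h2 : c * ‖R - 1‖ ^ 2 ≤ 2 * (‖R - 1‖ * ‖H‖) := by
    have e1 : ‖R - 1‖ ^ 2 = 2 * ∑ i, (1 - R i i) := by
      rw [← Matrix.trace_transpose_mul_self_eq_norm_sq, Matrix.transpose_sub, Matrix.sub_mul,
        Matrix.mul_sub, hR]
      simp [Matrix.trace, Fin.sum_univ_three]
      ring
    have e2 : ∑ i, s i * (1 - R i i) ≤ ((R - 1)ᵀ * H).trace := by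
      have : ((R - 1)ᵀ * H).trace - ∑ i, s i * (1 - R i i) =
          (Rᵀ * (Matrix.diagonal s + H)).trace -
            ((1 : Matrix (Fin 3) (Fin 3) ℝ)ᵀ * (Matrix.diagonal s + H)).trace := by
        rw [Matrix.transpose_sub, Matrix.sub_mul, Matrix.mul_add, Matrix.mul_add]
        simp [Matrix.trace, Fin.sum_univ_three, Matrix.mul_diagonal]
        ring
      linarith
    have e3 : c * ∑ i, (1 - R i i) ≤ ∑ i, s i * (1 - R i i) := by
      rw [Finset.mul_sum]
      refine Finset.sum_le_sum fun i _ => mul_le_mul_of_nonneg_right (hs i) ?_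
      have := Matrix.apply_le_one_of_transpose_mul_self hR i i
      linarith
    have e4 := le_of_abs_le (Matrix.abs_trace_transpose_mul_le (R - 1) H)
    rw [e1]
    linarith
  rcases (norm_nonneg (R - 1)).eq_or_lt with h0 | h0
  · rw [← h0]; positivity
  · rw [div_mul_eq_mul_div, le_div_iff₀ hc]
    refine le_of_mul_le_mul_left ?_ h0
    nlinarith

/-- Put `K = R - 1`. Orthogonality says `K + Kᵀ = -KᵀK`, and symmetry of `Rᵀ(D+H)` relates `DK -
KᵀD` to `H - Hᵀ`. Eliminating `Kᵀ` leaves the Sylvester equation `KD + DK = H - Hᵀ` up to terms that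
are quadratic by the Lipschitz bound; it is solved entry by entry. -/
theorem IsPolarFactor.norm_sub_one_sub_skewSolve_le {s : Fin 3 → ℝ} {c : ℝ} (hc : 0 < c)
    (hs : ∀ i, c ≤ s i) : ∃ C, ∀ H R : Matrix (Fin 3) (Fin 3) ℝ,
      IsPolarFactor (Matrix.diagonal s + H) R → ‖R - 1 - skewSolve s H‖ ≤ C * ‖H‖ ^ 2 := by
  set D : Matrix (Fin 3) (Fin 3) ℝ := Matrix.diagonal s with hD
  -- The inner bracket bounds the quadratic remainder, `2c` is a lower bound for `sᵢ + sⱼ`, and `3`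
  -- passes from an entrywise bound to the Frobenius norm.
  refine ⟨3 * (((2 / c) ^ 2 * ‖D‖ + 2 * (2 / c)) / (2 * c)), fun H R h => ?_⟩
  have hK := h.norm_sub_one_le hc hs
  set K := R - 1 with hKdef
  have hRK : R = 1 + K := by rw [hKdef]; abel
  have hE : K + Kᵀ = -(Kᵀ * K) := by
    have := h.transpose_mul_self
    rw [hRK, Matrix.transpose_add, Matrix.transpose_one, Matrix.add_mul, Matrix.one_mul,
      Matrix.mul_add, Matrix.mul_one] at this
    rw [← sub_eq_zero]
    refine Eq.trans ?_ (sub_eq_zero.2 this)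
    abel
  have hsym : K * D + D * K - (H - Hᵀ) = -(Kᵀ * K * D) + Kᵀ * H - Hᵀ * K := by
    have h1 := h.isSymm
    have h2 : D ᵀ = D := Matrix.diagonal_transpose s
    rw [hRK] at h1
    simp only [Matrix.transpose_mul, Matrix.transpose_add, Matrix.transpose_one,
      Matrix.transpose_transpose, h2, Matrix.add_mul, Matrix.mul_add, Matrix.one_mul] at h1
    have h3 : K * D + Kᵀ * D = -(Kᵀ * K * D) := by rw [← Matrix.add_mul, hE, Matrix.neg_mul]
    rw [← sub_eq_zero]
    refine Eq.trans (b := (K * D + Kᵀ * D - -(Kᵀ * K * D)) + _) ?_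
      ((congrArg₂ (· + ·) (sub_eq_zero.2 h3) (sub_eq_zero.2 h1)).trans (add_zero 0))
    abel
  have hKt : ‖Kᵀ‖ = ‖K‖ := Matrix.frobenius_norm_transpose K
  have hHt : ‖Hᵀ‖ = ‖H‖ := Matrix.frobenius_norm_transpose H
  have hrem : ‖-(Kᵀ * K * D) + Kᵀ * H - Hᵀ * K‖ ≤
      ((2 / c) ^ 2 * ‖D‖ + 2 * (2 / c)) * ‖H‖ ^ 2 := by
    calc ‖-(Kᵀ * K * D) + Kᵀ * H - Hᵀ * K‖ ≤ ‖Kᵀ‖ * ‖K‖ * ‖D‖ + ‖Kᵀ‖ * ‖H‖ + ‖Hᵀ‖ * ‖K‖ := by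
          refine (norm_sub_le _ _).trans (add_le_add ((norm_add_le _ _).trans (add_le_add ?_ ?_)) ?_)
          · rw [norm_neg]
            exact (norm_mul_le _ _).trans (mul_le_mul_of_nonneg_right (norm_mul_le _ _)
              (norm_nonneg _))
          · exact norm_mul_le _ _
          · exact norm_mul_le _ _
      _ = ‖K‖ * ‖K‖ * ‖D‖ + ‖K‖ * ‖H‖ + ‖H‖ * ‖K‖ := by rw [hKt, hHt]
      _ ≤ (2 / c * ‖H‖) * (2 / c * ‖H‖) * ‖D‖ + (2 / c * ‖H‖) * ‖H‖ + ‖H‖ * (2 / c * ‖H‖) := by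
          gcongr
      _ = _ := by ring
  rw [mul_assoc]
  refine Matrix.frobenius_norm_le_of_abs_apply_le fun i j => ?_
  have hij : 2 * c ≤ s i + s j := by linarith [hs i, hs j]
  have h1 := (Matrix.abs_apply_le_frobenius_norm (-(Kᵀ * K * D) + Kᵀ * H - Hᵀ * K) i j).trans hrem
  rw [← hsym] at h1
  have h2 : (K * D + D * K - (H - Hᵀ)) i j = (s i + s j) * ((K - skewSolve s H) i j) := by
    have : s i + s j ≠ 0 := by linarith
    simp only [hD, Matrix.sub_apply, Matrix.add_apply, Matrix.mul_diagonal, Matrix.diagonal_mul,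
      Matrix.transpose_apply, skewSolve, Matrix.of_apply]
    field_simp
    ring
  rw [h2, abs_mul, abs_of_pos (by linarith : 0 < s i + s j)] at h1
  rw [div_mul_eq_mul_div, le_div_iff₀ (by linarith)]
  calc |(K - skewSolve s H) i j| * (2 * c) ≤ |(K - skewSolve s H) i j| * (s i + s j) := by gcongr
    _ = (s i + s j) * |(K - skewSolve s H) i j| := mul_comm _ _
    _ ≤ _ := h1

end

/-! ### The Jacobian and its condition number -/

section

open scoped Matrix Matrix.Norms.Frobenius

theorem matUnvec_matVec (X : Matrix (Fin 3) (Fin 3) ℝ) : matUnvec (matVec X) = X := rfl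

theorem matVec_matUnvec (x : EuclideanSpace ℝ (Fin 3 × Fin 3)) : matVec (matUnvec x) = x := rfl

/-- The differential of the orthogonal polar factor at `U diag(s) Vᵀ`, on vectorized matrices. -/
noncomputable def polarDeriv (U : Matrix (Fin 3) (Fin 3) ℝ) (s : Fin 3 → ℝ)
    (V : Matrix (Fin 3) (Fin 3) ℝ) :
    EuclideanSpace ℝ (Fin 3 × Fin 3) →ₗ[ℝ] EuclideanSpace ℝ (Fin 3 × Fin 3) where
  toFun x := matVec (U * skewSolve s (Uᵀ * matUnvec x * V) * Vᵀ)
  map_add' x y := by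
    have h1 : matUnvec (x + y) = matUnvec x + matUnvec y := rfl
    have h2 : ∀ X Y, skewSolve s (X + Y) = skewSolve s X + skewSolve s Y := by
      intro X Y
      ext i j
      simp only [skewSolve, Matrix.of_apply, Matrix.add_apply]
      ring
    rw [h1, Matrix.mul_add, Matrix.add_mul, h2, Matrix.mul_add, Matrix.add_mul]
    rfl
  map_smul' c x := by
    have h1 : matUnvec (c • x) = c • matUnvec x := rfl
    have h2 : ∀ X, skewSolve s (c • X) = c • skewSolve s X := by
      intro X
      ext i j
      simp only [skewSolve, Matrix.of_apply, Matrix.smul_apply, smul_eq_mul]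
      ring
    rw [h1, Matrix.mul_smul, Matrix.smul_mul, h2, Matrix.mul_smul, Matrix.smul_mul]
    rfl

theorem continuous_matUnvec : Continuous matUnvec := by
  refine continuous_matrix fun i j => ?_
  exact (EuclideanSpace.proj (𝕜 := ℝ) (i, j)).continuous

/-- Conjugating by the fixed frames `U`, `V` of `M` reduces nearby matrices to perturbations of
`diag(s)`. Nothing is differentiated in `U`, `V` or `s`, so repeated singular values cause no
trouble. -/
theorem hasFDerivAt_svdOrthogonalization {M U V : Matrix (Fin 3) (Fin 3) ℝ} {s : Fin 3 → ℝ}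
    (h : IsSVD M U s V) (hM : 0 < M.det) :
    HasFDerivAt (fun x => matVec (svdOrthogonalization (matUnvec x)))
      (LinearMap.toContinuousLinearMap (polarDeriv U s V)) (matVec M) := by
  have hU1 := Matrix.transpose_mul_self_of_mem_orthogonalGroup h.1
  have hU2 := Matrix.mul_transpose_self_of_mem_orthogonalGroup h.1
  have hV1 := Matrix.transpose_mul_self_of_mem_orthogonalGroup h.2.1
  have hV2 := Matrix.mul_transpose_self_of_mem_orthogonalGroup h.2.1
  have hconj : ∀ X, U * (Uᵀ * X * V) * Vᵀ = X := by
    intro X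
    calc U * (Uᵀ * X * V) * Vᵀ = (U * Uᵀ) * X * (V * Vᵀ) := by simp only [Matrix.mul_assoc]
      _ = X := by rw [hU2, hV2, Matrix.one_mul, Matrix.mul_one]
  have hs2 : ∀ i, s 2 ≤ s i := fun i => h.2.2.1 (Fin.le_last i)
  obtain ⟨C, hC⟩ := IsPolarFactor.norm_sub_one_sub_skewSolve_le (h.pos hM.ne' 2) hs2
  have hDM : Uᵀ * M * V = Matrix.diagonal s := by
    rw [h.2.2.2.2]
    calc Uᵀ * (U * Matrix.diagonal s * Vᵀ) * V = (Uᵀ * U) * Matrix.diagonal s * (Vᵀ * V) := by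
          simp only [Matrix.mul_assoc]
      _ = _ := by rw [hU1, hV1, Matrix.one_mul, Matrix.mul_one]
  have hpol : ∀ X : Matrix (Fin 3) (Fin 3) ℝ, 0 < X.det →
      IsPolarFactor (Matrix.diagonal s + Uᵀ * (X - M) * V)
        (Uᵀ * svdOrthogonalization X * V) := by
    intro X hX
    have := (isPolarFactor_svdOrthogonalization hX).conj h.1 h.2.1
    rwa [← hDM, ← Matrix.add_mul, ← Matrix.mul_add, add_sub_cancel]
  -- The Lipschitz estimate with zero perturbation identifies the chosen value at `M` itself as `U
  -- Vᵀ`.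
  have hR0 : Uᵀ * svdOrthogonalization M * V = 1 := by
    have := (hpol M hM).norm_sub_one_le (h.pos hM.ne' 2) hs2
    rw [sub_self, Matrix.mul_zero, Matrix.zero_mul, norm_zero, mul_zero] at this
    exact sub_eq_zero.1 (norm_eq_zero.1 (le_antisymm this (norm_nonneg _)))
  rw [hasFDerivAt_iff_isLittleO]
  refine IsBigO.trans_isLittleO ?_ (Asymptotics.isLittleO_pow_sub_sub (matVec M) one_lt_two)
  refine IsBigO.of_bound (‖U‖ * (max C 0 * (‖Uᵀ‖ * ‖V‖) ^ 2) * ‖Vᵀ‖) ?_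
  have hev : ∀ᶠ x in 𝓝 (matVec M), 0 < (matUnvec x).det := by
    have hcont : Continuous fun x => (matUnvec x).det := continuous_matUnvec.matrix_det
    exact hcont.continuousAt.eventually (lt_mem_nhds hM)
  filter_upwards [hev] with x hx
  obtain ⟨X, rfl⟩ : ∃ X, x = matVec X := ⟨matUnvec x, rfl⟩
  rw [matUnvec_matVec] at hx
  have e1 : matVec (svdOrthogonalization (matUnvec (matVec X))) -
      matVec (svdOrthogonalization (matUnvec (matVec M))) -
        (polarDeriv U s V) (matVec X - matVec M) =
      matVec (U * (Uᵀ * svdOrthogonalization X * V - 1 - skewSolve s (Uᵀ * (X - M) * V)) * Vᵀ) := by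
    rw [Matrix.mul_sub, Matrix.sub_mul, Matrix.mul_sub, Matrix.sub_mul, hconj, ← hR0, hconj]
    rfl
  have e2 : ‖matVec X - matVec M‖ = ‖X - M‖ := norm_matVec (X - M)
  rw [LinearMap.coe_toContinuousLinearMap', e1, norm_matVec, e2, norm_pow, norm_norm]
  have h1 := hC _ _ (hpol X hx)
  have h2 : ‖Uᵀ * (X - M) * V‖ ≤ ‖Uᵀ‖ * ‖V‖ * ‖X - M‖ := by
    calc ‖Uᵀ * (X - M) * V‖ ≤ ‖Uᵀ‖ * ‖X - M‖ * ‖V‖ :=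
          (norm_mul_le _ _).trans (mul_le_mul_of_nonneg_right (norm_mul_le _ _) (norm_nonneg _))
      _ = _ := by ring
  set Z := Uᵀ * svdOrthogonalization X * V - 1 - skewSolve s (Uᵀ * (X - M) * V)
  calc ‖U * Z * Vᵀ‖ ≤ ‖U‖ * ‖Z‖ * ‖Vᵀ‖ :=
        (norm_mul_le _ _).trans (mul_le_mul_of_nonneg_right (norm_mul_le _ _) (norm_nonneg _))
    _ ≤ ‖U‖ * (max C 0 * (‖Uᵀ‖ * ‖V‖ * ‖X - M‖) ^ 2) * ‖Vᵀ‖ := by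
        gcongr
        exact h1.trans (mul_le_mul (le_max_left _ _) (by gcongr) (by positivity) (le_max_right _ _))
    _ = _ := by ring

theorem svdJacobian_eq_polarDeriv {M U V : Matrix (Fin 3) (Fin 3) ℝ} {s : Fin 3 → ℝ}
    (h : IsSVD M U s V) (hM : 0 < M.det) :
    (svdJacobian M : EuclideanSpace ℝ (Fin 3 × Fin 3) →ₗ[ℝ] _) = polarDeriv U s V := by
  rw [svdJacobian, (hasFDerivAt_svdOrthogonalization h hM).fderiv]
  rfl

/-- The isometry `X ↦ U X Vᵀ` turns the differential into `skewSolve s`, whose kernel is the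
symmetric matrices and which is diagonal on skew ones. Only the sharp upper bound and the sharp
lower bound off the kernel are needed, each with an extremal vector. -/
theorem restrictedCond_polarDeriv {M U V : Matrix (Fin 3) (Fin 3) ℝ} {s : Fin 3 → ℝ}
    (h : IsSVD M U s V) (hM : 0 < M.det) :
    restrictedCond (polarDeriv U s V) = (s 0 + s 1) / (s 1 + s 2) := by
  have hU1 := Matrix.transpose_mul_self_of_mem_orthogonalGroup h.1
  have hU2 := Matrix.mul_transpose_self_of_mem_orthogonalGroup h.1
  have hV1 := Matrix.transpose_mul_self_of_mem_orthogonalGroup h.2.1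
  have hV2 := Matrix.mul_transpose_self_of_mem_orthogonalGroup h.2.1
  have h0 := h.pos hM.ne' 0
  have h1 := h.pos hM.ne' 1
  have h2 := h.pos hM.ne' 2
  have h01 : s 1 ≤ s 0 := h.2.2.1 (by decide)
  have h12 : s 2 ≤ s 1 := h.2.2.1 (by decide)
  set T := polarDeriv U s V with hT
  have hinner : ∀ X Y : Matrix (Fin 3) (Fin 3) ℝ,
      inner ℝ (matVec (U * X * Vᵀ)) (matVec (U * Y * Vᵀ)) = inner ℝ (matVec X) (matVec Y) := by
    intro X Y
    rw [inner_matVec, inner_matVec]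
    simp only [Matrix.transpose_mul, Matrix.transpose_transpose]
    calc (V * (Xᵀ * Uᵀ) * (U * Y * Vᵀ)).trace = (V * (Xᵀ * (Uᵀ * U) * Y * Vᵀ)).trace := by
          simp only [Matrix.mul_assoc]
      _ = (Xᵀ * Y * (Vᵀ * V)).trace := by
          rw [hU1, Matrix.mul_one, Matrix.trace_mul_comm]; simp only [Matrix.mul_assoc]
      _ = _ := by rw [hV1, Matrix.mul_one]
  have hnorm : ∀ X : Matrix (Fin 3) (Fin 3) ℝ, ‖matVec (U * X * Vᵀ)‖ = ‖matVec X‖ := by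
    intro X
    rw [← sq_eq_sq₀ (norm_nonneg _) (norm_nonneg _), ← real_inner_self_eq_norm_sq, hinner,
      real_inner_self_eq_norm_sq]
  have hTX : ∀ X : Matrix (Fin 3) (Fin 3) ℝ,
      T (matVec (U * X * Vᵀ)) = matVec (U * skewSolve s X * Vᵀ) := by
    intro X
    change matVec (U * skewSolve s (Uᵀ * (U * X * Vᵀ) * V) * Vᵀ) = _
    have : Uᵀ * (U * X * Vᵀ) * V = X := by
      calc Uᵀ * (U * X * Vᵀ) * V = (Uᵀ * U) * X * (Vᵀ * V) := by simp only [Matrix.mul_assoc]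
        _ = X := by rw [hU1, hV1, Matrix.one_mul, Matrix.mul_one]
    rw [this]
  have hsurj : ∀ x, ∃ X, x = matVec (U * X * Vᵀ) := by
    intro x
    refine ⟨Uᵀ * matUnvec x * V, ?_⟩
    have : U * (Uᵀ * matUnvec x * V) * Vᵀ = matUnvec x := by
      calc U * (Uᵀ * matUnvec x * V) * Vᵀ = (U * Uᵀ) * matUnvec x * (V * Vᵀ) := by
            simp only [Matrix.mul_assoc]
        _ = _ := by rw [hU2, hV2, Matrix.one_mul, Matrix.mul_one]
    rw [this, matVec_matUnvec]
  have hsq : ∀ X : Matrix (Fin 3) (Fin 3) ℝ, ‖matVec X‖ ^ 2 =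
      X 0 0 ^ 2 + X 0 1 ^ 2 + X 0 2 ^ 2 + (X 1 0 ^ 2 + X 1 1 ^ 2 + X 1 2 ^ 2) +
        (X 2 0 ^ 2 + X 2 1 ^ 2 + X 2 2 ^ 2) := by
    intro X
    rw [EuclideanSpace.norm_sq_eq, Fintype.sum_prod_type]
    simp [Fin.sum_univ_three, matVec]
  have hskew : ∀ X : Matrix (Fin 3) (Fin 3) ℝ, ‖matVec (skewSolve s X)‖ ^ 2 =
      2 * ((X 0 1 - X 1 0) ^ 2 * (1 / (s 0 + s 1)) ^ 2 +
        (X 0 2 - X 2 0) ^ 2 * (1 / (s 0 + s 2)) ^ 2 +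
        (X 1 2 - X 2 1) ^ 2 * (1 / (s 1 + s 2)) ^ 2) := by
    intro X
    rw [hsq]
    simp only [skewSolve, Matrix.of_apply, sub_self, zero_div, add_comm (s 1) (s 0),
      add_comm (s 2) (s 0), add_comm (s 2) (s 1)]
    ring
  have hperp : ∀ X : Matrix (Fin 3) (Fin 3) ℝ,
      matVec (U * X * Vᵀ) ∈ (LinearMap.ker T)ᗮ ↔ Xᵀ = -X := by
    intro X
    rw [Submodule.mem_orthogonal]
    constructor
    · intro hX
      have hk : ∀ Y : Matrix (Fin 3) (Fin 3) ℝ, Yᵀ = Y → (Yᵀ * X).trace = 0 := by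
        intro Y hY
        rw [← inner_matVec, ← hinner]
        refine hX _ ?_
        rw [LinearMap.mem_ker, hTX]
        have : skewSolve s Y = 0 := by
          ext i j
          have := congrFun (congrFun hY j) i
          rw [Matrix.transpose_apply] at this
          simp [skewSolve, this]
        rw [this, Matrix.mul_zero, Matrix.zero_mul]
        rfl
      -- Testing against the symmetric matrix `X + Xᵀ` shows that its own norm vanishes.
      have h3 := hk (X + Xᵀ) (by simp [add_comm])
      have h4 : ‖X + Xᵀ‖ ^ 2 = 0 := by
        rw [← Matrix.trace_transpose_mul_self_eq_norm_sq]
        rw [Matrix.mul_add, Matrix.trace_add, h3, zero_add, ← Matrix.trace_transpose,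
          Matrix.transpose_mul]
        simp only [Matrix.transpose_add, Matrix.transpose_transpose] at h3 ⊢
        rw [Matrix.trace_mul_comm, add_comm X, h3]
      have h5 : X + Xᵀ = 0 := by simpa using h4
      exact eq_neg_of_add_eq_zero_right h5
    · intro hX u hu
      obtain ⟨Y, rfl⟩ := hsurj u
      rw [LinearMap.mem_ker, hTX] at hu
      rw [hinner, inner_matVec]
      have h3 : ‖matVec (skewSolve s Y)‖ = 0 := by rw [← hnorm, hu, norm_zero]
      have h4 : skewSolve s Y = 0 := by rwa [norm_matVec, norm_eq_zero] at h3
      have h5 : Yᵀ = Y := by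
        ext i j
        have h6 := congrFun (congrFun h4 j) i
        simp only [skewSolve, Matrix.of_apply, Matrix.zero_apply] at h6
        have h7 : s j + s i ≠ 0 := (add_pos (h.pos hM.ne' j) (h.pos hM.ne' i)).ne'
        rw [Matrix.transpose_apply]
        rcases div_eq_zero_iff.1 h6 with h8 | h8
        · linarith
        · exact absurd h8 h7
      have h6 : (Yᵀ * X).trace = -(Yᵀ * X).trace := by
        conv_lhs => rw [← Matrix.trace_transpose, Matrix.transpose_mul, Matrix.transpose_transpose,
          hX, Matrix.trace_mul_comm, Matrix.mul_neg, Matrix.trace_neg, ← h5]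
      linarith
  have hmono : ∀ {a b : ℝ}, 0 < a → a ≤ b → (1 / b) ^ 2 ≤ (1 / a) ^ 2 := by
    intro a b ha hab
    have hb : 0 < b := ha.trans_le hab
    exact pow_le_pow_left₀ (by positivity) (one_div_le_one_div_of_le ha hab) 2
  have hmax : T.singularValues 0 = 2 * (1 / (s 1 + s 2)) := by
    -- The witness generates rotations in the plane of the two smallest singular values, where the
    -- factor `2/(sᵢ+sⱼ)` is largest.
    refine T.singularValues_zero_eq (by positivity) (fun x => ?_)
      (x := matVec (U * !![0, 0, 0; 0, 0, 1; 0, -1, 0] * Vᵀ)) ?_ ?_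
    · obtain ⟨X, rfl⟩ := hsurj x
      rw [hTX, hnorm, hnorm]
      refine le_of_sq_le_sq ?_ (by positivity)
      rw [hskew, mul_pow, hsq]
      have e1 : (1 / (s 0 + s 1)) ^ 2 ≤ (1 / (s 1 + s 2)) ^ 2 := hmono (by linarith) (by linarith)
      have e2 : (1 / (s 0 + s 2)) ^ 2 ≤ (1 / (s 1 + s 2)) ^ 2 := hmono (by linarith) (by linarith)
      set q := (1 / (s 1 + s 2)) ^ 2
      have hq : 0 ≤ q := by positivity
      calc _ ≤ 2 * ((X 0 1 - X 1 0) ^ 2 * q + (X 0 2 - X 2 0) ^ 2 * q +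
            (X 1 2 - X 2 1) ^ 2 * q) := by gcongr
        _ ≤ _ := by
            rw [mul_pow]
            nlinarith [mul_nonneg hq (sq_nonneg (X 0 1 + X 1 0)), mul_nonneg hq (sq_nonneg (X 0 2 + X 2 0)),
              mul_nonneg hq (sq_nonneg (X 1 2 + X 2 1)), mul_nonneg hq (sq_nonneg (X 0 0)),
              mul_nonneg hq (sq_nonneg (X 1 1)), mul_nonneg hq (sq_nonneg (X 2 2))]
    · rw [← norm_ne_zero_iff, hnorm, ← pow_ne_zero_iff two_ne_zero, hsq]
      simp
    · rw [hTX, hnorm, hnorm, ← sq_eq_sq₀ (by positivity) (by positivity), mul_pow, hskew, hsq]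
      generalize 1 / (s 1 + s 2) = q
      simp
      ring
  have hmin : T.singularValues (Module.finrank ℝ (LinearMap.range T) - 1) =
      2 * (1 / (s 0 + s 1)) := by
    -- Here the witness is the generator for the two largest singular values.
    refine T.singularValues_finrank_range_sub_one_eq (by positivity) (fun x hx => ?_)
      (x := matVec (U * !![0, 1, 0; -1, 0, 0; 0, 0, 0] * Vᵀ)) ?_ ?_ ?_
    · obtain ⟨X, rfl⟩ := hsurj x
      have hX := (hperp X).1 hx
      have hX' : ∀ i j, X j i = - X i j := fun i j => congrFun (congrFun hX i) j
      rw [hTX, hnorm, hnorm]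
      refine le_of_sq_le_sq ?_ (by positivity)
      have d0 : X 0 0 = 0 := by linarith [hX' 0 0]
      have d1 : X 1 1 = 0 := by linarith [hX' 1 1]
      have d2 : X 2 2 = 0 := by linarith [hX' 2 2]
      rw [hskew, mul_pow, hsq, hX' 0 1, hX' 0 2, hX' 1 2, d0, d1, d2]
      have e1 : (1 / (s 0 + s 1)) ^ 2 ≤ (1 / (s 1 + s 2)) ^ 2 := hmono (by linarith) (by linarith)
      have e2 : (1 / (s 0 + s 1)) ^ 2 ≤ (1 / (s 0 + s 2)) ^ 2 := hmono (by linarith) (by linarith)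
      set q := (1 / (s 0 + s 1)) ^ 2
      calc _ = 2 * ((X 0 1 - -X 0 1) ^ 2 * q + (X 0 2 - -X 0 2) ^ 2 * q +
            (X 1 2 - -X 1 2) ^ 2 * q) := by ring
        _ ≤ _ := by gcongr
    · rw [← norm_ne_zero_iff, hnorm, ← pow_ne_zero_iff two_ne_zero, hsq]
      simp
    · rw [hperp]
      ext i j
      fin_cases i <;> fin_cases j <;> simp
    · rw [hTX, hnorm, hnorm, ← sq_eq_sq₀ (by positivity) (by positivity), mul_pow, hskew, hsq]
      generalize 1 / (s 0 + s 1) = q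
      simp
      ring
  rw [restrictedCond, hmax, hmin]
  have := (add_pos h0 h1).ne'
  have := (add_pos h1 h2).ne'
  field_simp

theorem jacobianCond_eq_of_isSVD {M U V : Matrix (Fin 3) (Fin 3) ℝ} {s : Fin 3 → ℝ}
    (h : IsSVD M U s V) (hM : 0 < M.det) : jacobianCond M = (s 0 + s 1) / (s 1 + s 2) := by
  rw [jacobianCond, svdJacobian_eq_polarDeriv h hM, restrictedCond_polarDeriv h hM]

theorem jacobianCond_eq (M : Matrix (Fin 3) (Fin 3) ℝ) (hM : 0 < M.det) :
    jacobianCond M = (singVal M 0 + singVal M 1) / (singVal M 1 + singVal M 2) := by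
  obtain ⟨U, V, h⟩ := exists_isSVD_singVal M hM.ne'
  exact jacobianCond_eq_of_isSVD h hM

end

/-! ### Gaussian moments and integration by parts for polynomials -/

section

/-- The `n`-th moment of the standard Gaussian distribution. -/
noncomputable def gaussianMoment (n : ℕ) : ℝ := ∫ x, x ^ n ∂(gaussianReal 0 1)

theorem integrable_pow_gaussianReal (n : ℕ) :
    Integrable (fun x : ℝ => x ^ n) (gaussianReal 0 1) := by
  have h := (memLp_id_gaussianReal (μ := 0) (v := 1) (n : NNReal)).integrable_norm_pow'
  exact h.mono' (by fun_prop) (by simp)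

/-- Integration by parts against the density, whose derivative is `-x` times itself. For `n = 0` the
truncated index `n - 1` is multiplied by zero, so the formula correctly gives a vanishing mean. -/
theorem gaussianMoment_succ (n : ℕ) : gaussianMoment (n + 1) = n * gaussianMoment (n - 1) := by
  have hint : ∀ k : ℕ, Integrable (fun x : ℝ => x ^ k * gaussianPDFReal 0 1 x) := by
    intro k
    have h := integrable_pow_gaussianReal k
    rw [gaussianReal_of_var_ne_zero _ one_ne_zero,
      integrable_withDensity_iff_integrable_smul' (by fun_prop) (by simp [gaussianPDF])] at h
    refine h.congr (Eventually.of_forall fun x => ?_)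
    simp [mul_comm]
  have hE : ∀ k : ℕ, gaussianMoment k = ∫ x : ℝ, x ^ k * gaussianPDFReal 0 1 x := by
    intro k
    rw [gaussianMoment, integral_gaussianReal_eq_integral_smul one_ne_zero]
    simp [mul_comm]
  have hd : ∀ x : ℝ, HasDerivAt (gaussianPDFReal 0 1) (-(x * gaussianPDFReal 0 1 x)) x := by
    intro x
    have h1 : HasDerivAt (fun x : ℝ => -(x - 0) ^ 2 / (2 * ((1 : NNReal) : ℝ))) (-x) x := by
      have := (((hasDerivAt_id x).sub_const 0).pow 2).neg.div_const (2 * ((1 : NNReal) : ℝ))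
      refine this.congr_deriv ?_
      simp
      ring
    have h2 := h1.exp.const_mul ((√(2 * Real.pi * ((1 : NNReal) : ℝ)))⁻¹)
    refine h2.congr_deriv ?_
    rw [gaussianPDFReal]
    ring
  have h := integral_mul_deriv_eq_deriv_mul_of_integrable (u := fun x : ℝ => x ^ n)
    (u' := fun x => n * x ^ (n - 1)) (v := gaussianPDFReal 0 1)
    (v' := fun x => -(x * gaussianPDFReal 0 1 x)) (fun x _ => hasDerivAt_pow n x) (fun x _ => hd x)
    (by
      refine (hint (n + 1)).neg.congr (Eventually.of_forall fun x => ?_)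
      simp [pow_succ]; ring)
    (by
      refine ((hint (n - 1)).const_mul (n : ℝ)).congr (Eventually.of_forall fun x => ?_)
      simp [mul_assoc])
    (hint n)
  rw [hE, hE, ← integral_const_mul]
  have e1 : ∫ x : ℝ, x ^ n * -(x * gaussianPDFReal 0 1 x) =
      -∫ x : ℝ, x ^ (n + 1) * gaussianPDFReal 0 1 x := by
    rw [← integral_neg]
    congr 1; ext x; ring
  rw [e1] at h
  rw [neg_inj.1 h]
  congr 1; ext x; ring

section Wick

variable {ι : Type*} [Fintype ι]

theorem integrable_eval_mvPolynomial (p : MvPolynomial ι ℝ) :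
    Integrable (fun x : ι → ℝ => MvPolynomial.eval x p)
      (Measure.pi fun _ : ι => gaussianReal 0 1) := by
  induction p using MvPolynomial.induction_on' with
  | monomial s a =>
    simp only [MvPolynomial.eval_monomial, Finsupp.prod_fintype _ _ (fun _ => pow_zero _)]
    exact (Integrable.fintype_prod (f := fun i (x : ℝ) => x ^ s i)
      fun i => integrable_pow_gaussianReal (s i)).const_mul a
  | add p q hp hq =>
    simp only [map_add]
    exact hp.add hq

/-- Expectation of a polynomial in independent standard Gaussian variables. -/
noncomputable def gaussianExpect : MvPolynomial ι ℝ →ₗ[ℝ] ℝ where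
  toFun p := ∫ x, MvPolynomial.eval x p ∂(Measure.pi fun _ : ι => gaussianReal 0 1)
  map_add' p q := by
    simp only [map_add]
    exact integral_add (integrable_eval_mvPolynomial p) (integrable_eval_mvPolynomial q)
  map_smul' c p := by
    simp only [MvPolynomial.smul_eval, integral_const_mul, smul_eq_mul, RingHom.id_apply]

theorem gaussianExpect_monomial (s : ι →₀ ℕ) (a : ℝ) :
    gaussianExpect (MvPolynomial.monomial s a) = a * ∏ i, gaussianMoment (s i) := by
  change ∫ x, MvPolynomial.eval x (MvPolynomial.monomial s a) ∂_ = _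
  simp only [MvPolynomial.eval_monomial, Finsupp.prod_fintype _ _ (fun _ => pow_zero _),
    integral_const_mul]
  rw [integral_fintype_prod_eq_prod (f := fun i (x : ℝ) => x ^ s i)]
  rfl

/-- Gaussian integration by parts. -/
theorem gaussianExpect_X_mul (i : ι) (p : MvPolynomial ι ℝ) :
    gaussianExpect (MvPolynomial.X i * p) = gaussianExpect (MvPolynomial.pderiv i p) := by
  classical
  induction p using MvPolynomial.induction_on' with
  | monomial s a =>
    rw [MvPolynomial.pderiv_monomial, MvPolynomial.X, MvPolynomial.monomial_mul, one_mul,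
      gaussianExpect_monomial, gaussianExpect_monomial,
      ← Finset.mul_prod_erase Finset.univ
        (fun j => gaussianMoment ((Finsupp.single i 1 + s : ι →₀ ℕ) j)) (Finset.mem_univ i),
      ← Finset.mul_prod_erase Finset.univ
        (fun j => gaussianMoment ((s - Finsupp.single i 1 : ι →₀ ℕ) j)) (Finset.mem_univ i)]
    have h1 : ∀ j ∈ Finset.univ.erase i, gaussianMoment ((Finsupp.single i 1 + s : ι →₀ ℕ) j) =
        gaussianMoment ((s - Finsupp.single i 1 : ι →₀ ℕ) j) := by
      intro j hj
      have : i ≠ j := (Finset.ne_of_mem_erase hj).symm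
      simp [this]
    rw [Finset.prod_congr rfl h1]
    have h2 : (Finsupp.single i 1 + s : ι →₀ ℕ) i = s i + 1 := by simp [add_comm]
    have h3 : (s - Finsupp.single i 1 : ι →₀ ℕ) i = s i - 1 := by simp
    rw [h2, h3, gaussianMoment_succ]
    ring
  | add p q hp hq => rw [mul_add, map_add, map_add, map_add, hp, hq]

-- Integrating one factor `Xᵢ` by parts gives `E p + E(Xᵢ ∂ᵢp)`; summing over `i`, Euler's identity
-- for homogeneous polynomials contributes the degree.
open MvPolynomial in
theorem gaussianExpect_sum_sq_mul {p : MvPolynomial ι ℝ} {d : ℕ} (hp : p.IsHomogeneous d) :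
    gaussianExpect ((∑ i, MvPolynomial.X i ^ 2) * p) = (Fintype.card ι + d) * gaussianExpect p := by
  have h1 : ∀ i : ι, gaussianExpect (MvPolynomial.X i ^ 2 * p) =
      gaussianExpect p + gaussianExpect (MvPolynomial.X i * MvPolynomial.pderiv i p) := by
    intro i
    rw [sq, mul_assoc, gaussianExpect_X_mul, MvPolynomial.pderiv_mul, MvPolynomial.pderiv_X_self,
      one_mul, map_add]
  rw [Finset.sum_mul, map_sum, Finset.sum_congr rfl fun i _ => h1 i, Finset.sum_add_distrib,
    ← map_sum gaussianExpect (fun i => X i * pderiv i p), hp.sum_X_mul_pderiv, map_nsmul]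
  simp
  ring

/-- Integration by parts read backwards, `E ∂ᵢ∂ᵢp = E(Xᵢ ∂ᵢp)`, followed by Euler's identity. -/
theorem gaussianExpect_laplacian {p : MvPolynomial ι ℝ} {d : ℕ} (hp : p.IsHomogeneous d) :
    gaussianExpect (∑ i, MvPolynomial.pderiv i (MvPolynomial.pderiv i p)) =
      d * gaussianExpect p := by
  rw [map_sum, Finset.sum_congr rfl fun i _ => (gaussianExpect_X_mul i _).symm, ← map_sum,
    hp.sum_X_mul_pderiv, map_nsmul, nsmul_eq_mul]

end Wick

/-! ### The Cartan cubic and its Gaussian moments -/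

open MvPolynomial in
/-- The Cartan cubic: `3 √6` times the determinant of the traceless symmetric `3 × 3` matrix with
orthonormal coordinates `X 0, …, X 4`. -/
noncomputable def cartanCubic : MvPolynomial (Fin 5) ℝ :=
  C 3 * X 0 ^ 2 * X 1 - X 1 ^ 3 + C 3 * X 1 * X 2 ^ 2 - C (3 / 2) * X 1 * (X 3 ^ 2 + X 4 ^ 2) +
    C (3 / 2 * √3) * X 0 * (X 3 ^ 2 - X 4 ^ 2) + C (3 * √3) * X 2 * X 3 * X 4

open MvPolynomial in
theorem isHomogeneous_cartanCubic : cartanCubic.IsHomogeneous 3 := by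
  have hX : ∀ i : Fin 5, (X i : MvPolynomial (Fin 5) ℝ).IsHomogeneous 1 := isHomogeneous_X ℝ
  have hC : ∀ a : ℝ, (C a : MvPolynomial (Fin 5) ℝ).IsHomogeneous 0 := isHomogeneous_C _
  have hX2 : ∀ i : Fin 5, (X i ^ 2 : MvPolynomial (Fin 5) ℝ).IsHomogeneous 2 :=
    fun i => (hX i).pow 2
  refine IsHomogeneous.add (IsHomogeneous.add (IsHomogeneous.sub (IsHomogeneous.add
    (IsHomogeneous.sub ?_ ?_) ?_) ?_) ?_) ?_
  · exact ((hC _).mul (hX2 0)).mul (hX 1)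
  · exact (hX 1).pow 3
  · exact ((hC _).mul (hX 1)).mul (hX2 2)
  · exact ((hC _).mul (hX 1)).mul ((hX2 3).add (hX2 4))
  · exact ((hC _).mul (hX 0)).mul ((hX2 3).sub (hX2 4))
  · exact (((hC _).mul (hX 2)).mul (hX 3)).mul (hX 4)

open MvPolynomial in
theorem sum_pderiv_pderiv_cartanCubic : ∑ i, pderiv i (pderiv i cartanCubic) = 0 := by
  have h2 : ∀ i : Fin 5, pderiv i (2 : MvPolynomial (Fin 5) ℝ) = 0 := fun i => by
    simpa using (pderiv (R := ℝ) i).map_natCast 2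
  have h3 : ∀ i : Fin 5, pderiv i (3 : MvPolynomial (Fin 5) ℝ) = 0 := fun i => by
    simpa using (pderiv (R := ℝ) i).map_natCast 3
  refine funext fun x => ?_
  simp [Fin.sum_univ_five, cartanCubic, Pi.single_apply, Fin.reduceEq, h2, h3]
  ring

-- Together with harmonicity this is Cartan's isoparametric equation; it makes the Laplacian of a
-- power of the cubic a radial polynomial times a lower power, which closes the moment recursion.
open MvPolynomial in
theorem sum_sq_pderiv_cartanCubic :
    ∑ i, pderiv i cartanCubic ^ 2 = C 9 * (∑ i, X i ^ 2) ^ 2 := by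
  refine funext fun x => ?_
  have h3 : √3 * √3 = 3 := Real.mul_self_sqrt (by norm_num)
  simp [Fin.sum_univ_five, cartanCubic, Pi.single_apply, Fin.reduceEq]
  linear_combination ((3 / 2 * (x 3 ^ 2 - x 4 ^ 2)) ^ 2 + (3 * x 3 * x 4) ^ 2 +
    (3 * x 0 * x 3 + 3 * x 2 * x 4) ^ 2 + (-3 * x 0 * x 4 + 3 * x 2 * x 3) ^ 2) * h3

-- Here `ΔQ^(k+2) = 9(k+2)(k+1)|x|⁴Q^k`. The Laplacian identity evaluates the left side in degree
-- `3(k+2)`, and removing `|x|²` twice yields the factors `3k+7` and `3k+5`.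
open MvPolynomial in
theorem gaussianExpect_cartanCubic_pow_add_two (k : ℕ) :
    gaussianExpect (cartanCubic ^ (k + 2)) =
      3 * (k + 1) * (3 * k + 5) * (3 * k + 7) * gaussianExpect (cartanCubic ^ k) := by
  have hQ := isHomogeneous_cartanCubic
  set Q := cartanCubic with hQdef
  have hlap : ∑ i, pderiv i (pderiv i (Q ^ (k + 2))) =
      C ((k + 2) * (k + 1) * 9 : ℝ) * ((∑ i, X i ^ 2) * ((∑ i, X i ^ 2) * Q ^ k)) := by
    have h1 : ∀ i, pderiv i (pderiv i (Q ^ (k + 2))) =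
        C ((k + 2) * (k + 1) : ℝ) * Q ^ k * pderiv i Q ^ 2 +
          C (k + 2 : ℝ) * Q ^ (k + 1) * pderiv i (pderiv i Q) := by
      intro i
      rw [pderiv_pow, pderiv_mul, pderiv_mul, pderiv_pow]
      have h0 : pderiv i ((k + 2 : ℕ) : MvPolynomial (Fin 5) ℝ) = 0 :=
        (pderiv (R := ℝ) i).map_natCast _
      have hC2 : (C 2 : MvPolynomial (Fin 5) ℝ) = 2 := map_ofNat C 2
      rw [h0]
      simp [hC2]
      ring
    rw [Finset.sum_congr rfl fun i _ => h1 i, Finset.sum_add_distrib, ← Finset.mul_sum,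
      ← Finset.mul_sum, hQdef, sum_pderiv_pderiv_cartanCubic, sum_sq_pderiv_cartanCubic]
    simp
    ring
  have h1 := gaussianExpect_laplacian (hQ.pow (k + 2))
  have hR : (∑ i : Fin 5, X i ^ 2 : MvPolynomial (Fin 5) ℝ).IsHomogeneous 2 :=
    IsHomogeneous.sum _ _ _ fun i _ => (isHomogeneous_X ℝ i).pow 2
  rw [hlap, ← smul_eq_C_mul, map_smul, gaussianExpect_sum_sq_mul (hR.mul (hQ.pow k)),
    gaussianExpect_sum_sq_mul (hQ.pow k)] at h1
  have h2 : (k + 2 : ℝ) ≠ 0 := by positivity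
  push_cast at h1
  simp only [Fintype.card_fin, smul_eq_mul] at h1
  push_cast at h1
  have h3 : (k + 2 : ℝ) * (3 * gaussianExpect (Q ^ (k + 2)) -
      3 * (3 * (k + 1) * (3 * k + 5) * (3 * k + 7) * gaussianExpect (Q ^ k))) = 0 := by
    linear_combination -h1
  have := (mul_eq_zero.1 h3).resolve_left h2
  linarith

theorem gaussianExpect_cartanCubic : gaussianExpect cartanCubic = 0 := by
  have h1 := gaussianExpect_laplacian isHomogeneous_cartanCubic
  rw [sum_pderiv_pderiv_cartanCubic, map_zero] at h1
  push_cast at h1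
  linarith

end

/-! ### Gaussian integrals in polar coordinates -/

theorem pi_gaussianReal_eq_withDensity (ι : Type*) [Fintype ι] :
    (Measure.pi fun _ : ι => gaussianReal 0 1) =
      volume.withDensity fun x : ι → ℝ => ∏ i, gaussianPDF 0 1 (x i) := by
  symm
  refine (Measure.pi_eq fun s hs => ?_).symm
  have h1 : Integrable (fun x : ι → ℝ => ∏ i, gaussianPDFReal 0 1 (x i))
      (Measure.pi fun i => volume.restrict (s i)) :=
    Integrable.fintype_prod fun i => (integrable_gaussianPDFReal 0 1).restrict
  have h2 : ∀ x : ι → ℝ, ∏ i, gaussianPDF 0 1 (x i) =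
      ENNReal.ofReal (∏ i, gaussianPDFReal 0 1 (x i)) := fun x => by
    rw [ENNReal.ofReal_prod_of_nonneg fun i _ => gaussianPDFReal_nonneg 0 1 _]
    rfl
  rw [withDensity_apply _ (MeasurableSet.univ_pi hs), volume_pi, Measure.restrict_pi_pi]
  simp only [h2]
  rw [← ofReal_integral_eq_lintegral_ofReal h1 (Eventually.of_forall fun x =>
      Finset.prod_nonneg fun i _ => gaussianPDFReal_nonneg 0 1 _),
    integral_fintype_prod_eq_prod, ENNReal.ofReal_prod_of_nonneg fun i _ =>
      integral_nonneg fun x => gaussianPDFReal_nonneg 0 1 x]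
  exact Finset.prod_congr rfl fun i _ => (gaussianReal_apply_eq_integral 0 one_ne_zero (s i)).symm

theorem integral_stdGaussian_eq {ι : Type*} [Fintype ι] (f : EuclideanSpace ℝ ι → ℝ) :
    ∫ x, f x ∂(stdGaussian (EuclideanSpace ℝ ι)) =
      (√(2 * Real.pi))⁻¹ ^ Fintype.card ι * ∫ x, Real.exp (-‖x‖ ^ 2 / 2) * f x := by
  rw [← map_pi_eq_stdGaussian, ← (PiLp.volume_preserving_toLp ι).map_eq]
  have hcoe : (WithLp.toLp 2 : (ι → ℝ) → EuclideanSpace ℝ ι) = MeasurableEquiv.toLp 2 (ι → ℝ) := rfl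
  rw [hcoe, MeasurableEmbedding.integral_map (MeasurableEquiv.toLp 2 (ι → ℝ)).measurableEmbedding,
    MeasurableEmbedding.integral_map (MeasurableEquiv.toLp 2 (ι → ℝ)).measurableEmbedding,
    pi_gaussianReal_eq_withDensity,
    integral_withDensity_eq_integral_toReal_smul (by fun_prop)]
  · rw [← integral_const_mul]
    refine integral_congr_ae (Eventually.of_forall fun x => ?_)
    simp [ENNReal.toReal_prod, gaussianPDFReal, Finset.prod_mul_distrib, EuclideanSpace.norm_sq_eq,
      ← Real.exp_sum, Finset.sum_div, neg_div, mul_assoc, mul_pow]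
  · refine Eventually.of_forall fun x => ?_
    exact ENNReal.prod_lt_top fun i _ => gaussianPDF_lt_top

/-- Homogeneity is required only for positive `r`, so functions involving the norm, and not just
polynomials, are covered. Values at the origin do not matter because it is a null set. -/
theorem integral_exp_neg_norm_sq_mul_of_homogeneous {E : Type*} [NormedAddCommGroup E]
    [NormedSpace ℝ E] [FiniteDimensional ℝ E] [Nontrivial E] [MeasurableSpace E] [BorelSpace E]
    (μ : Measure E) [μ.IsAddHaarMeasure] {f : E → ℝ} {d : ℕ}
    (hf : ∀ (r : ℝ) (x : E), 0 < r → f (r • x) = r ^ d * f x) :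
    ∫ x, Real.exp (-‖x‖ ^ 2 / 2) * f x ∂μ =
      (∫ x : Metric.sphere (0 : E) 1, f x ∂μ.toSphere) *
        ∫ r in Set.Ioi (0 : ℝ), r ^ (Module.finrank ℝ E - 1 + d) * Real.exp (-r ^ 2 / 2) := by
  calc ∫ x, Real.exp (-‖x‖ ^ 2 / 2) * f x ∂μ
      = ∫ x : ({(0)}ᶜ : Set E), Real.exp (-‖x.1‖ ^ 2 / 2) * f x ∂(μ.comap (↑)) := by
        rw [integral_subtype_comap (MeasurableSet.singleton _).compl
          fun x ↦ Real.exp (-‖x‖ ^ 2 / 2) * f x, restrict_compl_singleton]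
    _ = ∫ x : Metric.sphere (0 : E) 1 × Set.Ioi (0 : ℝ), f x.1 *
          (Real.exp (-(x.2 : ℝ) ^ 2 / 2) * (x.2 : ℝ) ^ d)
          ∂μ.toSphere.prod (.volumeIoiPow (Module.finrank ℝ E - 1)) := by
        rw [← μ.measurePreserving_homeomorphUnitSphereProd.integral_comp
          (Homeomorph.measurableEmbedding _)]
        refine integral_congr_ae (Eventually.of_forall fun x => ?_)
        have hx : 0 < ‖x.1‖ := norm_pos_iff.2 x.2
        have h1 : x.1 = ‖x.1‖ • (‖x.1‖⁻¹ • x.1) := by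
          rw [smul_smul, mul_inv_cancel₀ hx.ne', one_smul]
        simp only [homeomorphUnitSphereProd_apply_snd_coe, homeomorphUnitSphereProd_apply_fst_coe]
        conv_lhs => rw [h1, hf _ _ hx, ← h1]
        ring
    _ = (∫ x : Metric.sphere (0 : E) 1, f x ∂μ.toSphere) *
          ∫ r : Set.Ioi (0 : ℝ), Real.exp (-(r : ℝ) ^ 2 / 2) * (r : ℝ) ^ d
            ∂.volumeIoiPow (Module.finrank ℝ E - 1) :=
        integral_prod_mul (fun x : Metric.sphere (0 : E) 1 => f x)
          (fun r : Set.Ioi (0 : ℝ) => Real.exp (-(r : ℝ) ^ 2 / 2) * (r : ℝ) ^ d)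
    _ = _ := by
        congr 1
        simp only [Measure.volumeIoiPow, ENNReal.ofReal]
        rw [integral_withDensity_eq_integral_smul,
          integral_subtype_comap measurableSet_Ioi fun a ↦ Real.toNNReal
            (a ^ (Module.finrank ℝ E - 1)) • (Real.exp (-a ^ 2 / 2) * a ^ d),
          setIntegral_congr_fun measurableSet_Ioi fun x hx ↦ ?_]
        · rw [NNReal.smul_def, Real.coe_toNNReal _ (pow_nonneg hx.out.le _), smul_eq_mul]
          ring
        · exact (measurable_subtype_coe.pow_const _).real_toNNReal

/-- The integral `∫₀^∞ r ^ n exp (-r² / 2) dr`. -/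
noncomputable def radialMoment (n : ℕ) : ℝ :=
  ∫ r in Set.Ioi (0 : ℝ), r ^ n * Real.exp (-r ^ 2 / 2)

theorem radialMoment_eq (n : ℕ) :
    radialMoment n = (1 / 2 : ℝ) ^ (-((n : ℝ) + 1) / 2) * (1 / 2) * Real.Gamma (((n : ℝ) + 1) / 2) := by
  have h := integral_rpow_mul_exp_neg_mul_rpow (p := 2) (q := n) (b := 1 / 2) (by norm_num)
    (by have : (0 : ℝ) ≤ n := n.cast_nonneg
        linarith) (by norm_num)
  rw [← h, radialMoment]
  refine setIntegral_congr_fun measurableSet_Ioi fun r hr => ?_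
  simp only [Real.rpow_natCast, Real.rpow_two]
  congr 2
  ring

theorem radialMoment_pos (n : ℕ) : 0 < radialMoment n := by
  rw [radialMoment_eq]
  have : 0 < Real.Gamma (((n : ℝ) + 1) / 2) := Real.Gamma_pos_of_pos (by positivity)
  positivity

theorem radialMoment_add_two (n : ℕ) : radialMoment (n + 2) = (n + 1) * radialMoment n := by
  rw [radialMoment_eq, radialMoment_eq]
  have h1 : (((n + 2 : ℕ) : ℝ) + 1) / 2 = ((n : ℝ) + 1) / 2 + 1 := by push_cast; ring
  have h2 : -(((n + 2 : ℕ) : ℝ) + 1) / 2 = -((n : ℝ) + 1) / 2 - 1 := by push_cast; ring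
  rw [h1, h2, Real.Gamma_add_one (by positivity), Real.rpow_sub_one (by norm_num)]
  ring

theorem radialMoment_one : radialMoment 1 = 1 := by
  rw [radialMoment_eq]
  norm_num

theorem radialMoment_zero : radialMoment 0 = √(Real.pi / 2) := by
  rw [radialMoment_eq]
  norm_num
  rw [Real.Gamma_one_half_eq, Real.rpow_neg (by norm_num), ← Real.sqrt_eq_rpow, Real.sqrt_div
    zero_le_one, Real.sqrt_one, one_div, inv_inv]
  have h2 : √2 ^ 2 = 2 := Real.sq_sqrt (by norm_num)
  field_simp
  linear_combination h2

/-! ### Uniform distribution of the Cartan cubic on the unit sphere -/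

/-- The Cartan cubic as a function on `ℝ⁵`. -/
noncomputable def cartanFun (x : EuclideanSpace ℝ (Fin 5)) : ℝ := MvPolynomial.eval x.ofLp cartanCubic

theorem cartanFun_eq (x : EuclideanSpace ℝ (Fin 5)) :
    cartanFun x = 3 * x 0 ^ 2 * x 1 - x 1 ^ 3 + 3 * x 1 * x 2 ^ 2 -
      3 / 2 * x 1 * (x 3 ^ 2 + x 4 ^ 2) + 3 / 2 * √3 * x 0 * (x 3 ^ 2 - x 4 ^ 2) +
        3 * √3 * x 2 * x 3 * x 4 := by
  simp [cartanFun, cartanCubic]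

theorem continuous_cartanFun : Continuous cartanFun := by
  have : cartanFun = fun x => _ := funext cartanFun_eq
  rw [this]
  fun_prop

theorem cartanFun_smul (r : ℝ) (x : EuclideanSpace ℝ (Fin 5)) :
    cartanFun (r • x) = r ^ 3 * cartanFun x := by
  simp only [cartanFun_eq, PiLp.smul_apply, smul_eq_mul]
  ring

theorem integral_stdGaussian_of_homogeneous {f : EuclideanSpace ℝ (Fin 5) → ℝ} {d : ℕ}
    (hf : ∀ (r : ℝ) (x : EuclideanSpace ℝ (Fin 5)), 0 < r → f (r • x) = r ^ d * f x) :
    ∫ x, f x ∂(stdGaussian (EuclideanSpace ℝ (Fin 5))) =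
      (√(2 * Real.pi))⁻¹ ^ 5 * ((∫ x : Metric.sphere (0 : EuclideanSpace ℝ (Fin 5)) 1, f x
        ∂(volume : Measure (EuclideanSpace ℝ (Fin 5))).toSphere) * radialMoment (4 + d)) := by
  rw [integral_stdGaussian_eq, integral_exp_neg_norm_sq_mul_of_homogeneous volume hf]
  simp [radialMoment]

/-- The rotation invariant measure on the unit sphere of `ℝ⁵`. -/
noncomputable abbrev sphereMeasure : Measure (Metric.sphere (0 : EuclideanSpace ℝ (Fin 5)) 1) :=
  (volume : Measure (EuclideanSpace ℝ (Fin 5))).toSphere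

theorem integral_cartanFun_pow (k : ℕ) :
    ∫ x, cartanFun x ^ k ∂(stdGaussian (EuclideanSpace ℝ (Fin 5))) =
      gaussianExpect (cartanCubic ^ k) := by
  rw [← map_pi_eq_stdGaussian,
    integral_map (f := fun x => cartanFun x ^ k) (by fun_prop)
      (continuous_cartanFun.pow k).aestronglyMeasurable]
  simp [cartanFun, gaussianExpect]

/-- Passing from the Gaussian to the sphere divides by radial moments, whose ratio is
`(3k+5)(3k+7)(3k+9)`. Two of these factors cancel against the Gaussian recursion, leaving
`(k+1)/(k+3)`, the ratio for the uniform law on `[-1,1]`. -/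
theorem integral_sphere_cartanFun_pow_add_two (k : ℕ) :
    (k + 3) * ∫ x : Metric.sphere (0 : EuclideanSpace ℝ (Fin 5)) 1,
      cartanFun x ^ (k + 2) ∂sphereMeasure =
    (k + 1) * ∫ x : Metric.sphere (0 : EuclideanSpace ℝ (Fin 5)) 1,
      cartanFun x ^ k ∂sphereMeasure := by
  have hom : ∀ k : ℕ, ∀ (r : ℝ) (x : EuclideanSpace ℝ (Fin 5)), 0 < r →
      cartanFun (r • x) ^ k = r ^ (3 * k) * cartanFun x ^ k := by
    intro k r x _
    rw [cartanFun_smul, mul_pow, pow_mul]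
  have h1 := integral_stdGaussian_of_homogeneous (f := fun x => cartanFun x ^ k) (hom k)
  have h2 := integral_stdGaussian_of_homogeneous (f := fun x => cartanFun x ^ (k + 2)) (hom (k + 2))
  rw [integral_cartanFun_pow] at h1 h2
  rw [gaussianExpect_cartanCubic_pow_add_two, h1] at h2
  have e : 4 + 3 * (k + 2) = (((4 + 3 * k) + 2) + 2) + 2 := by ring
  rw [e, radialMoment_add_two, radialMoment_add_two, radialMoment_add_two] at h2
  have hc : (0 : ℝ) < (√(2 * Real.pi))⁻¹ ^ 5 := by positivity
  have hJ := radialMoment_pos (4 + 3 * k)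
  set c := (√(2 * Real.pi))⁻¹ ^ 5
  set J := radialMoment (4 + 3 * k)
  push_cast at h2
  have hne : c * J * (3 * (3 * k + 5) * (3 * k + 7)) ≠ 0 := by positivity
  refine mul_left_cancel₀ hne ?_
  linear_combination -h2

theorem integral_sphere_cartanFun :
    ∫ x : Metric.sphere (0 : EuclideanSpace ℝ (Fin 5)) 1, cartanFun x ∂sphereMeasure = 0 := by
  have h1 := integral_stdGaussian_of_homogeneous (f := cartanFun) (d := 3)
    fun r x _ => cartanFun_smul r x
  have h2 := integral_cartanFun_pow 1
  simp only [pow_one, gaussianExpect_cartanCubic] at h2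
  rw [h2] at h1
  have hc : (√(2 * Real.pi))⁻¹ ^ 5 ≠ 0 := by positivity
  exact (mul_eq_zero.1 ((mul_eq_zero.1 h1.symm).resolve_left hc)).resolve_right
    (radialMoment_pos 7).ne'

theorem integral_sphere_cartanFun_pow (k : ℕ) :
    ∫ x : Metric.sphere (0 : EuclideanSpace ℝ (Fin 5)) 1, cartanFun x ^ k ∂sphereMeasure =
      sphereMeasure.real Set.univ / 2 * ∫ t in (-1 : ℝ)..1, t ^ k := by
  induction k using Nat.twoStepInduction with
  | zero => simp; norm_num
  | one => simp [integral_sphere_cartanFun]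
  | more k ih _ =>
    have h := integral_sphere_cartanFun_pow_add_two k
    rw [ih] at h
    have h3 : (k + 3 : ℝ) ≠ 0 := by positivity
    have h1 : (k + 1 : ℝ) ≠ 0 := by positivity
    refine mul_left_cancel₀ h3 (h.trans ?_)
    rw [integral_pow, integral_pow]
    push_cast
    have e : (-1 : ℝ) ^ (k + 2 + 1) = (-1) ^ (k + 1) := by ring
    rw [e]
    have h3' : (k + 2 + 1 : ℝ) ≠ 0 := by positivity
    field_simp
    simp
    ring

/-- Equality of moments passes to continuous functions by Weierstrass approximation on `[-1,1]`,
which is why the range of the cubic on the sphere enters as a hypothesis. -/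
theorem integral_sphere_comp_cartanFun
    (hq : ∀ x : Metric.sphere (0 : EuclideanSpace ℝ (Fin 5)) 1, cartanFun x ∈ Set.Icc (-1 : ℝ) 1)
    {h : ℝ → ℝ} (hh : Continuous h) :
    ∫ x : Metric.sphere (0 : EuclideanSpace ℝ (Fin 5)) 1, h (cartanFun x) ∂sphereMeasure =
      sphereMeasure.real Set.univ / 2 * ∫ t in (-1 : ℝ)..1, h t := by
  set m := sphereMeasure.real Set.univ with hm
  have hm0 : 0 ≤ m := measureReal_nonneg
  have hcont : ∀ {g : ℝ → ℝ}, Continuous g →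
      Integrable (fun x : Metric.sphere (0 : EuclideanSpace ℝ (Fin 5)) 1 => g (cartanFun x))
        sphereMeasure := by
    intro g hg
    exact (hg.comp (continuous_cartanFun.comp continuous_subtype_val)).integrable_of_hasCompactSupport
      (HasCompactSupport.of_compactSpace _)
  have hpoly : ∀ p : Polynomial ℝ,
      ∫ x : Metric.sphere (0 : EuclideanSpace ℝ (Fin 5)) 1, p.eval (cartanFun x) ∂sphereMeasure =
        m / 2 * ∫ t in (-1 : ℝ)..1, p.eval t := by
    intro p
    simp only [Polynomial.eval_eq_sum_range]
    rw [integral_finsetSum _ fun i _ => (hcont (continuous_pow i)).const_mul _,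
      intervalIntegral.integral_finsetSum (f := fun i t => p.coeff i * t ^ i) fun i _ =>
        (continuous_const.mul (continuous_pow i)).intervalIntegrable _ _, Finset.mul_sum]
    refine Finset.sum_congr rfl fun i _ => ?_
    rw [integral_const_mul, intervalIntegral.integral_const_mul, integral_sphere_cartanFun_pow]
    ring
  refine eq_of_forall_dist_le fun ε hε => ?_
  -- Both sides move by at most `m` times the tolerance; the `+ 1` keeps the denominator positive
  -- without knowing `m > 0`.
  obtain ⟨p, hp⟩ := exists_polynomial_near_of_continuousOn (-1) 1 h hh.continuousOn
    (ε / (2 * m + 1)) (by positivity)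
  have e1 : |(∫ x : Metric.sphere (0 : EuclideanSpace ℝ (Fin 5)) 1, h (cartanFun x) ∂sphereMeasure) -
      ∫ x : Metric.sphere (0 : EuclideanSpace ℝ (Fin 5)) 1, p.eval (cartanFun x) ∂sphereMeasure| ≤
      ε / (2 * m + 1) * m := by
    rw [← integral_sub (hcont hh) (hcont p.continuous), ← Real.norm_eq_abs]
    refine norm_integral_le_of_norm_le_const (Eventually.of_forall fun x => ?_)
    rw [Real.norm_eq_abs, abs_sub_comm]
    exact (hp _ (hq x)).le
  have e2 : |(∫ t in (-1 : ℝ)..1, p.eval t) - ∫ t in (-1 : ℝ)..1, h t| ≤ ε / (2 * m + 1) * 2 := by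
    rw [← intervalIntegral.integral_sub (p.continuous.intervalIntegrable _ _)
      (hh.intervalIntegrable _ _), ← Real.norm_eq_abs]
    refine (intervalIntegral.norm_integral_le_of_norm_le_const (C := ε / (2 * m + 1))
      fun t ht => ?_).trans (by norm_num)
    rw [Set.uIoc_of_le (by norm_num)] at ht
    exact (hp t ⟨ht.1.le, ht.2⟩).le
  rw [Real.dist_eq]
  rw [hpoly] at e1
  calc _ = |((∫ x : Metric.sphere (0 : EuclideanSpace ℝ (Fin 5)) 1, h (cartanFun x) ∂sphereMeasure) -
        m / 2 * ∫ t in (-1 : ℝ)..1, p.eval t) +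
          m / 2 * ((∫ t in (-1 : ℝ)..1, p.eval t) - ∫ t in (-1 : ℝ)..1, h t)| := by ring_nf
    _ ≤ ε / (2 * m + 1) * m + m / 2 * (ε / (2 * m + 1) * 2) := by
        refine (abs_add_le _ _).trans (add_le_add e1 ?_)
        rw [abs_mul, abs_of_nonneg (by positivity : 0 ≤ m / 2)]
        gcongr
    _ = ε * (2 * m / (2 * m + 1)) := by ring
    _ ≤ ε * 1 := by
        gcongr
        rw [div_le_one (by positivity)]
        linarith
    _ = ε := mul_one ε

/-! ### Trigonometric solution of the cubic and the mean largest eigenvalue -/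

section

open scoped Matrix

/-- The largest root of a depressed cubic with three real roots, normalized. -/
noncomputable def trisectCos (t : ℝ) : ℝ := Real.cos (Real.arccos t / 3)

theorem continuous_trisectCos : Continuous trisectCos :=
  Real.continuous_cos.comp (Real.continuous_arccos.div_const 3)

theorem half_le_trisectCos (t : ℝ) : 1 / 2 ≤ trisectCos t := by
  rw [← Real.cos_pi_div_three]
  refine Real.cos_le_cos_of_nonneg_of_le_pi ?_ ?_ ?_
  · linarith [Real.arccos_nonneg t]
  · linarith [Real.pi_pos]
  · linarith [Real.arccos_le_pi t]

theorem trisectCos_cubic {t : ℝ} (h : t ∈ Set.Icc (-1 : ℝ) 1) :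
    4 * trisectCos t ^ 3 - 3 * trisectCos t = t := by
  rw [trisectCos, ← Real.cos_three_mul, mul_div_cancel₀ _ (by norm_num : (3 : ℝ) ≠ 0),
    Real.cos_arccos h.1 h.2]

/-- Substitute `t = cos 3θ`, so that the integrand becomes `-3 cos θ sin 3θ`; the product formula
gives the antiderivative in `cos 4θ` and `cos 2θ`. -/
theorem integral_trisectCos : ∫ t in (-1 : ℝ)..1, trisectCos t = 27 / 16 := by
  have h1 : ∫ t in (-1 : ℝ)..1, trisectCos t =
      ∫ θ in Real.pi / 3..0, trisectCos (Real.cos (3 * θ)) * (-(3 * Real.sin (3 * θ))) := by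
    have := intervalIntegral.integral_comp_mul_deriv (a := Real.pi / 3) (b := 0)
      (f := fun θ => Real.cos (3 * θ)) (f' := fun θ => -(3 * Real.sin (3 * θ))) (g := trisectCos)
      (fun x _ => by
        have := ((hasDerivAt_id x).const_mul 3).cos
        refine this.congr_deriv ?_
        simp; ring)
      (by fun_prop) continuous_trisectCos
    simp only [Function.comp_apply] at this
    rw [this]
    congr 1
    · rw [mul_div_cancel₀ _ (by norm_num : (3 : ℝ) ≠ 0), Real.cos_pi]
    · simp
  have h2 : ∫ θ in Real.pi / 3..0, trisectCos (Real.cos (3 * θ)) * (-(3 * Real.sin (3 * θ))) =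
      ∫ θ in Real.pi / 3..0, Real.cos θ * (-(3 * Real.sin (3 * θ))) := by
    refine intervalIntegral.integral_congr fun θ hθ => ?_
    rw [Set.uIcc_of_ge (by positivity)] at hθ
    have : trisectCos (Real.cos (3 * θ)) = Real.cos θ := by
      rw [trisectCos, Real.arccos_cos (by linarith [hθ.1]) (by linarith [hθ.2]),
        mul_div_cancel_left₀ _ (by norm_num : (3 : ℝ) ≠ 0)]
    simp only [this]
  have h3 : ∀ θ ∈ Set.uIcc (Real.pi / 3) 0, HasDerivAt
      (fun θ => 3 / 8 * Real.cos (4 * θ) + 3 / 4 * Real.cos (2 * θ))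
      (Real.cos θ * (-(3 * Real.sin (3 * θ)))) θ := by
    intro θ _
    have h4 := (((hasDerivAt_id θ).const_mul 4).cos.const_mul (3 / 8)).add
      (((hasDerivAt_id θ).const_mul 2).cos.const_mul (3 / 4))
    refine h4.congr_deriv ?_
    have e1 : Real.sin (4 * θ) = Real.sin (3 * θ + θ) := by ring_nf
    have e2 : Real.sin (2 * θ) = Real.sin (3 * θ - θ) := by ring_nf
    simp only [id]
    rw [e1, e2, Real.sin_add, Real.sin_sub]
    ring
  rw [h1, h2, intervalIntegral.integral_eq_sub_of_hasDerivAt h3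
    ((by fun_prop : Continuous fun θ => Real.cos θ * (-(3 * Real.sin (3 * θ)))).intervalIntegrable
      _ _)]
  have e1 : Real.cos (2 * (Real.pi / 3)) = -(1 / 2) := by
    rw [Real.cos_two_mul, Real.cos_pi_div_three]; norm_num
  have e2 : Real.cos (4 * (Real.pi / 3)) = -(1 / 2) := by
    have : 4 * (Real.pi / 3) = 2 * (2 * (Real.pi / 3)) := by ring
    rw [this, Real.cos_two_mul, e1]; norm_num
  rw [e1, e2]
  norm_num

/-- The difference of the two sides is twice the discriminant of the cubic with roots `a`, `b`, `c`,
hence twice a square. -/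
theorem abs_prod_le_of_sum_eq_zero {a b c r : ℝ} (h0 : a + b + c = 0)
    (h2 : a ^ 2 + b ^ 2 + c ^ 2 = r ^ 2) : 54 * (a * b * c) ^ 2 ≤ (r ^ 3) ^ 2 := by
  have hc : c = -a - b := by linarith
  have h3 : (r ^ 3) ^ 2 = (r ^ 2) ^ 3 := by ring
  rw [h3, ← h2, hc]
  have : 0 ≤ 2 * ((a - b) * (2 * a + b) * (a + 2 * b)) ^ 2 := by positivity
  nlinarith

theorem max_root_eq_trisectCos {μ : Fin 3 → ℝ} {r q l : ℝ} (hr : 0 ≤ r) (h0 : ∑ i, μ i = 0)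
    (h2 : ∑ i, μ i ^ 2 = r ^ 2) (h3 : 3 * √6 * ∏ i, μ i = q) (hle : ∀ i, μ i ≤ l)
    (hex : ∃ i, μ i = l) : l = √(2 / 3) * r * trisectCos (q / r ^ 3) := by
  rw [Fin.sum_univ_three] at h0 h2
  rw [Fin.prod_univ_three] at h3
  -- For `r = 0` all roots vanish, and the factor `r` annihilates the right side whatever the
  -- quotient by zero means.
  rcases hr.eq_or_lt with rfl | hr
  · obtain ⟨i, rfl⟩ := hex
    have : μ i ^ 2 = 0 := by
      fin_cases i
      · exact le_antisymm (by simp only [Fin.zero_eta]; nlinarith [sq_nonneg (μ 1), sq_nonneg (μ 2)]) (sq_nonneg _)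
      · exact le_antisymm (by simp only [Fin.mk_one]; nlinarith [sq_nonneg (μ 0), sq_nonneg (μ 2)]) (sq_nonneg _)
      · exact le_antisymm (by simp only [Fin.reduceFinMk]; nlinarith [sq_nonneg (μ 1), sq_nonneg (μ 0)]) (sq_nonneg _)
    simpa using this
  · have h6 : √6 ^ 2 = 6 := Real.sq_sqrt (by norm_num)
    have ht : q / r ^ 3 ∈ Set.Icc (-1 : ℝ) 1 := by
      rw [Set.mem_Icc, ← abs_le, ← sq_le_one_iff_abs_le_one, div_pow, div_le_one (by positivity), ← h3]
      have := abs_prod_le_of_sum_eq_zero h0 h2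
      nlinarith
    have hc := trisectCos_cubic ht
    have hhalf := half_le_trisectCos (q / r ^ 3)
    set c := trisectCos (q / r ^ 3)
    set w := √(2 / 3) with hw
    have hw2 : w ^ 2 = 2 / 3 := Real.sq_sqrt (by norm_num)
    have hw0 : 0 < w := Real.sqrt_pos.2 (by norm_num)
    have hw6 : w * √6 = 2 := by
      rw [hw, ← Real.sqrt_mul (by norm_num)]
      rw [show (2 / 3 * 6 : ℝ) = 2 ^ 2 by norm_num]
      exact Real.sqrt_sq (by norm_num)
    have hq : q = r ^ 3 * (4 * c ^ 3 - 3 * c) := by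
      rw [hc]; field_simp
    have hp : 6 * (μ 0 * μ 1 * μ 2) = w * q := by
      rw [← h3]; linear_combination (-3 * (μ 0 * μ 1 * μ 2)) * hw6
    have he2 : μ 0 * μ 1 + μ 0 * μ 2 + μ 1 * μ 2 = -r ^ 2 / 2 := by
      have : (μ 0 + μ 1 + μ 2) ^ 2 = 0 := by rw [h0]; ring
      nlinarith
    set l' := w * r * c with hl'
    have hroot : (l' - μ 0) * (l' - μ 1) * (l' - μ 2) = 0 := by
      have e1 : (l' - μ 0) * (l' - μ 1) * (l' - μ 2) = l' ^ 3 - (μ 0 + μ 1 + μ 2) * l' ^ 2 +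
        (μ 0 * μ 1 + μ 0 * μ 2 + μ 1 * μ 2) * l' - μ 0 * μ 1 * μ 2 := by ring
      rw [e1, h0, he2]
      have e2 : μ 0 * μ 1 * μ 2 = w * q / 6 := by linarith
      rw [e2, hq, hl']
      linear_combination (w * r ^ 3 * c ^ 3) * hw2
    have hl'0 : 0 < l' := by positivity
    -- This inequality, from `cos ≥ 1/2` on `[0, π/3]`, singles out the largest root: a root above a
    -- positive root `a` would force `r² > 6a²`.
    have hl'6 : r ^ 2 ≤ 6 * l' ^ 2 := by
      have : 1 / 4 ≤ c ^ 2 := by nlinarith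
      rw [hl', mul_pow, mul_pow, hw2]
      nlinarith [sq_nonneg r]
    have key : ∀ a b d : ℝ, a + b + d = 0 → a ^ 2 + b ^ 2 + d ^ 2 = r ^ 2 → l' = a → b ≤ l' := by
      intro a b d hs hss ha
      by_contra! hb
      have hd : d = -(a + b) := by linarith
      subst ha
      rw [hd] at hss
      nlinarith [mul_pos hl'0 (sub_pos.2 hb)]
    have hall : ∃ i, l' = μ i ∧ ∀ j, μ j ≤ l' := by
      rcases mul_eq_zero.1 hroot with h | h
      · rcases mul_eq_zero.1 h with h | h
        · refine ⟨0, by linarith, fun j => ?_⟩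
          fin_cases j
          · simp only [Fin.zero_eta]; linarith
          · exact key (μ 0) (μ 1) (μ 2) (by linarith) (by linarith) (by linarith)
          · exact key (μ 0) (μ 2) (μ 1) (by linarith) (by linarith) (by linarith)
        · refine ⟨1, by linarith, fun j => ?_⟩
          fin_cases j
          · exact key (μ 1) (μ 0) (μ 2) (by linarith) (by linarith) (by linarith)
          · simp only [Fin.mk_one]; linarith
          · exact key (μ 1) (μ 2) (μ 0) (by linarith) (by linarith) (by linarith)
      · refine ⟨2, by linarith, fun j => ?_⟩
        fin_cases j
        · exact key (μ 2) (μ 0) (μ 1) (by linarith) (by linarith) (by linarith)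
        · exact key (μ 2) (μ 1) (μ 0) (by linarith) (by linarith) (by linarith)
        · simp only [Fin.reduceFinMk]; linarith
    obtain ⟨i, hi, hj⟩ := hall
    obtain ⟨k, rfl⟩ := hex
    exact le_antisymm (hj k) (hi ▸ hle i)

theorem eigenvalues_symPart_le (N : Matrix (Fin 3) (Fin 3) ℝ) (i : Fin 3) :
    (symPart_isHermitian N).eigenvalues i ≤ largestEigSymPart N :=
  (symPart_isHermitian N).eigenvalues₀_antitone (Fin.zero_le _)

theorem exists_eigenvalues_symPart_eq (N : Matrix (Fin 3) (Fin 3) ℝ) :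
    ∃ i, (symPart_isHermitian N).eigenvalues i = largestEigSymPart N := by
  refine ⟨Fintype.equivOfCardEq (Fintype.card_fin _) ⟨0, by simp⟩, ?_⟩
  rw [Matrix.IsHermitian.eigenvalues, Equiv.symm_apply_apply]
  rfl

theorem det_smul_one_sub_eq_prod_eigenvalues {A : Matrix (Fin 3) (Fin 3) ℝ} (hA : A.IsHermitian)
    (t : ℝ) : (t • (1 : Matrix (Fin 3) (Fin 3) ℝ) - A).det = ∏ i, (t - hA.eigenvalues i) := by
  have h := congrArg (Polynomial.eval t) hA.charpoly_eq
  rw [Matrix.eval_charpoly, Polynomial.eval_prod] at h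
  simpa [Matrix.smul_one_eq_diagonal, Matrix.scalar_apply] using h

/-- Orthonormal coordinates of the traceless symmetric part of a `3 × 3` matrix. -/
noncomputable def tracelessCoord (N : Matrix (Fin 3) (Fin 3) ℝ) : EuclideanSpace ℝ (Fin 5) :=
  !₂[(N 0 0 - N 1 1) * √2 / 2, (N 0 0 + N 1 1 - 2 * N 2 2) * (√2 * √3) / 6,
    (N 0 1 + N 1 0) * √2 / 2, (N 0 2 + N 2 0) * √2 / 2, (N 1 2 + N 2 1) * √2 / 2]

/-- The `μᵢ` are the eigenvalues of the traceless symmetric part. Norm and Cartan cubic are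
invariants of that part, read off from its characteristic polynomial. -/
theorem exists_tracelessCoord_eigenvalues (N : Matrix (Fin 3) (Fin 3) ℝ) : ∃ μ : Fin 3 → ℝ,
    (∀ i, (symPart_isHermitian N).eigenvalues i = N.trace / 3 + μ i) ∧ ∑ i, μ i = 0 ∧
      ∑ i, μ i ^ 2 = ‖tracelessCoord N‖ ^ 2 ∧
      3 * √6 * ∏ i, μ i = cartanFun (tracelessCoord N) := by
  obtain ⟨e, he⟩ : ∃ e, (symPart_isHermitian N).eigenvalues = e := ⟨_, rfl⟩
  have hdet := det_smul_one_sub_eq_prod_eigenvalues (symPart_isHermitian N)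
  rw [he] at hdet ⊢
  have h2 : √2 ^ 2 = 2 := Real.sq_sqrt (by norm_num)
  have h3 : √3 ^ 2 = 3 := Real.sq_sqrt (by norm_num)
  have h6 : √6 = √2 * √3 := by rw [← Real.sqrt_mul (by norm_num)]; norm_num
  have htr : e 0 + e 1 + e 2 = N 0 0 + N 1 1 + N 2 2 := by
    have := (symPart_isHermitian N).trace_eq_sum_eigenvalues
    rw [he] at this
    simp [Matrix.trace, Fin.sum_univ_three, symPart] at this
    linarith
  have hd : ∀ t, (t - e 0) * (t - e 1) * (t - e 2) =
      (t • (1 : Matrix (Fin 3) (Fin 3) ℝ) - symPart N).det := by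
    intro t
    rw [hdet, Fin.prod_univ_three]
  simp only [Matrix.det_fin_three, symPart, Matrix.sub_apply, Matrix.smul_apply, Matrix.add_apply,
    Matrix.transpose_apply, Matrix.one_apply, smul_eq_mul, Fin.reduceEq, if_true, if_false,
    mul_one, mul_zero] at hd
  refine ⟨fun i => e i - N.trace / 3, fun i => by ring, ?_, ?_, ?_⟩
  · simp only [Matrix.trace, Matrix.diag_apply, Fin.sum_univ_three]
    linarith
  · simp only [Matrix.trace, Matrix.diag_apply, Fin.sum_univ_three, EuclideanSpace.norm_sq_eq,
      tracelessCoord, Fin.sum_univ_five, Real.norm_eq_abs, sq_abs]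
    -- Subtracting the values of the characteristic polynomial at `0` and `1` removes the
    -- determinant and isolates the second elementary symmetric function.
    have h0 := hd 0
    have h1 := hd 1
    simp
    linear_combination (e 0 + e 1 + e 2 + (N 0 0 + N 1 1 + N 2 2) / 3 - 2) * htr -
      2 * h1 + 2 * h0 - ((N 0 0 - N 1 1) ^ 2 / 4 + (N 0 1 + N 1 0) ^ 2 / 4 +
        (N 0 2 + N 2 0) ^ 2 / 4 + (N 1 2 + N 2 1) ^ 2 / 4 +
        (N 0 0 + N 1 1 - 2 * N 2 2) ^ 2 / 36 * √3 ^ 2) * h2 -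
      (N 0 0 + N 1 1 - 2 * N 2 2) ^ 2 / 18 * h3
  · simp only [Matrix.trace, Matrix.diag_apply, Fin.sum_univ_three, Fin.prod_univ_three,
      cartanFun_eq, tracelessCoord]
    -- At `tr/3` the characteristic polynomial equals minus the product of the `μᵢ`.
    have h := hd ((N 0 0 + N 1 1 + N 2 2) / 3)
    simp
    rw [h6]
    generalize √2 = a at h2 ⊢
    generalize √3 = b at h3 ⊢
    linear_combination (-3 * a * b) * h - a * (b * (3 * ((N 0 0 - N 1 1) / 2) ^ 2 *
        ((N 0 0 + N 1 1 - 2 * N 2 2) / 6) + 3 * ((N 0 0 + N 1 1 - 2 * N 2 2) / 6) *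
        ((N 0 1 + N 1 0) / 2) ^ 2 - 3 / 2 * ((N 0 0 + N 1 1 - 2 * N 2 2) / 6) *
        (((N 0 2 + N 2 0) / 2) ^ 2 + ((N 1 2 + N 2 1) / 2) ^ 2) + 3 / 2 * ((N 0 0 - N 1 1) / 2) *
        (((N 0 2 + N 2 0) / 2) ^ 2 - ((N 1 2 + N 2 1) / 2) ^ 2) + 3 * ((N 0 1 + N 1 0) / 2) *
        ((N 0 2 + N 2 0) / 2) * ((N 1 2 + N 2 1) / 2)) -
        b ^ 3 * ((N 0 0 + N 1 1 - 2 * N 2 2) / 6) ^ 3) * h2 +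
      2 * a * b * ((N 0 0 + N 1 1 - 2 * N 2 2) / 6) ^ 3 * h3

theorem largestEigSymPart_eq (N : Matrix (Fin 3) (Fin 3) ℝ) :
    largestEigSymPart N = N.trace / 3 + √(2 / 3) * ‖tracelessCoord N‖ *
      trisectCos (cartanFun (tracelessCoord N) / ‖tracelessCoord N‖ ^ 3) := by
  obtain ⟨μ, he, h0, h2, h3⟩ := exists_tracelessCoord_eigenvalues N
  rw [← max_root_eq_trisectCos (norm_nonneg _) h0 h2 h3 (l := largestEigSymPart N - N.trace / 3)]
  · ring
  · intro i
    have := eigenvalues_symPart_le N i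
    rw [he] at this
    linarith
  · obtain ⟨i, hi⟩ := exists_eigenvalues_symPart_eq N
    rw [he] at hi
    exact ⟨i, by linarith⟩

theorem exists_tracelessCoord_eq (x : EuclideanSpace ℝ (Fin 5)) :
    ∃ N : Matrix (Fin 3) (Fin 3) ℝ, tracelessCoord N = x := by
  have h2 : √2 ^ 2 = 2 := Real.sq_sqrt (by norm_num)
  have h3 : √3 ^ 2 = 3 := Real.sq_sqrt (by norm_num)
  refine ⟨!![x 0 * √2 / 2 + x 1 * (√2 * √3) / 6, x 2 * √2, x 3 * √2;
    0, -(x 0 * √2 / 2) + x 1 * (√2 * √3) / 6, x 4 * √2; 0, 0, -(x 1 * (√2 * √3) / 3)], ?_⟩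
  ext i
  fin_cases i
  · simp [tracelessCoord]
    linear_combination x 0 / 2 * h2
  · simp [tracelessCoord]
    linear_combination x 1 / 6 * √3 ^ 2 * h2 + x 1 / 3 * h3
  · simp [tracelessCoord]
    linear_combination x 2 / 2 * h2
  · simp [tracelessCoord]
    linear_combination x 3 / 2 * h2
  · simp [tracelessCoord]
    linear_combination x 4 / 2 * h2

theorem cartanFun_mem_Icc (x : Metric.sphere (0 : EuclideanSpace ℝ (Fin 5)) 1) :
    cartanFun x ∈ Set.Icc (-1 : ℝ) 1 := by
  obtain ⟨N, hN⟩ := exists_tracelessCoord_eq x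
  obtain ⟨μ, -, h0, h2, h3⟩ := exists_tracelessCoord_eigenvalues N
  have hx : ‖(x : EuclideanSpace ℝ (Fin 5))‖ = 1 := by simp
  rw [hN] at h2 h3
  rw [hx, Fin.sum_univ_three] at h2
  rw [Fin.sum_univ_three] at h0
  rw [Fin.prod_univ_three] at h3
  have h6 : √6 ^ 2 = 6 := Real.sq_sqrt (by norm_num)
  rw [Set.mem_Icc, ← abs_le, ← sq_le_one_iff_abs_le_one, ← h3]
  have := abs_prod_le_of_sum_eq_zero h0 h2
  nlinarith

theorem integral_largestEig_stdGaussian :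
    ∫ x : EuclideanSpace ℝ (Fin 5), √(2 / 3) * ‖x‖ * trisectCos (cartanFun x / ‖x‖ ^ 3)
      ∂(stdGaussian (EuclideanSpace ℝ (Fin 5))) = goeConst := by
  have h1 := integral_stdGaussian_of_homogeneous
    (f := fun x => √(2 / 3) * ‖x‖ * trisectCos (cartanFun x / ‖x‖ ^ 3)) (d := 1) (by
      intro r x hr
      rw [norm_smul, cartanFun_smul, Real.norm_of_nonneg hr.le, mul_pow,
        mul_div_mul_left _ _ (pow_ne_zero 3 hr.ne')]
      ring)
  -- The total mass one of the Gaussian determines the product of its normalizing constant and the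
  -- area of the sphere, so neither has to be computed.
  have h2 := integral_stdGaussian_of_homogeneous (f := fun _ => (1 : ℝ)) (d := 0) (by simp)
  have h3 : ∫ x : Metric.sphere (0 : EuclideanSpace ℝ (Fin 5)) 1, √(2 / 3) *
      ‖(x : EuclideanSpace ℝ (Fin 5))‖ * trisectCos (cartanFun x /
        ‖(x : EuclideanSpace ℝ (Fin 5))‖ ^ 3) ∂sphereMeasure =
      √(2 / 3) * (sphereMeasure.real Set.univ / 2 * (27 / 16)) := by
    rw [← integral_trisectCos, ← integral_sphere_comp_cartanFun cartanFun_mem_Icc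
      continuous_trisectCos, ← integral_const_mul]
    refine integral_congr_ae (Eventually.of_forall fun x => ?_)
    simp
  have j4 : radialMoment 4 = 3 * √(Real.pi / 2) := by
    rw [radialMoment_add_two 2, radialMoment_add_two 0, radialMoment_zero]
    norm_num
  have j5 : radialMoment 5 = 8 := by
    rw [radialMoment_add_two 3, radialMoment_add_two 1, radialMoment_one]
    norm_num
  rw [h1, h3]
  simp only [add_zero, integral_const, smul_eq_mul, mul_one, probReal_univ] at h2
  rw [show 4 + 1 = 5 from rfl, j5]
  rw [j4] at h2
  set c := (√(2 * Real.pi))⁻¹ ^ 5 * sphereMeasure.real Set.univ with hc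
  have h4 : c * (3 * √(Real.pi / 2)) = 1 := by rw [hc]; linarith
  have h5 : c * (27 / 4) * √(2 / 3) = goeConst := by
    have hpi := Real.pi_pos
    have e1 : √(Real.pi / 2) ≠ 0 := (Real.sqrt_pos.2 (by positivity)).ne'
    have e2 : √(2 / 3) = √(3 / Real.pi) * √(Real.pi / 2) * (2 / 3) := by
      rw [← Real.sqrt_mul (by positivity), ← Real.sqrt_sq (by norm_num : (0 : ℝ) ≤ 2 / 3),
        ← Real.sqrt_mul (by positivity)]
      congr 1
      field_simp
      norm_num
    rw [e2, goeConst]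
    linear_combination (3 / 2) * √(3 / Real.pi) * h4
  rw [← h5, hc]
  ring

end

/-! ### Transfer to Gaussian matrices -/

section

open scoped Matrix

/-- The standard Gaussian measure on vectorized `3 × 3` matrices. -/
noncomputable abbrev matGaussian : Measure (EuclideanSpace ℝ (Fin 3 × Fin 3)) :=
  stdGaussian (EuclideanSpace ℝ (Fin 3 × Fin 3))

/-- The adjoint of `tracelessCoord`. -/
noncomputable def tracelessEmbed (t : EuclideanSpace ℝ (Fin 5)) : Matrix (Fin 3) (Fin 3) ℝ :=
  !![t 0 * √2 / 2 + t 1 * (√2 * √3) / 6, t 2 * √2 / 2, t 3 * √2 / 2;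
    t 2 * √2 / 2, -(t 0 * √2 / 2) + t 1 * (√2 * √3) / 6, t 4 * √2 / 2;
    t 3 * √2 / 2, t 4 * √2 / 2, -(t 1 * (√2 * √3) / 3)]

theorem inner_tracelessCoord (N : Matrix (Fin 3) (Fin 3) ℝ) (t : EuclideanSpace ℝ (Fin 5)) :
    inner ℝ (tracelessCoord N) t = inner ℝ (matVec N) (matVec (tracelessEmbed t)) := by
  simp only [PiLp.inner_apply, Fintype.sum_prod_type, Fin.sum_univ_three, Fin.sum_univ_five,
    RCLike.inner_apply, conj_trivial]
  simp [tracelessCoord, tracelessEmbed, matVec]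
  ring

theorem norm_tracelessEmbed (t : EuclideanSpace ℝ (Fin 5)) : ‖matVec (tracelessEmbed t)‖ = ‖t‖ := by
  have h2 : √2 ^ 2 = 2 := Real.sq_sqrt (by norm_num)
  have h3 : √3 ^ 2 = 3 := Real.sq_sqrt (by norm_num)
  rw [← sq_eq_sq₀ (norm_nonneg _) (norm_nonneg _), EuclideanSpace.norm_sq_eq,
    EuclideanSpace.norm_sq_eq, Fintype.sum_prod_type]
  simp only [Fin.sum_univ_three, Fin.sum_univ_five, Real.norm_eq_abs, sq_abs]
  simp [tracelessEmbed, matVec]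
  linear_combination (t 0 ^ 2 / 2 + t 2 ^ 2 / 2 + t 3 ^ 2 / 2 + t 4 ^ 2 / 2 +
    t 1 ^ 2 / 6 * √3 ^ 2) * h2 + t 1 ^ 2 / 3 * h3

theorem continuous_tracelessCoord_matUnvec :
    Continuous fun x : EuclideanSpace ℝ (Fin 3 × Fin 3) => tracelessCoord (matUnvec x) := by
  refine (PiLp.continuous_toLp 2 _).comp (continuous_pi fun i => ?_)
  fin_cases i <;> simp [matUnvec] <;> fun_prop

/-- Characteristic functions agree because the adjoint of the coordinate map is an isometric
embedding. -/
theorem map_tracelessCoord_matGaussian :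
    matGaussian.map (fun x => tracelessCoord (matUnvec x)) =
      stdGaussian (EuclideanSpace ℝ (Fin 5)) := by
  have hm := continuous_tracelessCoord_matUnvec.measurable
  have := Measure.isProbabilityMeasure_map (μ := matGaussian) hm.aemeasurable
  refine Measure.ext_of_charFun (funext fun t => ?_)
  rw [charFun_stdGaussian, charFun_apply, integral_map hm.aemeasurable (by fun_prop)]
  simp only [inner_tracelessCoord, matVec_matUnvec]
  rw [← charFun_apply, charFun_stdGaussian, norm_tracelessEmbed]

theorem integrable_norm_pow_matGaussian (k : ℕ) :
    Integrable (fun x => ‖x‖ ^ k) matGaussian :=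
  (IsGaussian.memLp_id matGaussian k (by simp)).integrable_norm_pow'

theorem measurable_cartanFun : Measurable cartanFun := continuous_cartanFun.measurable

theorem measurable_largestEigSymPart :
    Measurable fun x : EuclideanSpace ℝ (Fin 3 × Fin 3) => largestEigSymPart (matUnvec x) := by
  have h1 := continuous_tracelessCoord_matUnvec.measurable
  have h2 : Measurable fun x : EuclideanSpace ℝ (Fin 3 × Fin 3) => (matUnvec x).trace :=
    (continuous_matUnvec.matrix_trace).measurable
  simp only [largestEigSymPart_eq]
  exact (h2.div_const 3).add ((h1.norm.const_mul _).mul (continuous_trisectCos.measurable.comp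
    ((measurable_cartanFun.comp h1).div (h1.norm.pow_const 3))))

theorem integral_apply_matGaussian (p : Fin 3 × Fin 3) : ∫ x, x p ∂matGaussian = 0 :=
  integral_strongDual_stdGaussian (EuclideanSpace.proj (𝕜 := ℝ) p)

theorem integrable_apply_matGaussian (p : Fin 3 × Fin 3) :
    Integrable (fun x : EuclideanSpace ℝ (Fin 3 × Fin 3) => x p) matGaussian :=
  (EuclideanSpace.proj (𝕜 := ℝ) p).integrable_comp IsGaussian.integrable_id

theorem integrable_and_integral_largestEigSymPart :
    Integrable (fun x => largestEigSymPart (matUnvec x)) matGaussian ∧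
      ∫ x, largestEigSymPart (matUnvec x) ∂matGaussian = goeConst := by
  set f : EuclideanSpace ℝ (Fin 5) → ℝ :=
    fun x => √(2 / 3) * ‖x‖ * trisectCos (cartanFun x / ‖x‖ ^ 3) with hf
  have hfm : Measurable f := (measurable_norm.const_mul _).mul (continuous_trisectCos.measurable.comp
    (measurable_cartanFun.div (measurable_norm.pow_const 3)))
  have hm := continuous_tracelessCoord_matUnvec.measurable
  have hfi : Integrable f (stdGaussian (EuclideanSpace ℝ (Fin 5))) := by
    refine ((IsGaussian.integrable_id (μ := stdGaussian (EuclideanSpace ℝ (Fin 5)))).norm.const_mul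
      √(2 / 3)).mono' hfm.aestronglyMeasurable (Eventually.of_forall fun x => ?_)
    rw [Real.norm_eq_abs, hf, abs_mul, abs_mul, abs_norm, abs_of_nonneg (Real.sqrt_nonneg _)]
    exact mul_le_of_le_one_right (by positivity) (Real.abs_cos_le_one _)
  have hT : ∀ x : EuclideanSpace ℝ (Fin 3 × Fin 3), (matUnvec x).trace / 3 =
      (x (0, 0) + x (1, 1) + x (2, 2)) / 3 := by
    intro x
    simp [Matrix.trace, Fin.sum_univ_three, matUnvec]
  have hi := fun p => integrable_apply_matGaussian p
  have hTi : Integrable (fun x : EuclideanSpace ℝ (Fin 3 × Fin 3) => (matUnvec x).trace / 3)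
      matGaussian := by
    simp only [hT]
    exact (((hi _).add (hi _)).add (hi _)).div_const 3
  have hT0 : ∫ x, (matUnvec x).trace / 3 ∂matGaussian = 0 := by
    simp only [hT]
    rw [integral_div, integral_add (f := fun x : EuclideanSpace ℝ (Fin 3 × Fin 3) => x (0, 0) + x (1, 1))
      ((hi _).add (hi _)) (hi _), integral_add (hi _) (hi _)]
    simp [integral_apply_matGaussian]
  have hfi' : Integrable (fun x => f (tracelessCoord (matUnvec x))) matGaussian := by
    rw [← map_tracelessCoord_matGaussian] at hfi
    exact hfi.comp_measurable hm
  simp only [largestEigSymPart_eq]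
  refine ⟨hTi.add hfi', ?_⟩
  rw [integral_add hTi hfi', hT0, zero_add, ← integral_map (f := f) hm.aemeasurable
    hfm.aestronglyMeasurable, map_tracelessCoord_matGaussian, integral_largestEig_stdGaussian]

end

/-! ### Perturbation of the extreme singular values and of the condition number -/

section

open scoped Matrix

theorem finrank_euclideanSpace_three : Module.finrank ℝ (EuclideanSpace ℝ (Fin 3)) = 3 := by simp

theorem norm_toEuclideanLin_le (M : Matrix (Fin 3) (Fin 3) ℝ) (v : EuclideanSpace ℝ (Fin 3)) :
    ‖Matrix.toEuclideanLin M v‖ ≤ ‖matVec M‖ * ‖v‖ := by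
  refine le_of_sq_le_sq ?_ (by positivity)
  rw [mul_pow, EuclideanSpace.norm_sq_eq, EuclideanSpace.norm_sq_eq, EuclideanSpace.norm_sq_eq,
    Fintype.sum_prod_type, Finset.sum_mul]
  refine Finset.sum_le_sum fun i _ => ?_
  simp only [Real.norm_eq_abs, sq_abs]
  have h : Matrix.toEuclideanLin M v i = ∑ j, M i j * v j := rfl
  rw [h]
  exact Finset.sum_mul_sq_le_sq_mul_sq Finset.univ (fun j => M i j) fun j => v j

theorem inner_toEuclideanLin_symPart (N : Matrix (Fin 3) (Fin 3) ℝ)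
    (v : EuclideanSpace ℝ (Fin 3)) :
    inner ℝ v (Matrix.toEuclideanLin (symPart N) v) = inner ℝ v (Matrix.toEuclideanLin N v) := by
  simp only [PiLp.inner_apply, RCLike.inner_apply, conj_trivial, Fin.sum_univ_three,
    Matrix.toLpLin_apply, Matrix.mulVec, dotProduct]
  simp [symPart]
  ring

theorem toEuclideanLin_eigenvectorBasis {A : Matrix (Fin 3) (Fin 3) ℝ} (hA : A.IsHermitian)
    (i : Fin 3) : Matrix.toEuclideanLin A (hA.eigenvectorBasis i) =
      hA.eigenvalues i • hA.eigenvectorBasis i := by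
  have h := hA.mulVec_eigenvectorBasis i
  rw [Matrix.toLpLin_apply, h]
  rfl

theorem exists_inner_eq_largestEigSymPart (N : Matrix (Fin 3) (Fin 3) ℝ) :
    ∃ v : EuclideanSpace ℝ (Fin 3), ‖v‖ = 1 ∧
      inner ℝ v (Matrix.toEuclideanLin N v) = largestEigSymPart N := by
  obtain ⟨i, hi⟩ := exists_eigenvalues_symPart_eq N
  set b := (symPart_isHermitian N).eigenvectorBasis
  refine ⟨b i, b.norm_eq_one i, ?_⟩
  rw [← inner_toEuclideanLin_symPart, toEuclideanLin_eigenvectorBasis, real_inner_smul_right, hi,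
    real_inner_self_eq_norm_sq]
  change _ * ‖b i‖ ^ 2 = _
  rw [b.norm_eq_one]
  ring

theorem inner_le_largestEigSymPart (N : Matrix (Fin 3) (Fin 3) ℝ)
    (v : EuclideanSpace ℝ (Fin 3)) :
    inner ℝ v (Matrix.toEuclideanLin N v) ≤ largestEigSymPart N * ‖v‖ ^ 2 := by
  set b := (symPart_isHermitian N).eigenvectorBasis
  have hsym : (Matrix.toEuclideanLin (symPart N)).IsSymmetric :=
    Matrix.isSymmetric_toEuclideanLin_iff.2 (symPart_isHermitian N)
  rw [← inner_toEuclideanLin_symPart, ← b.sum_inner_mul_inner, ← b.sum_sq_inner_right v,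
    Finset.mul_sum]
  refine Finset.sum_le_sum fun i _ => ?_
  rw [← hsym, toEuclideanLin_eigenvectorBasis, real_inner_smul_left, real_inner_comm]
  change inner ℝ (b i) v * (_ * inner ℝ (b i) v) ≤ _
  nlinarith [mul_le_mul_of_nonneg_right (eigenvalues_symPart_le N i) (sq_nonneg (inner ℝ (b i) v))]

theorem abs_largestEigSymPart_le (N : Matrix (Fin 3) (Fin 3) ℝ) :
    |largestEigSymPart N| ≤ ‖matVec N‖ := by
  obtain ⟨v, hv, h⟩ := exists_inner_eq_largestEigSymPart N
  rw [← h]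
  refine (abs_real_inner_le_norm _ _).trans ?_
  have := norm_toEuclideanLin_le N v
  rw [hv] at this ⊢
  linarith

theorem exists_norm_eq_singVal (M : Matrix (Fin 3) (Fin 3) ℝ) (k : Fin 3) :
    ∃ v : EuclideanSpace ℝ (Fin 3), ‖v‖ = 1 ∧ ‖Matrix.toEuclideanLin M v‖ = singVal M k := by
  set T := Matrix.toEuclideanLin M
  set b := T.isSymmetric_adjoint_comp_self.eigenvectorBasis finrank_euclideanSpace_three
  refine ⟨b k, b.norm_eq_one k, ?_⟩
  change _ = T.singularValues k
  rw [← sq_eq_sq₀ (norm_nonneg _) (T.singularValues_nonneg k),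
    T.norm_map_sq_eq_sum_singularValues finrank_euclideanSpace_three, Finset.sum_eq_single k]
  · simp [b]
  · intro j _ hj
    rw [b.orthonormal.2 hj]; ring
  · simp

theorem singVal_nonneg (M : Matrix (Fin 3) (Fin 3) ℝ) (k : ℕ) : 0 ≤ singVal M k :=
  LinearMap.singularValues_nonneg _ k

theorem singVal_antitone (M : Matrix (Fin 3) (Fin 3) ℝ) : Antitone (singVal M) :=
  LinearMap.singularValues_antitone _

theorem norm_toEuclideanLin_le_singVal (M : Matrix (Fin 3) (Fin 3) ℝ)
    (v : EuclideanSpace ℝ (Fin 3)) : ‖Matrix.toEuclideanLin M v‖ ≤ singVal M 0 * ‖v‖ := by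
  set T := Matrix.toEuclideanLin M
  set b := T.isSymmetric_adjoint_comp_self.eigenvectorBasis finrank_euclideanSpace_three
  refine le_of_sq_le_sq ?_ (mul_nonneg (singVal_nonneg M 0) (norm_nonneg v))
  rw [T.norm_map_sq_eq_sum_singularValues finrank_euclideanSpace_three, mul_pow,
    ← b.sum_sq_inner_right v, Finset.mul_sum]
  refine Finset.sum_le_sum fun i _ => mul_le_mul_of_nonneg_right ?_ (sq_nonneg _)
  exact pow_le_pow_left₀ (singVal_nonneg M i) (singVal_antitone M (Nat.zero_le _)) 2

theorem singVal_mul_norm_le (M : Matrix (Fin 3) (Fin 3) ℝ)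
    (v : EuclideanSpace ℝ (Fin 3)) : singVal M 2 * ‖v‖ ≤ ‖Matrix.toEuclideanLin M v‖ := by
  set T := Matrix.toEuclideanLin M
  set b := T.isSymmetric_adjoint_comp_self.eigenvectorBasis finrank_euclideanSpace_three
  refine le_of_sq_le_sq ?_ (norm_nonneg _)
  rw [T.norm_map_sq_eq_sum_singularValues finrank_euclideanSpace_three, mul_pow,
    ← b.sum_sq_inner_right v, Finset.mul_sum]
  refine Finset.sum_le_sum fun i _ => mul_le_mul_of_nonneg_right ?_ (sq_nonneg _)
  exact pow_le_pow_left₀ (singVal_nonneg M 2) (singVal_antitone M (by omega)) 2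

section Perturbation

variable (N : Matrix (Fin 3) (Fin 3) ℝ) {σ : ℝ}

theorem toEuclideanLin_one_add_smul (σ : ℝ) (v : EuclideanSpace ℝ (Fin 3)) :
    Matrix.toEuclideanLin (1 + σ • N) v = v + σ • Matrix.toEuclideanLin N v := by
  simp

theorem norm_sq_one_add_smul_le (σ : ℝ) {v : EuclideanSpace ℝ (Fin 3)} (hv : ‖v‖ = 1) :
    ‖Matrix.toEuclideanLin (1 + σ • N) v‖ ^ 2 ≤
      1 + 2 * (σ * inner ℝ v (Matrix.toEuclideanLin N v)) + (σ * ‖matVec N‖) ^ 2 := by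
  rw [toEuclideanLin_one_add_smul, norm_add_sq_real, real_inner_smul_right, norm_smul, hv, mul_pow,
    mul_pow, Real.norm_eq_abs, sq_abs]
  have := norm_toEuclideanLin_le N v
  rw [hv, mul_one] at this
  gcongr
  linarith

theorem le_norm_one_add_smul (σ : ℝ) {v : EuclideanSpace ℝ (Fin 3)} (hv : ‖v‖ = 1) :
    1 + σ * inner ℝ v (Matrix.toEuclideanLin N v) ≤ ‖Matrix.toEuclideanLin (1 + σ • N) v‖ := by
  have h := real_inner_le_norm v (Matrix.toEuclideanLin (1 + σ • N) v)
  rw [hv, one_mul, toEuclideanLin_one_add_smul, inner_add_right, real_inner_smul_right,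
    real_inner_self_eq_norm_sq, hv] at h
  rw [toEuclideanLin_one_add_smul]
  linarith

theorem singVal_zero_one_add_smul_le_one_add (hσ : 0 ≤ σ) :
    singVal (1 + σ • N) 0 ≤ 1 + σ * ‖matVec N‖ := by
  obtain ⟨v, hv, h⟩ := exists_norm_eq_singVal (1 + σ • N) 0
  simp only [Fin.val_zero] at h
  rw [← h, toEuclideanLin_one_add_smul]
  refine (norm_add_le _ _).trans ?_
  rw [norm_smul, hv, Real.norm_of_nonneg hσ]
  have := norm_toEuclideanLin_le N v
  rw [hv, mul_one] at this
  gcongr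

/-- The lower bound tests a top eigenvector of the symmetric part. The upper bound takes a top
singular vector and uses `√(1+2p+t²) ≤ 1+p+t²/2`. -/
theorem singVal_zero_one_add_smul_bounds (hσ : 0 ≤ σ) :
    1 + σ * largestEigSymPart N ≤ singVal (1 + σ • N) 0 ∧
      singVal (1 + σ • N) 0 ≤ 1 + σ * largestEigSymPart N + (σ * ‖matVec N‖) ^ 2 / 2 := by
  constructor
  · obtain ⟨v, hv, h⟩ := exists_inner_eq_largestEigSymPart N
    have h1 := le_norm_one_add_smul N σ hv
    have h2 := norm_toEuclideanLin_le_singVal (1 + σ • N) v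
    rw [hv, mul_one] at h2
    rw [h] at h1
    linarith
  · obtain ⟨v, hv, h⟩ := exists_norm_eq_singVal (1 + σ • N) 0
    simp only [Fin.val_zero] at h
    have h1 := norm_sq_one_add_smul_le N σ hv
    have h2 := inner_le_largestEigSymPart N v
    rw [hv, one_pow, mul_one] at h2
    have h3 := mul_le_mul_of_nonneg_left h2 hσ
    rw [← h]
    -- With `p ≥ -t` the right side `1 + p + t²/2` is nonnegative for every `t`, so squares can be
    -- compared without assuming that the noise is small.
    have h4 : -(σ * ‖matVec N‖) ≤ σ * largestEigSymPart N := by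
      have := mul_le_mul_of_nonneg_left (neg_le_of_abs_le (abs_largestEigSymPart_le N)) hσ
      linarith
    refine le_of_sq_le_sq ?_ (by nlinarith [sq_nonneg (σ * ‖matVec N‖)])
    nlinarith [sq_nonneg (σ * largestEigSymPart N + (σ * ‖matVec N‖) ^ 2 / 2)]

theorem singVal_two_one_add_smul_bounds (hσ : 0 ≤ σ) :
    1 - σ * largestEigSymPart (-N) ≤ singVal (1 + σ • N) 2 ∧
      singVal (1 + σ • N) 2 ≤ 1 - σ * largestEigSymPart (-N) + (σ * ‖matVec N‖) ^ 2 / 2 := by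
  have hneg : ∀ v, Matrix.toEuclideanLin (-N) v = -Matrix.toEuclideanLin N v := by simp
  have hnorm : ‖matVec (-N)‖ = ‖matVec N‖ := by
    have : matVec (-N) = -matVec N := rfl
    rw [this, norm_neg]
  constructor
  · obtain ⟨v, hv, h⟩ := exists_norm_eq_singVal (1 + σ • N) 2
    have h1 := le_norm_one_add_smul N σ hv
    have h2 := inner_le_largestEigSymPart (-N) v
    rw [hneg, inner_neg_right, hv, one_pow, mul_one] at h2
    have h3 := mul_le_mul_of_nonneg_left h2 hσ
    change _ = singVal (1 + σ • N) 2 at h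
    linarith
  · obtain ⟨v, hv, h⟩ := exists_inner_eq_largestEigSymPart (-N)
    rw [hneg, inner_neg_right] at h
    have h1 := norm_sq_one_add_smul_le N σ hv
    have h2 := singVal_mul_norm_le (1 + σ • N) v
    rw [hv, mul_one] at h2
    have h4 : σ * largestEigSymPart (-N) ≤ σ * ‖matVec N‖ := by
      refine mul_le_mul_of_nonneg_left ?_ hσ
      rw [← hnorm]
      exact le_of_abs_le (abs_largestEigSymPart_le (-N))
    have h5 : inner ℝ v (Matrix.toEuclideanLin N v) = -largestEigSymPart (-N) := by linarith
    rw [h5] at h1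
    refine h2.trans (le_of_sq_le_sq ?_ (by nlinarith [sq_nonneg (σ * ‖matVec N‖)]))
    nlinarith [sq_nonneg (-(σ * largestEigSymPart (-N)) + (σ * ‖matVec N‖) ^ 2 / 2)]

/-- On the segment from `1` to `1 + σN` no matrix is singular, since a kernel vector would satisfy
`‖x‖ ≤ σ‖N‖‖x‖`; the determinant keeps its sign. -/
theorem det_one_add_smul_pos (hσ : 0 ≤ σ) (ht : σ * ‖matVec N‖ < 1) : 0 < (1 + σ • N).det := by
  by_contra! hneg
  have hcont : ContinuousOn (fun τ : ℝ => (1 + (τ * σ) • N).det) (Set.Icc 0 1) := by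
    refine Continuous.continuousOn ?_
    refine Continuous.matrix_det ?_
    fun_prop
  have h0 : (0 : ℝ) ∈ Set.Icc ((fun τ : ℝ => (1 + (τ * σ) • N).det) 1)
      ((fun τ : ℝ => (1 + (τ * σ) • N).det) 0) := by simpa using hneg
  obtain ⟨τ, hτ, hdet⟩ := intermediate_value_Icc' zero_le_one hcont h0
  obtain ⟨v, hv, hMv⟩ := Matrix.exists_mulVec_eq_zero_iff.2 hdet
  set x : EuclideanSpace ℝ (Fin 3) := WithLp.toLp 2 v with hx
  have hx0 : x ≠ 0 := fun h => hv (congrArg WithLp.ofLp h)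
  have h1 : x + (τ * σ) • Matrix.toEuclideanLin N x = 0 := by
    rw [← toEuclideanLin_one_add_smul, Matrix.toLpLin_apply, hMv]
    rfl
  have h2 : ‖x‖ ≤ σ * ‖matVec N‖ * ‖x‖ := by
    calc ‖x‖ = ‖(τ * σ) • Matrix.toEuclideanLin N x‖ := by
          rw [← norm_neg ((τ * σ) • _)]
          exact congrArg norm (eq_neg_of_add_eq_zero_left h1)
      _ = τ * σ * ‖Matrix.toEuclideanLin N x‖ := by
          rw [norm_smul, Real.norm_of_nonneg (mul_nonneg hτ.1 hσ)]
      _ ≤ 1 * σ * (‖matVec N‖ * ‖x‖) := by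
          gcongr
          · exact hτ.2
          · exact norm_toEuclideanLin_le N x
      _ = _ := by ring
  have h3 : 0 < ‖x‖ := norm_pos_iff.2 hx0
  nlinarith

theorem abs_jacobianCond_sub_le (hσ : 0 ≤ σ) (ht : σ * ‖matVec N‖ ≤ 1 / 4) :
    |jacobianCond (1 + σ • N) -
      (1 + σ * ((largestEigSymPart N + largestEigSymPart (-N)) / 2))| ≤
        2 * (σ * ‖matVec N‖) ^ 2 := by
  have hnorm : ‖matVec (-N)‖ = ‖matVec N‖ := by
    have : matVec (-N) = -matVec N := rfl
    rw [this, norm_neg]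
  have hb0 := singVal_zero_one_add_smul_bounds N hσ
  have hb2 := singVal_two_one_add_smul_bounds N hσ
  have hu := singVal_zero_one_add_smul_le_one_add N hσ
  rw [jacobianCond_eq _ (det_one_add_smul_pos N hσ (by linarith))]
  have h01 : singVal (1 + σ • N) 1 ≤ singVal (1 + σ • N) 0 := singVal_antitone _ (by norm_num)
  have h12 : singVal (1 + σ • N) 2 ≤ singVal (1 + σ • N) 1 := singVal_antitone _ (by norm_num)
  have hl := abs_le.1 (abs_largestEigSymPart_le N)
  have hl' := abs_le.1 (abs_largestEigSymPart_le (-N))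
  rw [hnorm] at hl'
  have e1 := mul_le_mul_of_nonneg_left hl.1 hσ
  have e2 := mul_le_mul_of_nonneg_left hl.2 hσ
  have e3 := mul_le_mul_of_nonneg_left hl'.1 hσ
  have e4 := mul_le_mul_of_nonneg_left hl'.2 hσ
  have ht0 : 0 ≤ σ * ‖matVec N‖ := by positivity
  rw [mul_neg] at e1 e3
  have ew : σ * ((largestEigSymPart N + largestEigSymPart (-N)) / 2) =
      (σ * largestEigSymPart N + σ * largestEigSymPart (-N)) / 2 := by ring
  rw [ew]
  generalize singVal (1 + σ • N) 0 = a at *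
  generalize singVal (1 + σ • N) 1 = b at *
  generalize singVal (1 + σ • N) 2 = c at *
  generalize σ * largestEigSymPart N = p at *
  generalize σ * largestEigSymPart (-N) = q at *
  generalize σ * ‖matVec N‖ = t at *
  have hD : 3 / 2 ≤ b + c := by linarith
  have hDpos : 0 < b + c := by linarith
  -- The middle value `b` cancels from the numerator except through `b + c`, so the crude bounds `c
  -- ≤ b ≤ a` are enough for it.
  have key : (a + b) / (b + c) - (1 + (p + q) / 2) = (a - c - (p + q) / 2 * (b + c)) / (b + c) := by
    field_simp
    ring
  rw [key, abs_div, abs_of_pos hDpos, div_le_iff₀ hDpos]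
  have h5 : |a - c - (p + q)| ≤ t ^ 2 / 2 := abs_le.2 ⟨by linarith, by linarith⟩
  have h6 : |(p + q) / 2 * (2 - (b + c))| ≤ t * (2 * t) := by
    rw [abs_mul]
    exact mul_le_mul (abs_le.2 ⟨by linarith, by linarith⟩) (abs_le.2 ⟨by linarith, by linarith⟩)
      (abs_nonneg _) ht0
  calc |a - c - (p + q) / 2 * (b + c)| = |(a - c - (p + q)) + (p + q) / 2 * (2 - (b + c))| := by
        ring_nf
    _ ≤ t ^ 2 / 2 + t * (2 * t) := (abs_add_le _ _).trans (add_le_add h5 h6)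
    _ ≤ 2 * t ^ 2 * (b + c) := by nlinarith [sq_nonneg t]

end Perturbation

end

/-! ### Minors, a global bound on the condition number, and measurability -/

section

open scoped Matrix

theorem Matrix.abs_apply_mul_diagonal_mul_transpose_le {U V : Matrix (Fin 3) (Fin 3) ℝ}
    (hU : U * Uᵀ = 1) (hV : V * Vᵀ = 1) {d : Fin 3 → ℝ} {c : ℝ} (hd0 : ∀ i, 0 ≤ d i)
    (hd : ∀ i, d i ≤ c) (i j : Fin 3) : |(V * Matrix.diagonal d * Uᵀ) i j| ≤ c := by
  have h1 := congrFun (congrFun hU j) j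
  have h2 := congrFun (congrFun hV i) i
  simp only [Matrix.mul_apply, Matrix.transpose_apply, Matrix.one_apply_eq] at h1 h2
  have hc : 0 ≤ c := (hd0 0).trans (hd 0)
  calc |(V * Matrix.diagonal d * Uᵀ) i j| = |∑ k, V i k * d k * U j k| := by
        simp only [Matrix.mul_apply (M := V * Matrix.diagonal d), Matrix.mul_diagonal,
          Matrix.transpose_apply]
    _ ≤ ∑ k, c * ((V i k * V i k + U j k * U j k) / 2) := by
        refine (Finset.abs_sum_le_sum_abs _ _).trans (Finset.sum_le_sum fun k _ => ?_)
        have h3 : |V i k * d k * U j k| = d k * |V i k * U j k| := by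
          rw [mul_right_comm, mul_comm, abs_mul, abs_of_nonneg (hd0 k)]
        rw [h3]
        refine mul_le_mul (hd k) (abs_le.2 ⟨?_, ?_⟩) (abs_nonneg _) hc
        · nlinarith [sq_nonneg (V i k + U j k)]
        · nlinarith [sq_nonneg (V i k - U j k)]
    _ = c := by
        rw [← Finset.mul_sum, ← Finset.sum_div, Finset.sum_add_distrib, h1, h2]
        ring

/-- For positive determinant the adjugate is `V diag(s₂s₃, s₁s₃, s₁s₂) Uᵀ`, and its entries are
bounded by the largest diagonal value. This bounds `1/(s₁s₂)` above by reciprocals of explicit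
minors. -/
theorem abs_adjugate_apply_le {M : Matrix (Fin 3) (Fin 3) ℝ} (hM : 0 < M.det) (i j : Fin 3) :
    |M.adjugate i j| ≤ singVal M 0 * singVal M 1 := by
  obtain ⟨U, V, h⟩ := exists_isSVD_singVal M hM.ne'
  have hU1 := Matrix.transpose_mul_self_of_mem_orthogonalGroup h.1
  have hU2 := Matrix.mul_transpose_self_of_mem_orthogonalGroup h.1
  have hV1 := Matrix.transpose_mul_self_of_mem_orthogonalGroup h.2.1
  have hV2 := Matrix.mul_transpose_self_of_mem_orthogonalGroup h.2.1
  have hdet : M.det = singVal M 0 * singVal M 1 * singVal M 2 := by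
    rw [h.det_eq, h.det_mul_transpose_eq_one hM, one_mul]
    rfl
  have h0 := singVal_nonneg M 0
  have h1 := singVal_nonneg M 1
  have h2 := singVal_nonneg M 2
  have h01 : singVal M 1 ≤ singVal M 0 := singVal_antitone _ (by norm_num)
  have h12 : singVal M 2 ≤ singVal M 1 := singVal_antitone _ (by norm_num)
  set d : Fin 3 → ℝ := ![singVal M 1 * singVal M 2, singVal M 0 * singVal M 2,
    singVal M 0 * singVal M 1] with hd
  have hadj : M.adjugate = V * Matrix.diagonal d * Uᵀ := by
    have h3 : M * (V * Matrix.diagonal d * Uᵀ) = M.det • (1 : Matrix (Fin 3) (Fin 3) ℝ) := by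
      conv_lhs => rw [h.2.2.2.2]
      calc U * Matrix.diagonal (fun i : Fin 3 => singVal M i) * Vᵀ * (V * Matrix.diagonal d * Uᵀ)
          = U * (Matrix.diagonal (fun i : Fin 3 => singVal M i) * (Vᵀ * V) * Matrix.diagonal d) *
              Uᵀ := by simp only [Matrix.mul_assoc]
        _ = U * (M.det • (1 : Matrix (Fin 3) (Fin 3) ℝ)) * Uᵀ := by
            rw [hV1, Matrix.mul_one, Matrix.diagonal_mul_diagonal, Matrix.smul_one_eq_diagonal]
            congr 3
            ext i
            fin_cases i
            · simp [hd, hdet]; ring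
            · simp [hd, hdet]; ring
            · simp [hd, hdet]; ring
        _ = _ := by rw [Matrix.mul_smul, Matrix.mul_one, Matrix.smul_mul, hU2]
    have h4 := congrArg (M.adjugate * ·) h3
    simp only [← Matrix.mul_assoc M.adjugate M, Matrix.adjugate_mul, Matrix.smul_mul,
      Matrix.one_mul, Matrix.mul_smul, Matrix.mul_one] at h4
    exact (smul_right_injective _ hM.ne' h4).symm
  rw [hadj]
  refine Matrix.abs_apply_mul_diagonal_mul_transpose_le hU2 hV2 ?_ ?_ i j
  · intro i
    fin_cases i <;> simp [hd] <;> positivity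
  · intro i
    fin_cases i
    · simp [hd]; nlinarith
    · simp [hd]; nlinarith
    · simp [hd]

theorem singVal_zero_mul_one_pos {M : Matrix (Fin 3) (Fin 3) ℝ} (hM : 0 < M.det) :
    0 < singVal M 0 * singVal M 1 := by
  obtain ⟨U, V, h⟩ := exists_isSVD_singVal M hM.ne'
  exact mul_pos (h.pos hM.ne' 0) (h.pos hM.ne' 1)

theorem jacobianCond_nonneg {M : Matrix (Fin 3) (Fin 3) ℝ} (hM : 0 < M.det) :
    0 ≤ jacobianCond M := by
  rw [jacobianCond_eq M hM]
  have h0 := singVal_nonneg M 0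
  have h1 := singVal_nonneg M 1
  have h2 := singVal_nonneg M 2
  positivity

theorem jacobianCond_le {M : Matrix (Fin 3) (Fin 3) ℝ} (hM : 0 < M.det) :
    jacobianCond M ≤ 2 * singVal M 0 ^ 2 / (singVal M 0 * singVal M 1) := by
  obtain ⟨U, V, h⟩ := exists_isSVD_singVal M hM.ne'
  have h0 : 0 < singVal M 0 := h.pos hM.ne' 0
  have h1 : 0 < singVal M 1 := h.pos hM.ne' 1
  have h2 : 0 < singVal M 2 := h.pos hM.ne' 2
  have h01 : singVal M 1 ≤ singVal M 0 := singVal_antitone _ (by norm_num)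
  rw [jacobianCond_eq M hM]
  calc _ ≤ (2 * singVal M 0) / singVal M 1 := by
        gcongr <;> linarith
    _ = _ := by field_simp

theorem continuous_singVal_zero : Continuous fun x => singVal (matUnvec x) 0 := by
  refine (LipschitzWith.of_le_add fun x y => ?_).continuous
  obtain ⟨v, hv, h⟩ := exists_norm_eq_singVal (matUnvec x) 0
  have h1 := norm_toEuclideanLin_le_singVal (matUnvec y) v
  have h2 := norm_toEuclideanLin_le (matUnvec (x - y)) v
  have h3 : Matrix.toEuclideanLin (matUnvec x) v =
      Matrix.toEuclideanLin (matUnvec y) v + Matrix.toEuclideanLin (matUnvec (x - y)) v := by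
    rw [← LinearMap.add_apply, ← map_add]
    congr 2
    ext i j
    simp [matUnvec]
  rw [hv, mul_one] at h1 h2
  change _ = singVal (matUnvec x) 0 at h
  rw [← h, h3, dist_eq_norm]
  exact (norm_add_le _ _).trans (add_le_add h1 h2)

theorem continuous_singVal_two : Continuous fun x => singVal (matUnvec x) 2 := by
  refine (LipschitzWith.of_le_add fun x y => ?_).continuous
  obtain ⟨v, hv, h⟩ := exists_norm_eq_singVal (matUnvec y) 2
  have h1 := singVal_mul_norm_le (matUnvec x) v
  have h2 := norm_toEuclideanLin_le (matUnvec (x - y)) v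
  have h3 : Matrix.toEuclideanLin (matUnvec x) v =
      Matrix.toEuclideanLin (matUnvec y) v + Matrix.toEuclideanLin (matUnvec (x - y)) v := by
    rw [← LinearMap.add_apply, ← map_add]
    congr 2
    ext i j
    simp [matUnvec]
  rw [hv, mul_one] at h1 h2
  change _ = singVal (matUnvec y) 2 at h
  rw [← h, dist_eq_norm]
  rw [h3] at h1
  exact h1.trans ((norm_add_le _ _).trans (add_le_add le_rfl h2))

/-- The condition number, extended by zero outside the event `det M > 0`. -/
noncomputable def truncCond (M : Matrix (Fin 3) (Fin 3) ℝ) : ℝ :=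
  open Classical in if 0 < M.det then jacobianCond M else 0

/-- The extreme singular values are Lipschitz by their variational description; the middle one is
recovered as `det/(s₁s₃)`, avoiding a min-max argument. -/
theorem measurable_truncCond : Measurable fun x => truncCond (matUnvec x) := by
  have hdet : Measurable fun x => (matUnvec x).det := continuous_matUnvec.matrix_det.measurable
  have h0 := continuous_singVal_zero.measurable
  have h2 := continuous_singVal_two.measurable
  have h1 : Measurable fun x => (matUnvec x).det / (singVal (matUnvec x) 0 * singVal (matUnvec x) 2) :=
    hdet.div (h0.mul h2)
  have hset : MeasurableSet {x | 0 < (matUnvec x).det} := measurableSet_lt measurable_const hdet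
  have heq : (fun x => truncCond (matUnvec x)) = Set.indicator {x | 0 < (matUnvec x).det} fun x =>
      (singVal (matUnvec x) 0 + (matUnvec x).det / (singVal (matUnvec x) 0 * singVal (matUnvec x) 2)) /
        ((matUnvec x).det / (singVal (matUnvec x) 0 * singVal (matUnvec x) 2) +
          singVal (matUnvec x) 2) := by
    ext x
    by_cases hx : 0 < (matUnvec x).det
    · rw [truncCond, if_pos hx, Set.indicator_of_mem (by exact hx), jacobianCond_eq _ hx]
      obtain ⟨U, V, h⟩ := exists_isSVD_singVal (matUnvec x) hx.ne'
      have p0 : 0 < singVal (matUnvec x) 0 := h.pos hx.ne' 0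
      have p2 : 0 < singVal (matUnvec x) 2 := h.pos hx.ne' 2
      have hd : (matUnvec x).det = singVal (matUnvec x) 0 * singVal (matUnvec x) 1 *
          singVal (matUnvec x) 2 := by
        rw [h.det_eq, h.det_mul_transpose_eq_one hx, one_mul]
        rfl
      have e : (matUnvec x).det / (singVal (matUnvec x) 0 * singVal (matUnvec x) 2) =
          singVal (matUnvec x) 1 := by
        rw [hd]
        field_simp
      rw [e]
    · rw [truncCond, if_neg hx, Set.indicator_of_notMem (by exact hx)]
  rw [heq]
  exact ((h0.add h1).div (h1.add h2)).indicator hset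

end

/-! ### Negative moments of Gaussian minors -/

section

open scoped Matrix ENNReal

/-- The function `u ↦ |u| ^ (-3/4)`, infinite at zero. -/
noncomputable def absNegPow (u : ℝ) : ℝ≥0∞ := ENNReal.ofReal |u| ^ (-(3 / 4) : ℝ)

theorem measurable_absNegPow : Measurable absNegPow :=
  (ENNReal.measurable_ofReal.comp measurable_norm).pow_const _

theorem absNegPow_zero : absNegPow 0 = ⊤ := by
  rw [absNegPow, abs_zero, ENNReal.ofReal_zero, ENNReal.zero_rpow_of_neg (by norm_num)]

theorem absNegPow_of_ne_zero {u : ℝ} (hu : u ≠ 0) :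
    absNegPow u = ENNReal.ofReal (|u| ^ (-(3 / 4) : ℝ)) :=
  ENNReal.ofReal_rpow_of_pos (abs_pos.2 hu)

theorem absNegPow_neg (u : ℝ) : absNegPow (-u) = absNegPow u := by
  rw [absNegPow, abs_neg, absNegPow]

theorem absNegPow_mul (u v : ℝ) (hu : u ≠ 0) : absNegPow (u * v) = absNegPow u * absNegPow v := by
  rcases eq_or_ne v 0 with rfl | hv
  · rw [mul_zero, absNegPow_zero, ENNReal.mul_top]
    rw [absNegPow_of_ne_zero hu, Ne, ENNReal.ofReal_eq_zero, not_le]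
    exact Real.rpow_pos_of_pos (abs_pos.2 hu) _
  · rw [absNegPow_of_ne_zero hu, absNegPow_of_ne_zero hv, absNegPow_of_ne_zero (mul_ne_zero hu hv),
      abs_mul, Real.mul_rpow (abs_nonneg _) (abs_nonneg _), ENNReal.ofReal_mul (by positivity)]

theorem integrableOn_abs_rpow :
    IntegrableOn (fun x : ℝ => |x| ^ (-(3 / 4) : ℝ)) (Set.Ioc (-1) 1) := by
  have h1 : IntervalIntegrable (fun x : ℝ => |x| ^ (-(3 / 4) : ℝ)) volume 0 1 := by
    refine (intervalIntegral.intervalIntegrable_rpow' (r := -(3 / 4)) (by norm_num)).congr ?_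
    intro x hx
    rw [Set.uIoc_of_le zero_le_one] at hx
    simp only [abs_of_pos hx.1]
  have h2 : IntervalIntegrable (fun x : ℝ => |x| ^ (-(3 / 4) : ℝ)) volume (-1) 0 := by
    have := ((IntervalIntegrable.iff_comp_neg (by simp)).1 h1).symm
    simpa only [abs_neg, neg_zero] using this
  exact (intervalIntegrable_iff_integrableOn_Ioc_of_le (by norm_num)).1 (h2.trans h1)

/-- A bound for the Gaussian integrals of `absNegPow (α * n + β)`. -/
noncomputable def absNegPowBound : ℝ≥0∞ := 1 + ∫⁻ u in Set.Ioc (-1 : ℝ) 1, absNegPow u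

theorem absNegPowBound_ne_top : absNegPowBound ≠ ⊤ := by
  refine ENNReal.add_ne_top.2 ⟨ENNReal.one_ne_top, ?_⟩
  have h := integrableOn_abs_rpow.lintegral_lt_top
  have h1 : ∫⁻ u in Set.Ioc (-1 : ℝ) 1, absNegPow u =
      ∫⁻ u in Set.Ioc (-1 : ℝ) 1, ENNReal.ofReal (|u| ^ (-(3 / 4) : ℝ)) := by
    refine lintegral_congr_ae (ae_restrict_of_ae ?_)
    have h0 : ∀ᵐ u : ℝ, u ≠ 0 := by simp [ae_iff]
    filter_upwards [h0] with u hu using absNegPow_of_ne_zero hu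
  rw [h1]
  exact h.ne

theorem gaussianReal_zero_one_le_volume : gaussianReal 0 1 ≤ (volume : Measure ℝ) := by
  rw [gaussianReal_of_var_ne_zero _ one_ne_zero]
  have h : gaussianPDF 0 1 ≤ (1 : ℝ → ℝ≥0∞) := by
    intro x
    refine ENNReal.ofReal_le_one.2 ?_
    rw [gaussianPDFReal_def]
    have h1 : Real.exp (-(x - 0) ^ 2 / (2 * ((1 : NNReal) : ℝ))) ≤ 1 :=
      Real.exp_le_one_iff.2 (div_nonpos_of_nonpos_of_nonneg (neg_nonpos.2 (sq_nonneg _))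
        (by norm_num))
    have h2 : (√(2 * Real.pi * ((1 : NNReal) : ℝ)))⁻¹ ≤ 1 := by
      refine inv_le_one_of_one_le₀ (Real.one_le_sqrt.2 ?_)
      push_cast
      nlinarith [Real.pi_gt_three]
    exact mul_le_one₀ h2 (Real.exp_pos _).le h1
  calc volume.withDensity (gaussianPDF 0 1) ≤ volume.withDensity 1 :=
        withDensity_mono (Eventually.of_forall h)
    _ = volume := withDensity_one

/-- The singularity is integrable because `3/4 < 1`. Dominating the Gaussian by Lebesgue measure,
which is translation invariant, makes the bound independent of `b`. -/
theorem lintegral_absNegPow_add_le (b : ℝ) :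
    ∫⁻ n, absNegPow (n + b) ∂gaussianReal 0 1 ≤ absNegPowBound := by
  have hle : ∀ u, absNegPow u ≤ 1 + (Set.Ioc (-1 : ℝ) 1).indicator absNegPow u := by
    intro u
    by_cases hu : u ∈ Set.Ioc (-1 : ℝ) 1
    · rw [Set.indicator_of_mem hu]
      exact le_add_self
    · rw [Set.indicator_of_notMem hu, add_zero]
      have h1 : 1 ≤ |u| := by
        by_contra! h
        exact hu ⟨(abs_lt.1 h).1, (abs_lt.1 h).2.le⟩
      exact ENNReal.rpow_le_one_of_one_le_of_neg (by simpa using h1) (by norm_num)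
  have hm : Measurable ((Set.Ioc (-1 : ℝ) 1).indicator absNegPow) :=
    measurable_absNegPow.indicator measurableSet_Ioc
  calc ∫⁻ n, absNegPow (n + b) ∂gaussianReal 0 1
      ≤ ∫⁻ n, (1 + (Set.Ioc (-1 : ℝ) 1).indicator absNegPow (n + b)) ∂gaussianReal 0 1 :=
        lintegral_mono fun n => hle _
    _ = 1 + ∫⁻ n, (Set.Ioc (-1 : ℝ) 1).indicator absNegPow (n + b) ∂gaussianReal 0 1 := by
        rw [lintegral_add_left measurable_const, lintegral_one, measure_univ]
    _ ≤ 1 + ∫⁻ n, (Set.Ioc (-1 : ℝ) 1).indicator absNegPow (n + b) := by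
        gcongr
        exact gaussianReal_zero_one_le_volume
    _ = _ := by
        rw [lintegral_add_right_eq_self (μ := (volume : Measure ℝ))
          ((Set.Ioc (-1 : ℝ) 1).indicator absNegPow) b, lintegral_indicator measurableSet_Ioc,
          absNegPowBound]

theorem lintegral_absNegPow_mul_add_le (a b : ℝ) :
    ∫⁻ n, absNegPow (a * n + b) ∂gaussianReal 0 1 ≤ absNegPowBound * absNegPow a := by
  rcases eq_or_ne a 0 with rfl | ha
  · rw [absNegPow_zero, ENNReal.mul_top]
    · exact le_top
    · exact (zero_lt_one.trans_le le_self_add).ne'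
  · have h : ∀ n, absNegPow (a * n + b) = absNegPow a * absNegPow (n + b / a) := by
      intro n
      rw [← absNegPow_mul _ _ ha]
      congr 1
      field_simp
    simp only [h]
    rw [lintegral_const_mul _ (by exact measurable_absNegPow.comp (measurable_add_const _)), mul_comm]
    gcongr
    exact lintegral_absNegPow_add_le _

theorem lintegral_pi_le_of_lintegral_update_le {ι : Type*} [Fintype ι] [DecidableEq ι]
    {ν : Measure ℝ} [IsProbabilityMeasure ν] {f g : (ι → ℝ) → ℝ≥0∞} (hf : Measurable f)
    (hg : Measurable g) (i : ι) (hgi : ∀ x y, g (Function.update x i y) = g x)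
    (h : ∀ x, ∫⁻ y, f (Function.update x i y) ∂ν ≤ g x) :
    ∫⁻ x, f x ∂Measure.pi (fun _ => ν) ≤ ∫⁻ x, g x ∂Measure.pi fun _ => ν := by
  refine lintegral_le_of_lmarginal_le {i} hf hg fun x => ?_
  rw [lmarginal_singleton, lmarginal_singleton]
  simpa only [hgi, lintegral_const, measure_univ, mul_one] using h x

/-- Integrates out one coordinate in which the first factor is affine, replacing that factor by its
slope. A zero slope is harmless: its negative power is then infinite. -/
theorem lintegral_pi_absNegPow_mul_le {ι : Type*} [Fintype ι] [DecidableEq ι]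
    {a b : (ι → ℝ) → ℝ} {c : (ι → ℝ) → ℝ≥0∞} (ha : Measurable a) (hb : Measurable b)
    (hc : Measurable c) (i : ι) (hai : ∀ x y, a (Function.update x i y) = a x)
    (hbi : ∀ x y, b (Function.update x i y) = b x)
    (hci : ∀ x y, c (Function.update x i y) = c x) :
    ∫⁻ x, absNegPow (a x * x i + b x) * c x ∂Measure.pi (fun _ => gaussianReal 0 1) ≤
      absNegPowBound * ∫⁻ x, absNegPow (a x) * c x ∂Measure.pi fun _ => gaussianReal 0 1 := by
  have hψ := measurable_absNegPow
  have m1 : Measurable fun x => absNegPow (a x) * c x := (hψ.comp ha).mul hc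
  rw [← lintegral_const_mul _ m1]
  refine lintegral_pi_le_of_lintegral_update_le ?_ (m1.const_mul _) i ?_ fun x => ?_
  · exact (hψ.comp ((ha.mul (measurable_pi_apply i)).add hb)).mul hc
  · intro x y
    rw [hai, hci]
  · simp only [hai, hbi, hci, Function.update_self]
    rw [lintegral_mul_const _ (by exact hψ.comp ((measurable_id.const_mul _).add_const _)),
      ← mul_assoc]
    gcongr
    exact lintegral_absNegPow_mul_add_le _ _

/-- The product of the `-3/4` powers of two minors of `M`. -/
noncomputable def minorNegPow (M : Matrix (Fin 3) (Fin 3) ℝ) : ℝ≥0∞ :=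
  absNegPow (M 0 0 * M 1 1 - M 0 1 * M 1 0) * absNegPow (M 1 0 * M 2 2 - M 1 2 * M 2 0)

theorem measurable_minorNegPow :
    Measurable fun x : EuclideanSpace ℝ (Fin 3 × Fin 3) => minorNegPow (matUnvec x) := by
  unfold minorNegPow
  refine (measurable_absNegPow.comp ?_).mul (measurable_absNegPow.comp ?_) <;>
  · simp only [matUnvec, Matrix.of_apply]
    fun_prop

theorem one_add_smul_matUnvec (σ : ℝ) (x : EuclideanSpace ℝ (Fin 3 × Fin 3)) :
    1 + σ • matUnvec x = matUnvec (matVec 1 + σ • x) := by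
  ext i j
  rfl

theorem measurable_matVec_one_add_smul (σ : ℝ) :
    Measurable fun x : EuclideanSpace ℝ (Fin 3 × Fin 3) => matVec 1 + σ • x := by
  fun_prop

/-- The two minors are chosen so that coordinates can be eliminated successively: `(0,1)` occurs
only in the first with slope `-σ² y(1,0)`, and `(1,2)` only in the second with slope `-σ² y(2,0)`.
The slopes are then integrated in turn. Two different minors are used because the power `-3/2` of a
single one would not be integrable along a line. -/
theorem lintegral_minorNegPow_le {σ : ℝ} (hσ : 0 < σ) :
    ∫⁻ x, minorNegPow (1 + σ • matUnvec x) ∂matGaussian ≤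
      absNegPowBound ^ 4 * ENNReal.ofReal ((σ ^ 3)⁻¹) := by
  have hmap : matGaussian = (Measure.pi fun _ => gaussianReal 0 1).map
    (WithLp.toLp 2 : (Fin 3 × Fin 3 → ℝ) → EuclideanSpace ℝ (Fin 3 × Fin 3)) :=
      map_pi_eq_stdGaussian.symm
  have hmeas : Measurable fun x : EuclideanSpace ℝ (Fin 3 × Fin 3) =>
      minorNegPow (1 + σ • matUnvec x) := by
    simp only [one_add_smul_matUnvec]
    exact measurable_minorNegPow.comp (measurable_matVec_one_add_smul σ)
  rw [hmap, lintegral_map hmeas (by fun_prop)]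
  have hψ := measurable_absNegPow
  have e : ∀ y : Fin 3 × Fin 3 → ℝ, minorNegPow (1 + σ • matUnvec (WithLp.toLp 2 y)) =
      absNegPow (-(σ ^ 2 * y (1, 0)) * y (0, 1) + (1 + σ * y (0, 0)) * (1 + σ * y (1, 1))) *
        absNegPow (-(σ ^ 2 * y (2, 0)) * y (1, 2) + σ * y (1, 0) * (1 + σ * y (2, 2))) := by
    intro y
    simp only [minorNegPow, matUnvec, Matrix.add_apply, Matrix.smul_apply, Matrix.of_apply,
      smul_eq_mul, Matrix.one_apply_eq]
    rw [Matrix.one_apply_ne (by decide), Matrix.one_apply_ne (by decide),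
      Matrix.one_apply_ne (by decide), Matrix.one_apply_ne (by decide)]
    congr 2 <;> ring
  simp only [e]
  have u : ∀ {i j : Fin 3 × Fin 3} (x : Fin 3 × Fin 3 → ℝ) (y : ℝ), j ≠ i →
      Function.update x i y j = x j := fun x y h => Function.update_of_ne h y x
  have s1 := lintegral_pi_absNegPow_mul_le (ι := Fin 3 × Fin 3)
    (a := fun y => -(σ ^ 2 * y (1, 0))) (b := fun y => (1 + σ * y (0, 0)) * (1 + σ * y (1, 1)))
    (c := fun y => absNegPow (-(σ ^ 2 * y (2, 0)) * y (1, 2) + σ * y (1, 0) * (1 + σ * y (2, 2))))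
    (by fun_prop) (by fun_prop) (by exact hψ.comp (by fun_prop)) (0, 1)
    (by intro x y; simp only [u x y (by decide : ((1, 0) : Fin 3 × Fin 3) ≠ (0, 1))])
    (by
      intro x y
      simp only [u x y (by decide : ((0, 0) : Fin 3 × Fin 3) ≠ (0, 1)),
        u x y (by decide : ((1, 1) : Fin 3 × Fin 3) ≠ (0, 1))])
    (by
      intro x y
      simp only [u x y (by decide : ((2, 0) : Fin 3 × Fin 3) ≠ (0, 1)),
        u x y (by decide : ((1, 2) : Fin 3 × Fin 3) ≠ (0, 1)),
        u x y (by decide : ((1, 0) : Fin 3 × Fin 3) ≠ (0, 1)),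
        u x y (by decide : ((2, 2) : Fin 3 × Fin 3) ≠ (0, 1))])
  have s2 := lintegral_pi_absNegPow_mul_le (ι := Fin 3 × Fin 3)
    (a := fun y => -(σ ^ 2 * y (2, 0))) (b := fun y => σ * y (1, 0) * (1 + σ * y (2, 2)))
    (c := fun y => absNegPow (-(σ ^ 2 * y (1, 0))))
    (by fun_prop) (by fun_prop) (by exact hψ.comp (by fun_prop)) (1, 2)
    (by intro x y; simp only [u x y (by decide : ((2, 0) : Fin 3 × Fin 3) ≠ (1, 2))])
    (by
      intro x y
      simp only [u x y (by decide : ((1, 0) : Fin 3 × Fin 3) ≠ (1, 2)),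
        u x y (by decide : ((2, 2) : Fin 3 × Fin 3) ≠ (1, 2))])
    (by intro x y; simp only [u x y (by decide : ((1, 0) : Fin 3 × Fin 3) ≠ (1, 2))])
  have s3 := lintegral_pi_absNegPow_mul_le (ι := Fin 3 × Fin 3)
    (a := fun _ => -σ ^ 2) (b := fun _ => 0) (c := fun y => absNegPow (-(σ ^ 2 * y (1, 0))))
    (by fun_prop) (by fun_prop) (by exact hψ.comp (by fun_prop)) (2, 0)
    (fun _ _ => rfl) (fun _ _ => rfl)
    (by intro x y; simp only [u x y (by decide : ((1, 0) : Fin 3 × Fin 3) ≠ (2, 0))])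
  have s4 := lintegral_pi_absNegPow_mul_le (ι := Fin 3 × Fin 3)
    (a := fun _ => -σ ^ 2) (b := fun _ => 0) (c := fun _ => absNegPow (-σ ^ 2))
    (by fun_prop) (by fun_prop) measurable_const (1, 0)
    (fun _ _ => rfl) (fun _ _ => rfl) (fun _ _ => rfl)
  have hσ2 : absNegPow (-σ ^ 2) * absNegPow (-σ ^ 2) = ENNReal.ofReal ((σ ^ 3)⁻¹) := by
    rw [absNegPow_neg, absNegPow_of_ne_zero (by positivity), ← ENNReal.ofReal_mul (by positivity)]
    congr 1
    rw [abs_of_pos (by positivity), ← Real.rpow_natCast σ 2, ← Real.rpow_mul hσ.le,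
      ← Real.rpow_add hσ, ← Real.rpow_natCast σ 3, ← Real.rpow_neg hσ.le]
    norm_num
  simp only [lintegral_const, measure_univ, mul_one, add_zero, neg_mul, hσ2] at s3 s4
  refine s1.trans ?_
  have hK : absNegPowBound ^ 4 * ENNReal.ofReal ((σ ^ 3)⁻¹) = absNegPowBound * (absNegPowBound *
      (absNegPowBound * (absNegPowBound * ENNReal.ofReal ((σ ^ 3)⁻¹)))) := by ring
  rw [hK]
  gcongr
  simp only [mul_comm (absNegPow (-(σ ^ 2 * _)))]
  refine s2.trans ?_
  gcongr
  refine s3.trans ?_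
  gcongr
  simp only [mul_comm (absNegPow (-σ ^ 2)) (absNegPow (-(σ ^ 2 * _)))]
  exact s4

end

/-! ### Pointwise domination of the error -/

section

open scoped Matrix ENNReal

theorem mul_le_cube_add_rpow {a b : ℝ} (ha : 0 ≤ a) (hb : 0 ≤ b) :
    a * b ≤ a ^ 3 + b ^ (3 / 2 : ℝ) := by
  have h32 : b ^ (3 / 2 : ℝ) = √b * b := by
    rcases hb.eq_or_lt with rfl | hb
    · rw [Real.zero_rpow (by norm_num), mul_zero]
    · rw [Real.sqrt_eq_rpow, ← Real.rpow_add_one hb.ne']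
      norm_num
  rw [h32]
  have hs := Real.sqrt_nonneg b
  have hsq := Real.sq_sqrt hb
  rcases le_total (√b) a with h | h
  · have : b ≤ a ^ 2 := hsq ▸ pow_le_pow_left₀ hs h 2
    nlinarith [mul_nonneg hs hb]
  · nlinarith [pow_nonneg ha 3, mul_le_mul_of_nonneg_right h hb]

theorem inv_rpow_le_minorNegPow {M : Matrix (Fin 3) (Fin 3) ℝ} (hM : 0 < M.det)
    (hfin : minorNegPow M ≠ ⊤) :
    (singVal M 0 * singVal M 1)⁻¹ ^ (3 / 2 : ℝ) ≤ (minorNegPow M).toReal := by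
  set p := singVal M 0 * singVal M 1
  have hp : 0 < p := singVal_zero_mul_one_pos hM
  have key : ∀ u : ℝ, |u| ≤ p → ENNReal.ofReal (p ^ (-(3 / 4) : ℝ)) ≤ absNegPow u := by
    intro u hu
    rcases eq_or_ne u 0 with rfl | hu0
    · rw [absNegPow_zero]
      exact le_top
    · rw [absNegPow_of_ne_zero hu0]
      exact ENNReal.ofReal_le_ofReal
        (Real.rpow_le_rpow_of_nonpos (abs_pos.2 hu0) hu (by norm_num))
  have h1 : |M 0 0 * M 1 1 - M 0 1 * M 1 0| ≤ p := by
    have := abs_adjugate_apply_le hM 2 2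
    rw [Matrix.adjugate_fin_three] at this
    simpa using this
  have h2 : |M 1 0 * M 2 2 - M 1 2 * M 2 0| ≤ p := by
    have := abs_adjugate_apply_le hM 1 0
    rw [Matrix.adjugate_fin_three] at this
    simp only [Matrix.of_apply, Matrix.cons_val', Matrix.cons_val_zero, Matrix.cons_val_one] at this
    rwa [neg_add_eq_sub, abs_sub_comm] at this
  have h3 : ENNReal.ofReal (p⁻¹ ^ (3 / 2 : ℝ)) ≤ minorNegPow M := by
    have : p⁻¹ ^ (3 / 2 : ℝ) = p ^ (-(3 / 4) : ℝ) * p ^ (-(3 / 4) : ℝ) := by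
      rw [← Real.rpow_add hp, Real.inv_rpow hp.le, ← Real.rpow_neg hp.le]
      norm_num
    rw [this, ENNReal.ofReal_mul (by positivity)]
    exact mul_le_mul' (key _ h1) (key _ h2)
  exact (ENNReal.ofReal_le_iff_le_toReal hfin).1 h3

theorem truncCond_nonneg (M : Matrix (Fin 3) (Fin 3) ℝ) : 0 ≤ truncCond M := by
  unfold truncCond
  split_ifs with h
  exacts [jacobianCond_nonneg h, le_rfl]

/-- Young's inequality with exponents `3` and `3/2` separates polynomial growth in `‖N‖` from the
singular factor `1/(s₁s₂)`. The weight `τ²` becomes `τ³`, which for `τ = σ` compensates the `σ⁻³` in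
the expectation of the minors. -/
theorem truncCond_mul_le (N : Matrix (Fin 3) (Fin 3) ℝ) {σ τ b : ℝ} (hσ : 0 ≤ σ) (hτ : 0 ≤ τ)
    (hb : 0 ≤ b) (hfin : minorNegPow (1 + σ • N) ≠ ⊤) :
    b * τ ^ 2 * truncCond (1 + σ • N) ≤
      (b * (2 * (1 + σ * ‖matVec N‖) ^ 2)) ^ 3 + τ ^ 3 * (minorNegPow (1 + σ • N)).toReal := by
  by_cases h : 0 < (1 + σ • N).det
  · rw [truncCond, if_pos h]
    have hp := singVal_zero_mul_one_pos h
    have h1 := inv_rpow_le_minorNegPow h hfin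
    have h2 := singVal_zero_one_add_smul_le_one_add N hσ
    have h3 := jacobianCond_le h
    have h0 := singVal_nonneg (1 + σ • N) 0
    set p := singVal (1 + σ • N) 0 * singVal (1 + σ • N) 1
    calc b * τ ^ 2 * jacobianCond (1 + σ • N)
        ≤ b * τ ^ 2 * (2 * (1 + σ * ‖matVec N‖) ^ 2 / p) := by
          gcongr
          exact h3.trans (by gcongr)
      _ = b * (2 * (1 + σ * ‖matVec N‖) ^ 2) * (τ ^ 2 * p⁻¹) := by ring
      _ ≤ (b * (2 * (1 + σ * ‖matVec N‖) ^ 2)) ^ 3 + (τ ^ 2 * p⁻¹) ^ (3 / 2 : ℝ) :=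
          mul_le_cube_add_rpow (by positivity) (by positivity)
      _ ≤ _ := by
          rw [Real.mul_rpow (by positivity) (by positivity), ← Real.rpow_natCast τ 2,
            ← Real.rpow_mul hτ]
          have : ((2 : ℕ) : ℝ) * (3 / 2) = (3 : ℕ) := by norm_num
          rw [this, Real.rpow_natCast]
          gcongr
  · rw [truncCond, if_neg h, mul_zero]
    positivity

/-- Small noise is covered by the perturbation estimate. For large noise a fourth power of `4σ‖N‖ >
1` is inserted: two powers of `σ` give the prefactor and two are spent in Young's inequality. The
exponent `18` comes from cubing `(1+y)⁶`, and `10⁹` exceeds `512³ + 16`. -/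
theorem abs_truncCond_sub_le (N : Matrix (Fin 3) (Fin 3) ℝ) {σ : ℝ} (hσ : 0 < σ) (hσ1 : σ ≤ 1)
    (hfin : minorNegPow (1 + σ • N) ≠ ⊤) :
    |truncCond (1 + σ • N) - (1 + σ * ((largestEigSymPart N + largestEigSymPart (-N)) / 2))| ≤
      σ ^ 2 * (10 ^ 9 * (1 + ‖matVec N‖) ^ 18 + σ ^ 3 * (minorNegPow (1 + σ • N)).toReal) := by
  set y := ‖matVec N‖ with hy
  set g := (minorNegPow (1 + σ • N)).toReal
  have hg : 0 ≤ g := ENNReal.toReal_nonneg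
  have hy0 : 0 ≤ y := norm_nonneg _
  have hpow : ∀ k ≤ 18, (1 + y) ^ k ≤ (1 + y) ^ 18 := fun k hk =>
    pow_le_pow_right₀ (by linarith) hk
  have hσg : 0 ≤ σ ^ 3 * g := by positivity
  rcases le_or_gt (σ * y) (1 / 4) with ht | ht
  · have hpos := det_one_add_smul_pos N hσ.le (by linarith : σ * y < 1)
    rw [truncCond, if_pos hpos]
    refine (abs_jacobianCond_sub_le N hσ.le ht).trans ?_
    have : y ^ 2 ≤ (1 + y) ^ 18 :=
      (pow_le_pow_left₀ hy0 (by linarith) 2).trans (hpow 2 (by norm_num))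
    calc 2 * (σ * y) ^ 2 = σ ^ 2 * (2 * y ^ 2) := by ring
      _ ≤ _ := by
        gcongr
        nlinarith
  · have hn : ‖matVec (-N)‖ = y := by
      have : matVec (-N) = -matVec N := rfl
      rw [this, norm_neg]
    have hw : |(largestEigSymPart N + largestEigSymPart (-N)) / 2| ≤ y := by
      have h1 := abs_le.1 (abs_largestEigSymPart_le N)
      have h2 := abs_le.1 (abs_largestEigSymPart_le (-N))
      rw [hn] at h2
      exact abs_le.2 ⟨by linarith, by linarith⟩
    set w := (largestEigSymPart N + largestEigSymPart (-N)) / 2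
    have hσy : σ * y ≤ y := mul_le_of_le_one_left hy0 hσ1
    have h1 : 1 ≤ 16 * (σ * y) ^ 2 := by nlinarith
    have h2 : 1 ≤ 256 * (σ * y) ^ 4 := by nlinarith
    have h3 : |truncCond (1 + σ • N) - (1 + σ * w)| ≤ truncCond (1 + σ • N) + (1 + y) := by
      have hT := truncCond_nonneg (1 + σ • N)
      have h4 : |σ * w| ≤ y := by
        rw [abs_mul, abs_of_pos hσ]
        exact (mul_le_mul_of_nonneg_left hw hσ.le).trans hσy
      have h5 := abs_le.1 h4
      exact abs_le.2 ⟨by linarith, by linarith⟩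
    have h4 : 1 + y ≤ σ ^ 2 * (16 * (1 + y) ^ 18) := by
      calc 1 + y ≤ 16 * (σ * y) ^ 2 * (1 + y) := le_mul_of_one_le_left (by positivity) h1
        _ = σ ^ 2 * (16 * (y ^ 2 * (1 + y))) := by ring
        _ ≤ σ ^ 2 * (16 * ((1 + y) ^ 2 * (1 + y))) := by
            gcongr
            linarith
        _ = σ ^ 2 * (16 * (1 + y) ^ 3) := by ring
        _ ≤ _ := by
            gcongr ?_ * (?_ * ?_)
            exact hpow 3 (by norm_num)
    have h5 : truncCond (1 + σ • N) ≤ σ ^ 2 * ((512 * (1 + y) ^ 6) ^ 3 + σ ^ 3 * g) := by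
      have hT := truncCond_nonneg (1 + σ • N)
      have h6 := truncCond_mul_le N hσ.le hσ.le (by positivity : 0 ≤ 256 * y ^ 4) hfin
      calc truncCond (1 + σ • N) ≤ 256 * (σ * y) ^ 4 * truncCond (1 + σ • N) :=
            le_mul_of_one_le_left hT h2
        _ = σ ^ 2 * (256 * y ^ 4 * σ ^ 2 * truncCond (1 + σ • N)) := by ring
        _ ≤ σ ^ 2 * ((256 * y ^ 4 * (2 * (1 + σ * y) ^ 2)) ^ 3 + σ ^ 3 * g) := by gcongr
        _ ≤ σ ^ 2 * ((256 * (1 + y) ^ 4 * (2 * (1 + y) ^ 2)) ^ 3 + σ ^ 3 * g) := by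
            gcongr
            linarith
        _ = _ := by ring
    calc _ ≤ σ ^ 2 * ((512 * (1 + y) ^ 6) ^ 3 + σ ^ 3 * g) + σ ^ 2 * (16 * (1 + y) ^ 18) :=
          h3.trans (add_le_add h5 h4)
      _ = σ ^ 2 * ((512 ^ 3 + 16) * (1 + y) ^ 18 + σ ^ 3 * g) := by ring
      _ ≤ _ := by
          gcongr
          norm_num

end

/-! ### Asymptotics of the Gaussian expectation -/

section

open scoped Matrix ENNReal

theorem isOpenPosMeasure_matGaussian : Measure.IsOpenPosMeasure matGaussian := by
  have h : Measure.IsOpenPosMeasure (gaussianReal 0 1) :=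
    (gaussianReal_absolutelyContinuous' 0 one_ne_zero).isOpenPosMeasure
  rw [matGaussian, ← map_pi_eq_stdGaussian]
  exact (PiLp.continuous_toLp 2 _).isOpenPosMeasure_map (WithLp.toLp_surjective 2)

theorem measurable_truncCond_one_add_smul (σ : ℝ) :
    Measurable fun x => truncCond (1 + σ • matUnvec x) := by
  simp only [one_add_smul_matUnvec]
  exact measurable_truncCond.comp (measurable_matVec_one_add_smul σ)

theorem measurable_minorNegPow_one_add_smul (σ : ℝ) :
    Measurable fun x => minorNegPow (1 + σ • matUnvec x) := by
  simp only [one_add_smul_matUnvec]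
  exact measurable_minorNegPow.comp (measurable_matVec_one_add_smul σ)

theorem measurableSet_det_one_add_smul_pos (σ : ℝ) :
    MeasurableSet {x | 0 < (1 + σ • matUnvec x).det} := by
  refine measurableSet_lt measurable_const ?_
  simp only [one_add_smul_matUnvec]
  exact continuous_matUnvec.matrix_det.measurable.comp (measurable_matVec_one_add_smul σ)

theorem lintegral_minorNegPow_ne_top {σ : ℝ} (hσ : 0 < σ) :
    ∫⁻ x, minorNegPow (1 + σ • matUnvec x) ∂matGaussian ≠ ⊤ :=
  ne_top_of_le_ne_top (ENNReal.mul_ne_top (ENNReal.pow_ne_top absNegPowBound_ne_top)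
    ENNReal.ofReal_ne_top) (lintegral_minorNegPow_le hσ)

theorem integrable_minorNegPow {σ : ℝ} (hσ : 0 < σ) :
    Integrable (fun x => (minorNegPow (1 + σ • matUnvec x)).toReal) matGaussian :=
  integrable_toReal_of_lintegral_ne_top (measurable_minorNegPow_one_add_smul σ).aemeasurable
    (lintegral_minorNegPow_ne_top hσ)

theorem ae_minorNegPow_ne_top {σ : ℝ} (hσ : 0 < σ) :
    ∀ᵐ x ∂matGaussian, minorNegPow (1 + σ • matUnvec x) ≠ ⊤ := by
  filter_upwards [ae_lt_top (measurable_minorNegPow_one_add_smul σ)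
    (lintegral_minorNegPow_ne_top hσ)] with x hx using hx.ne

theorem integral_minorNegPow_le {σ : ℝ} (hσ : 0 < σ) :
    σ ^ 3 * ∫ x, (minorNegPow (1 + σ • matUnvec x)).toReal ∂matGaussian ≤
      (absNegPowBound ^ 4).toReal := by
  have hK : absNegPowBound ^ 4 ≠ ⊤ := ENNReal.pow_ne_top absNegPowBound_ne_top
  rw [integral_toReal (measurable_minorNegPow_one_add_smul σ).aemeasurable
    (ae_lt_top (measurable_minorNegPow_one_add_smul σ) (lintegral_minorNegPow_ne_top hσ))]
  have h := ENNReal.toReal_mono (ENNReal.mul_ne_top hK ENNReal.ofReal_ne_top)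
    (lintegral_minorNegPow_le hσ)
  rw [ENNReal.toReal_mul, ENNReal.toReal_ofReal (by positivity)] at h
  calc _ ≤ σ ^ 3 * ((absNegPowBound ^ 4).toReal * (σ ^ 3)⁻¹) := by gcongr
    _ = _ := by field_simp

theorem integrable_one_add_norm_pow_matGaussian (k : ℕ) :
    Integrable (fun x => (1 + ‖x‖) ^ k) matGaussian := by
  have h0 : MemLp (fun x => ‖id x‖) k matGaussian :=
    MemLp.norm (IsGaussian.memLp_id matGaussian k (by simp))
  have h : MemLp ((fun _ => (1 : ℝ)) + fun x => ‖id x‖) k matGaussian :=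
    MemLp.add (memLp_const 1) h0
  refine h.integrable_norm_pow'.congr (Eventually.of_forall fun x => ?_)
  simp only [Pi.add_apply, id_eq]
  rw [Real.norm_of_nonneg (by positivity)]

theorem integrable_truncCond {σ : ℝ} (hσ : 0 < σ) :
    Integrable (fun x => truncCond (1 + σ • matUnvec x)) matGaussian := by
  have h1 := ((integrable_one_add_norm_pow_matGaussian 6).const_mul
    ((2 * (1 + σ) ^ 2) ^ 3)).add (integrable_minorNegPow hσ)
  refine h1.mono' (measurable_truncCond_one_add_smul σ).aestronglyMeasurable ?_
  filter_upwards [ae_minorNegPow_ne_top hσ] with x hx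
  rw [Real.norm_of_nonneg (truncCond_nonneg _)]
  have h2 := truncCond_mul_le (matUnvec x) hσ.le zero_le_one zero_le_one hx
  rw [matVec_matUnvec] at h2
  simp only [one_pow, one_mul] at h2
  refine h2.trans (add_le_add_left ?_ _)
  have h3 : 1 + σ * ‖x‖ ≤ (1 + σ) * (1 + ‖x‖) := by nlinarith [norm_nonneg x]
  calc (2 * (1 + σ * ‖x‖) ^ 2) ^ 3 ≤ (2 * ((1 + σ) * (1 + ‖x‖)) ^ 2) ^ 3 := by gcongr
    _ = _ := by ring

/-- Half the gap between the extreme eigenvalues of the symmetric part. -/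
noncomputable def halfSpread (N : Matrix (Fin 3) (Fin 3) ℝ) : ℝ :=
  (largestEigSymPart N + largestEigSymPart (-N)) / 2

/-- The Gaussian law is invariant under `N ↦ -N`, so both extreme eigenvalues contribute the same
mean. -/
theorem integrable_and_integral_halfSpread :
    Integrable (fun x => halfSpread (matUnvec x)) matGaussian ∧
      ∫ x, halfSpread (matUnvec x) ∂matGaussian = goeConst := by
  obtain ⟨hi, he⟩ := integrable_and_integral_largestEigSymPart
  have hneg : MeasurePreserving (fun x => -x) matGaussian matGaussian :=
    ⟨measurable_neg, stdGaussian_map (LinearIsometryEquiv.neg ℝ)⟩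
  have hi' : Integrable (fun x => largestEigSymPart (-matUnvec x)) matGaussian :=
    hneg.integrable_comp_of_integrable hi
  have he' : ∫ x, largestEigSymPart (-matUnvec x) ∂matGaussian = goeConst := by
    rw [← he]
    exact hneg.integral_comp (MeasurableEquiv.neg _).measurableEmbedding
      fun x => largestEigSymPart (matUnvec x)
  refine ⟨(hi.add hi').div_const 2, ?_⟩
  unfold halfSpread
  rw [integral_div, integral_add hi hi', he, he']
  ring

theorem exists_abs_integral_truncCond_sub_le : ∃ C : ℝ, 0 ≤ C ∧ ∀ σ : ℝ, 0 < σ → σ ≤ 1 →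
    |∫ x, truncCond (1 + σ • matUnvec x) ∂matGaussian - (1 + σ * goeConst)| ≤ C * σ ^ 2 := by
  refine ⟨10 ^ 9 * ∫ x, (1 + ‖x‖) ^ 18 ∂matGaussian + (absNegPowBound ^ 4).toReal,
    add_nonneg (mul_nonneg (by norm_num) (integral_nonneg fun x => by positivity))
      ENNReal.toReal_nonneg, fun σ hσ hσ1 => ?_⟩
  obtain ⟨hi, he⟩ := integrable_and_integral_halfSpread
  have hlin : Integrable (fun x => 1 + σ * halfSpread (matUnvec x)) matGaussian :=
    (integrable_const 1).add (hi.const_mul σ)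
  have hlin' : ∫ x, (1 + σ * halfSpread (matUnvec x)) ∂matGaussian = 1 + σ * goeConst := by
    rw [integral_add (integrable_const 1) (hi.const_mul σ), integral_const_mul, he]
    simp
  have hp := (integrable_one_add_norm_pow_matGaussian 18).const_mul (10 ^ 9)
  have hg := (integrable_minorNegPow hσ).const_mul (σ ^ 3)
  rw [← hlin', ← integral_sub (integrable_truncCond hσ) hlin]
  refine (abs_integral_le_integral_abs).trans ?_
  calc ∫ x, |truncCond (1 + σ • matUnvec x) - (1 + σ * halfSpread (matUnvec x))| ∂matGaussian
      ≤ ∫ x, σ ^ 2 * (10 ^ 9 * (1 + ‖x‖) ^ 18 +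
          σ ^ 3 * (minorNegPow (1 + σ • matUnvec x)).toReal) ∂matGaussian := by
        refine integral_mono_ae ((integrable_truncCond hσ).sub hlin).abs
          ((hp.add hg).const_mul _) ?_
        filter_upwards [ae_minorNegPow_ne_top hσ] with x hx
        exact abs_truncCond_sub_le (matUnvec x) hσ hσ1 hx
    _ = σ ^ 2 * (10 ^ 9 * ∫ x, (1 + ‖x‖) ^ 18 ∂matGaussian +
          σ ^ 3 * ∫ x, (minorNegPow (1 + σ • matUnvec x)).toReal ∂matGaussian) := by
        rw [integral_const_mul, integral_add hp hg, integral_const_mul, integral_const_mul]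
    _ ≤ σ ^ 2 * (10 ^ 9 * ∫ x, (1 + ‖x‖) ^ 18 ∂matGaussian + (absNegPowBound ^ 4).toReal) := by
        gcongr
        exact integral_minorNegPow_le hσ
    _ = _ := mul_comm _ _

theorem matGaussian_det_pos_ne_zero {σ : ℝ} (hσ : 0 < σ) :
    matGaussian {x | 0 < (1 + σ • matUnvec x).det} ≠ 0 := by
  have := isOpenPosMeasure_matGaussian
  have h := (Metric.isOpen_ball (x := (0 : EuclideanSpace ℝ (Fin 3 × Fin 3)))
    (ε := σ⁻¹)).measure_pos matGaussian ⟨0, Metric.mem_ball_self (by positivity)⟩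
  refine (h.trans_le (measure_mono fun x hx => ?_)).ne'
  refine det_one_add_smul_pos (matUnvec x) hσ.le ?_
  rw [matVec_matUnvec]
  rw [mem_ball_zero_iff] at hx
  calc σ * ‖x‖ < σ * σ⁻¹ := by gcongr
    _ = 1 := mul_inv_cancel₀ hσ.ne'

/-- Chebyshev's inequality in pointwise form: `1 - σ²‖x‖²` lies below the indicator of positive
determinant, since it is nonpositive wherever that indicator may vanish. -/
theorem exists_one_sub_le_measureReal_det_pos : ∃ C : ℝ, 0 ≤ C ∧ ∀ σ : ℝ, 0 < σ →
    1 - C * σ ^ 2 ≤ matGaussian.real {x | 0 < (1 + σ • matUnvec x).det} := by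
  refine ⟨∫ x, ‖x‖ ^ 2 ∂matGaussian, integral_nonneg fun x => by positivity, fun σ hσ => ?_⟩
  have hi := (integrable_norm_pow_matGaussian 2).const_mul (σ ^ 2)
  have hs := measurableSet_det_one_add_smul_pos σ
  rw [← integral_indicator_one hs]
  have h1 : ∫ x, (1 - σ ^ 2 * ‖x‖ ^ 2) ∂matGaussian = 1 - (∫ x, ‖x‖ ^ 2 ∂matGaussian) * σ ^ 2 := by
    rw [integral_sub (integrable_const 1) hi, integral_const_mul]
    simp [mul_comm]
  rw [← h1]
  refine integral_mono ((integrable_const 1).sub hi) ((integrable_const 1).indicator hs) fun x => ?_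
  by_cases hx : 0 < (1 + σ • matUnvec x).det
  · simp only [Set.indicator_of_mem (show x ∈ {x | 0 < (1 + σ • matUnvec x).det} from hx)]
    have : 0 ≤ σ ^ 2 * ‖x‖ ^ 2 := by positivity
    simpa using this
  · simp only [Set.indicator_of_notMem (show x ∉ {x | 0 < (1 + σ • matUnvec x).det} from hx)]
    have h2 : 1 ≤ σ * ‖x‖ := by
      by_contra! h
      exact hx (det_one_add_smul_pos (matUnvec x) hσ.le h)
    nlinarith

end

/-! ### Conditioning and the leading-order formula -/

section

open scoped Matrix ENNReal

theorem goeConst_pos : 0 < goeConst := by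
  unfold goeConst
  have := Real.pi_pos
  positivity

theorem two_div_goeConst : 2 / goeConst = 4 / 3 * √(Real.pi / 3) := by
  have h3 : 0 < √(3 / Real.pi) := Real.sqrt_pos.2 (div_pos (by norm_num) Real.pi_pos)
  have h : √(Real.pi / 3) = (√(3 / Real.pi))⁻¹ := by
    rw [← Real.sqrt_inv, inv_div]
  rw [goeConst, h]
  field_simp
  norm_num

theorem tendsto_mobius_atTop {c : ℝ} (hc : 0 < c) :
    Tendsto (fun σ : ℝ => (2 + σ * c) / (2 - σ * c)) (𝓝[<] (2 / c)) atTop := by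
  have h1 : Tendsto (fun σ : ℝ => 2 + σ * c) (𝓝[<] (2 / c)) (𝓝 4) := by
    have : ContinuousAt (fun σ : ℝ => 2 + σ * c) (2 / c) := by fun_prop
    have h := this.tendsto.mono_left (nhdsWithin_le_nhds (s := Set.Iio (2 / c)))
    rwa [div_mul_cancel₀ _ hc.ne', show (2 : ℝ) + 2 = 4 by norm_num] at h
  have h2 : Tendsto (fun σ : ℝ => 2 - σ * c) (𝓝[<] (2 / c)) (𝓝[>] 0) := by
    refine tendsto_nhdsWithin_iff.2 ⟨?_, ?_⟩
    · have : ContinuousAt (fun σ : ℝ => 2 - σ * c) (2 / c) := by fun_prop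
      have h := this.tendsto.mono_left (nhdsWithin_le_nhds (s := Set.Iio (2 / c)))
      rwa [div_mul_cancel₀ _ hc.ne', sub_self] at h
    · filter_upwards [self_mem_nhdsWithin] with σ hσ
      exact sub_pos.2 ((lt_div_iff₀ hc).1 hσ)
  exact (h1.pos_mul_atTop (by norm_num) h2.inv_tendsto_nhdsGT_zero).congr fun σ =>
    (div_eq_mul_inv _ _).symm

theorem isBigO_mobius_sub {c : ℝ} (hc : 0 < c) :
    (fun σ : ℝ => (2 + σ * c) / (2 - σ * c) - (1 + σ * c)) =O[𝓝[>] 0] fun σ : ℝ => σ ^ 2 := by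
  refine IsBigO.of_bound (c ^ 2) ?_
  filter_upwards [Ioo_mem_nhdsGT (show (0 : ℝ) < 1 / c by positivity)] with σ hσ
  have h1 : σ * c < 1 := (lt_div_iff₀ hc).1 hσ.2
  have h2 : (2 + σ * c) / (2 - σ * c) - (1 + σ * c) = (c ^ 2 * σ ^ 2) / (2 - σ * c) := by
    have : 2 - σ * c ≠ 0 := by linarith
    field_simp
    ring
  rw [h2, Real.norm_of_nonneg (div_nonneg (by positivity) (by linarith)),
    Real.norm_of_nonneg (by positivity)]
  exact div_le_self (by positivity) (by linarith)

theorem indicator_detPosEvent {Ω : Type*} (N : Ω → Matrix (Fin 3) (Fin 3) ℝ) (σ : ℝ) :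
    (detPosEvent N σ).indicator (fun ω => jacobianCond (1 + σ • N ω)) =
      fun ω => truncCond (1 + σ • matUnvec (matVec (N ω))) := by
  ext ω
  rw [matUnvec_matVec]
  by_cases h : ω ∈ detPosEvent N σ
  · rw [Set.indicator_of_mem h, truncCond, if_pos (by exact h)]
  · rw [Set.indicator_of_notMem h, truncCond, if_neg (by exact h)]

section Transfer

variable {Ω : Type*} [MeasurableSpace Ω] {P : Measure Ω}
  {N : Ω → Matrix (Fin 3) (Fin 3) ℝ}

theorem hasLaw_matVec (hlaw : ∀ i j, HasLaw (fun ω => N ω i j) (gaussianReal 0 1) P)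
    (hindep : iIndepFun (fun (p : Fin 3 × Fin 3) (ω : Ω) => N ω p.1 p.2) P) :
    HasLaw (fun ω => matVec (N ω)) matGaussian P := by
  have h1 := iIndepFun.hasLaw_pi (fun p : Fin 3 × Fin 3 => hlaw p.1 p.2) hindep
  have h2 : HasLaw (WithLp.toLp 2 : (Fin 3 × Fin 3 → ℝ) → EuclideanSpace ℝ (Fin 3 × Fin 3))
      matGaussian (Measure.pi fun _ => gaussianReal 0 1) :=
    ⟨by fun_prop, map_pi_eq_stdGaussian⟩
  exact h2.comp h1

theorem measure_detPosEvent (hN : HasLaw (fun ω => matVec (N ω)) matGaussian P) (σ : ℝ) :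
    P (detPosEvent N σ) = matGaussian {x | 0 < (1 + σ • matUnvec x).det} :=
  hN.measure_eq (measurableSet_det_one_add_smul_pos σ)

/-- The entries of `N` are only almost everywhere measurable, so null measurability is the natural
form here. -/
theorem nullMeasurableSet_detPosEvent (hN : HasLaw (fun ω => matVec (N ω)) matGaussian P)
    (σ : ℝ) : NullMeasurableSet (detPosEvent N σ) P :=
  hN.aemeasurable.nullMeasurableSet_preimage (measurableSet_det_one_add_smul_pos σ)

theorem integrable_jacobianCond (hN : HasLaw (fun ω => matVec (N ω)) matGaussian P) {σ : ℝ}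
    (hσ : 0 < σ) : Integrable (fun ω => jacobianCond (1 + σ • N ω)) (cond P (detPosEvent N σ)) := by
  refine Integrable.smul_measure ?_ ?_
  · have h := integrable_truncCond hσ
    rw [← hN.map_eq] at h
    have h2 := h.comp_aemeasurable hN.aemeasurable
    rw [Function.comp_def, ← indicator_detPosEvent] at h2
    have h3 := h2.integrableOn (s := detPosEvent N σ)
    refine h3.congr_fun_ae ?_
    filter_upwards [ae_restrict_mem₀ (nullMeasurableSet_detPosEvent hN σ)] with ω hω
    exact Set.indicator_of_mem hω _
  · rw [measure_detPosEvent hN]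
    exact ENNReal.inv_ne_top.2 (matGaussian_det_pos_ne_zero hσ)

theorem expectedCond_eq (hN : HasLaw (fun ω => matVec (N ω)) matGaussian P) (σ : ℝ) :
    expectedCond P N σ = (matGaussian.real {x | 0 < (1 + σ • matUnvec x).det})⁻¹ *
      ∫ x, truncCond (1 + σ • matUnvec x) ∂matGaussian := by
  have h := hN.integral_comp (measurable_truncCond_one_add_smul σ).aestronglyMeasurable
  rw [Function.comp_def, ← indicator_detPosEvent,
    integral_indicator₀ (nullMeasurableSet_detPosEvent hN σ)] at h
  rw [expectedCond, ProbabilityTheory.cond, integral_smul_measure, h, measure_detPosEvent hN, ENNReal.toReal_inv,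
    smul_eq_mul]
  rfl

theorem tendsto_measure_detPosEvent [IsProbabilityMeasure P]
    (hN : HasLaw (fun ω => matVec (N ω)) matGaussian P) :
    Tendsto (fun σ : ℝ => P (detPosEvent N σ)) (𝓝[>] 0) (𝓝 1) := by
  obtain ⟨C, -, hC⟩ := exists_one_sub_le_measureReal_det_pos
  have h1 : Tendsto (fun σ : ℝ => 1 - C * σ ^ 2) (𝓝[>] 0) (𝓝 1) := by
    have : ContinuousAt (fun σ : ℝ => 1 - C * σ ^ 2) 0 := by fun_prop
    simpa using this.tendsto.mono_left (nhdsWithin_le_nhds (s := Set.Ioi 0))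
  refine tendsto_of_tendsto_of_tendsto_of_le_of_le' (ENNReal.ofReal_one ▸ ENNReal.tendsto_ofReal h1)
    tendsto_const_nhds ?_ (Eventually.of_forall fun σ => prob_le_one)
  filter_upwards [self_mem_nhdsWithin] with σ hσ
  rw [measure_detPosEvent hN]
  exact (ENNReal.ofReal_le_ofReal (hC σ hσ)).trans_eq (ofReal_measureReal)

theorem isBigO_expectedCond_sub (hN : HasLaw (fun ω => matVec (N ω)) matGaussian P) :
    (fun σ : ℝ => expectedCond P N σ - (1 + σ * goeConst)) =O[𝓝[>] 0] fun σ : ℝ => σ ^ 2 := by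
  obtain ⟨A, hA0, hA⟩ := exists_abs_integral_truncCond_sub_le
  obtain ⟨B, hB0, hB⟩ := exists_one_sub_le_measureReal_det_pos
  have hc := goeConst_pos
  -- `A` controls the unconditioned error; the other term bounds the effect of dividing by `q`,
  -- using `q ≥ 1/2`, `1 - q ≤ Bσ²` and a uniform bound on the numerator for `σ < 1`.
  refine IsBigO.of_bound (A + 2 * (1 + goeConst + A) * B) ?_
  have hsmall : ∀ᶠ σ : ℝ in 𝓝[>] 0, B * σ ^ 2 < 1 / 2 := by
    have : ContinuousAt (fun σ : ℝ => B * σ ^ 2) 0 := by fun_prop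
    exact (this.tendsto.mono_left (nhdsWithin_le_nhds (s := Set.Ioi 0))).eventually
      (gt_mem_nhds (by norm_num))
  filter_upwards [hsmall, Ioo_mem_nhdsGT (zero_lt_one' ℝ)] with σ hσB hσ
  have h1 := hA σ hσ.1 hσ.2.le
  have h2 := hB σ hσ.1
  rw [expectedCond_eq hN]
  set T := ∫ x, truncCond (1 + σ • matUnvec x) ∂matGaussian
  set q := matGaussian.real {x | 0 < (1 + σ • matUnvec x).det}
  have hq1 : q ≤ 1 := measureReal_le_one
  have hq : 1 / 2 ≤ q := by linarith
  have hq0 : 0 < q := by linarith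
  have hT0 : 0 ≤ T := integral_nonneg fun x => truncCond_nonneg _
  have hT : T ≤ 1 + goeConst + A := by
    have h3 := (abs_le.1 h1).2
    have h4 : σ * goeConst ≤ goeConst := mul_le_of_le_one_left hc.le hσ.2.le
    have h5 : A * σ ^ 2 ≤ A := mul_le_of_le_one_right hA0 (pow_le_one₀ hσ.1.le hσ.2.le)
    linarith
  have h6 : 0 ≤ q⁻¹ * T - T := by
    have : T ≤ q⁻¹ * T := le_mul_of_one_le_left hT0 ((one_le_inv₀ hq0).2 hq1)
    linarith
  have h7 : q⁻¹ * T - T ≤ 2 * (1 + goeConst + A) * (B * σ ^ 2) := by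
    calc q⁻¹ * T - T = q⁻¹ * T * (1 - q) := by field_simp
      _ ≤ 2 * (1 + goeConst + A) * (B * σ ^ 2) := by
        have hi : q⁻¹ ≤ 2 := by
          rw [inv_le_comm₀ hq0 two_pos]
          linarith
        have : 0 ≤ 1 - q := by linarith
        gcongr
        linarith
  rw [Real.norm_eq_abs, Real.norm_of_nonneg (by positivity)]
  have h8 := abs_le.1 h1
  refine abs_le.2 ⟨?_, ?_⟩ <;> nlinarith

end Transfer

end

theorem mainTheorem8 {Ω : Type*} [MeasurableSpace Ω] (P : Measure Ω) [IsProbabilityMeasure P]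
    (N : Ω → Matrix (Fin 3) (Fin 3) ℝ)
    (hlaw : ∀ i j, HasLaw (fun ω => N ω i j) (gaussianReal 0 1) P)
    (hindep : iIndepFun (fun (p : Fin 3 × Fin 3) (ω : Ω) => N ω p.1 p.2) P) :
    -- `κ` is the quotient `(s₁ + s₂) / (s₂ + s₃)` of singular values wherever `det M > 0`
    (∀ M : Matrix (Fin 3) (Fin 3) ℝ, 0 < M.det →
      jacobianCond M = (singVal M 0 + singVal M 1) / (singVal M 1 + singVal M 2)) ∧
    -- `c₃` is the expected largest eigenvalue of `(N + Nᵀ) / 2`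
    (Integrable (fun ω => largestEigSymPart (N ω)) P ∧
      ∫ ω, largestEigSymPart (N ω) ∂P = goeConst) ∧
    -- `det M > 0` holds with high probability for small `σ`
    Tendsto (fun σ : ℝ => P (detPosEvent N σ)) (𝓝[>] 0) (𝓝 1) ∧
    -- the expectation of `κ` given `det M > 0` exists, for every `σ > 0`
    (∀ σ : ℝ, 0 < σ → P (detPosEvent N σ) ≠ 0 ∧
      Integrable (fun ω => jacobianCond (1 + σ • N ω))
        (ProbabilityTheory.cond P (detPosEvent N σ))) ∧
    -- the leading-order formula and its expansion
    (fun σ : ℝ => expectedCond P N σ - (2 + σ * goeConst) / (2 - σ * goeConst))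
      =O[𝓝[>] 0] (fun σ : ℝ => σ ^ 2) ∧
    (fun σ : ℝ => expectedCond P N σ - (1 + σ * goeConst)) =O[𝓝[>] 0] (fun σ : ℝ => σ ^ 2) ∧
    -- the formula diverges as `σ` increases to `2 / c₃`
    Tendsto (fun σ : ℝ => (2 + σ * goeConst) / (2 - σ * goeConst))
      (𝓝[<] (2 / goeConst)) atTop ∧
    2 / goeConst = 4 / 3 * Real.sqrt (Real.pi / 3) := by

  have hN := hasLaw_matVec hlaw hindep
  have hO := isBigO_expectedCond_sub hN
  obtain ⟨hi, he⟩ := integrable_and_integral_largestEigSymPart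
  refine ⟨jacobianCond_eq, ⟨?_, ?_⟩, tendsto_measure_detPosEvent hN,
    fun σ hσ => ⟨measure_detPosEvent hN σ ▸ matGaussian_det_pos_ne_zero hσ,
      integrable_jacobianCond hN hσ⟩, ?_, hO, tendsto_mobius_atTop goeConst_pos, two_div_goeConst⟩
  · rw [← hN.map_eq] at hi
    exact hi.comp_aemeasurable hN.aemeasurable
  · exact (hN.integral_comp measurable_largestEigSymPart.aestronglyMeasurable).trans he
  · refine (hO.sub (isBigO_mobius_sub goeConst_pos)).congr_left fun σ => ?_
    ring
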